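/- All rings are commutative; local rings are noetherian. Let $A$ be such a local ring. A finitely generated $A$-module $C$ is \emph{semidualizing} if the homothety map $A\to\operatorname{Hom}_A(C,C)$, $a\mapsto(c\mapsto ac)$, is an isomorphism and $\operatorname{Ext}^i_A(C,C)=0$ for all $i\ge 1$; it is \emph{dualizing} if moreover it has finite injective dimension. A local ring is \emph{Gorenstein} if it has finite injective dimension over itself. A complex $T$ of finitely generated free $A$-modules, indexed by $\mathbb{Z}$, is \emph{totally acyclic} if $T$ and $\operatorname{Hom}_A(T,A)$ are exact. A \emph{Tate resolution} of a finitely generated $A$-module $M$ is a diagram of chain maps $T\xrightarrow{\alpha}P\xrightarrow{\beta}M$ with $T$ totally acyclic, $P$ a resolution of $M$ by finitely generated free modules with augmentation $\beta$, and $\alpha_i$ an isomorphism for $i\gg 0$. For such a resolution and an $A$-module $N$, put $\widehat{\operatorname{Tor}}{}^A_i(M,N)=\operatorname{H}_i(T\otimes_A N)$ and $\widehat{\operatorname{Ext}}{}_A^i(M,N)=\operatorname{H}_{-i}(\operatorname{Hom}_A(T,N))$ for $i\in\mathbb{Z}$; these modules do not depend, up to isomorphism, on the choice of the Tate resolution,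 and every finitely generated module over a Gorenstein local ring has one. \textbf{Theorem.} Let $R$ be a local Cohen--Macaulay ring with a dualizing module. Then $R$ admits a semidualizing module that is neither dualizing nor free if and only if there exist a Gorenstein local ring $Q$ and ideals $I_1,I_2\subset Q$ satisfying the following conditions: \begin{enumerate} \item[(1)] there is a ring isomorphism $R\cong Q/(I_1+I_2)$; \item[(2)] for $j=1,2$ the quotient ring $Q/I_j$ is Cohen--Macaulay and not Gorenstein; \item[(3)] for all $i\in\mathbb{Z}$ we have $\widehat{\operatorname{Tor}}{}^Q_i(Q/I_1,Q/I_2)=0=\widehat{\operatorname{Ext}}{}^i_Q(Q/I_1,Q/I_2)$; \item[(4)] there exists an integer $c$ such that $\operatorname{Ext}^c_Q(Q/I_1,Q/I_2)$ is not cyclic; and \item[(5)] for all $i\ge 1$ we have $\operatorname{Tor}^Q_i(Q/I_1,Q/I_2)=0$. \end{enumerate} Moreover, any $Q,I_1,I_2$ satisfying these conditions have $I_1\cap I_2=I_1I_2$. -/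

import Mathlib

open CategoryTheory
open scoped TensorProduct

universe u

noncomputable section

namespace SemidualizingPresentation

/-- The depth of a local ring: the supremum of the lengths of regular sequences
in its maximal ideal. -/
def depth (A : Type u) [CommRing A] [IsLocalRing A] : ℕ∞ :=
  ⨆ rs : {rs : List A // (∀ r ∈ rs, r ∈ IsLocalRing.maximalIdeal A) ∧
    RingTheory.Sequence.IsRegular A rs}, (rs.1.length : ℕ∞)

/-- A Cohen–Macaulay (noetherian) local ring. -/
structure IsCohenMacaulayLocal (A : Type u) [CommRing A] : Prop
    extends IsLocalRing A, IsNoetherianRing A where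
  depth_eq : (depth A : WithBot ℕ∞) = ringKrullDim A

/-- A Gorenstein (noetherian) local ring: the injective dimension of the ring, as a module over
itself, is finite. -/
structure IsGorensteinLocal (A : Type u) [CommRing A] : Prop
    extends IsLocalRing A, IsNoetherianRing A where
  finite_injDim : ∃ n : ℕ, HasInjectiveDimensionLE (ModuleCat.of A A) n

section Modules

variable {A : Type u} [CommRing A]

/-- A semidualizing module. The map `LinearMap.lsmul A C : A → Hom(C, C)`, `a ↦ (c ↦ a • c)`,
is the homothety homomorphism. -/
structure IsSemidualizing (C : ModuleCat.{u} A) : Prop where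
  finite : Module.Finite A C
  homothety_bijective : Function.Bijective (LinearMap.lsmul A C)
  ext_eq_zero : ∀ i : ℕ, 1 ≤ i → Subsingleton (Abelian.Ext C C i)

/-- A dualizing module. -/
structure IsDualizing (D : ModuleCat.{u} A) : Prop extends IsSemidualizing D where
  finite_injDim : ∃ n : ℕ, HasInjectiveDimensionLE D n

/-- The complex `T ⊗ N`. -/
def tensorComplex (T : ChainComplex (ModuleCat.{u} A) ℤ) (N : ModuleCat.{u} A) :
    ChainComplex (ModuleCat.{u} A) ℤ where
  X i := ModuleCat.of A (T.X i ⊗[A] N)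
  d i j := ModuleCat.ofHom ((T.d i j).hom.rTensor N)
  shape i j hij := by
    rw [T.shape i j hij]
    ext : 1
    simp
  d_comp_d' i j k _ _ := by
    rw [← ModuleCat.ofHom_comp, ← LinearMap.rTensor_comp, ← ModuleCat.hom_comp, T.d_comp_d]
    ext : 1
    simp

/-- The complex `Hom(T, N)`, in cohomological grading: in degree `i` it is `Hom(T_i, N)`, so that
its `i`-th cohomology is `H_{-i}(Hom(T, N))` in homological grading. -/
def homComplex (T : ChainComplex (ModuleCat.{u} A) ℤ) (N : ModuleCat.{u} A) :
    CochainComplex (ModuleCat.{u} A) ℤ where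
  X i := ModuleCat.of A (T.X i →ₗ[A] N)
  d i j := ModuleCat.ofHom (LinearMap.lcomp A N (T.d j i).hom)
  shape i j hij := by
    rw [T.shape j i hij]
    ext : 3
    simp
  d_comp_d' i j k _ _ := by
    ext f x
    change f ((T.d k j ≫ T.d j i).hom x) = 0
    rw [T.d_comp_d]
    simp

/-- A totally acyclic complex. -/
structure IsTotallyAcyclic (T : ChainComplex (ModuleCat.{u} A) ℤ) : Prop where
  finite : ∀ i, Module.Finite A (T.X i)
  free : ∀ i, Module.Free A (T.X i)
  acyclic : T.Acyclic
  acyclic_dual : (homComplex T (ModuleCat.of A A)).Acyclic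

/-- A Tate resolution `T → P → M`, where `M` is a complex concentrated in degree zero. -/
structure TateResolution (M : ModuleCat.{u} A) where
  T : ChainComplex (ModuleCat.{u} A) ℤ
  P : ChainComplex (ModuleCat.{u} A) ℤ
  α : T ⟶ P
  β : P ⟶ (HomologicalComplex.single (ModuleCat.{u} A) (ComplexShape.down ℤ) 0).obj M
  totallyAcyclic : IsTotallyAcyclic T
  isIso_α : ∃ n : ℤ, ∀ i : ℤ, n ≤ i → IsIso (α.f i)
  finite_P : ∀ i, Module.Finite A (P.X i)
  free_P : ∀ i, Module.Free A (P.X i)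
  isZero_P : ∀ i : ℤ, i < 0 → Limits.IsZero (P.X i)
  quasiIso_β : QuasiIso β

/-- Tate homology of `(M, N)`, computed from a Tate resolution of `M`. -/
def TateResolution.tateTor {M : ModuleCat.{u} A} (F : TateResolution M) (N : ModuleCat.{u} A)
    (i : ℤ) : ModuleCat.{u} A :=
  (tensorComplex F.T N).homology i

/-- Tate cohomology of `(M, N)`, computed from a Tate resolution of `M`. -/
def TateResolution.tateExt {M : ModuleCat.{u} A} (F : TateResolution M) (N : ModuleCat.{u} A)
    (i : ℤ) : ModuleCat.{u} A :=
  (homComplex F.T N).homology i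

/-- All Tate homology and Tate cohomology modules of `(M, N)` exist and are zero: `M` has a Tate
resolution, and the modules computed from it vanish in every degree. (Different Tate resolutions
of `M` give isomorphic modules.) -/
def TateVanishing (M N : ModuleCat.{u} A) : Prop :=
  ∃ F : TateResolution M, ∀ i : ℤ,
    Limits.IsZero (F.tateTor N i) ∧ Limits.IsZero (F.tateExt N i)

/-- `Tor_i(M, N) = 0` for all `i ≥ 1`, where `Tor_i(-, N)` is the left derived functor
of `- ⊗ N`. -/
def TorIndependent (M N : ModuleCat.{u} A) : Prop :=
  ∀ i : ℕ, 1 ≤ i → Limits.IsZero (((Tor' (ModuleCat.{u} A) i).obj M).obj N)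

end Modules

/-- `B` is presented as `Q/(I₁ + I₂)` with `Q` Gorenstein local and `I₁`, `I₂`
cohomologically independent. -/
structure IsIndependentPresentation (B : Type u) [CommRing B] (Q : Type u) [CommRing Q]
    (I₁ I₂ : Ideal Q) : Prop where
  gorenstein : IsGorensteinLocal Q
  ringEquiv : Nonempty (B ≃+* Q ⧸ (I₁ ⊔ I₂))
  cohenMacaulay₁ : IsCohenMacaulayLocal (Q ⧸ I₁)
  cohenMacaulay₂ : IsCohenMacaulayLocal (Q ⧸ I₂)
  not_gorenstein₁ : ¬ IsGorensteinLocal (Q ⧸ I₁)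
  not_gorenstein₂ : ¬ IsGorensteinLocal (Q ⧸ I₂)
  tate_eq_zero : TateVanishing (ModuleCat.of Q (Q ⧸ I₁)) (ModuleCat.of Q (Q ⧸ I₂))
  ext_not_cyclic : ∃ c : ℕ, ¬ (⊤ : Submodule Q
    (Abelian.Ext (ModuleCat.of Q (Q ⧸ I₁)) (ModuleCat.of Q (Q ⧸ I₂)) c)).IsPrincipal
  tor_eq_zero : TorIndependent (ModuleCat.of Q (Q ⧸ I₁)) (ModuleCat.of Q (Q ⧸ I₂))

end SemidualizingPresentation

end

open SemidualizingPresentation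

/-! Write `A ⋉ W` for the trivial extension `TrivExt A W`. In both directions the link between the
ring side and the module side is the dual `Hom_S(R, S)`, for a ring `S` mapping onto `R`.

From a semidualizing `C` to a presentation: let `D` be dualizing and put `S = R ⋉ C`. Then `Hom_S(R,
S) ≅ C`, and `R` is totally reflexive over `S` (`TrivExt.tr_base`). The module `W = Hom_R(S, D)` is
dualizing for `S`, so `Q = S ⋉ W` is Gorenstein: it is the coextension of `W` from `S` to `Q`. Take
`I₂ = 0 ⋉ W`, so that `Q/I₂ = S`, and let `I₁` be the kernel of `Q → R ⋉ Hom(C, D)`. The crucial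
identification is `Q/I₁ ≅ Q ⊗_S R`. Splicing syzygies and cosyzygies of `R` over `S` gives a doubly
infinite exact complex `T` of free modules. It stays exact under `Q ⊗_S -`, because modules of
finite injective dimension are Tor-independent of totally reflexive ones (`rTensor_hom_injective`).
Tensoring the result with `Q/I₂ = S`, or mapping it into `S`, gives back `T` and `Hom_S(T, S)`, both
exact; this yields the Tate and Tor vanishing (`tateVanishing_doubleExt`). Moreover `Hom_Q(Q/I₁,
Q/I₂)` is `C`, which would be free if it were cyclic. If `Q/I₂ = R ⋉ C` were Gorenstein, `C` would
be dualizing. If `Q/I₁` were, `Hom(C, D)` would have finite injective dimension and `C` would be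
free, by a count of generators.

From a presentation to `C`: put `S = Q/I₂`, so `R ≅ S ⊗_Q Q/I₁`. Tate vanishing makes the high
syzygies of `Q/I₁` totally reflexive after base change to `S`, and Tor-independence base changes the
remaining finite piece of the resolution. So `R` has finite G-dimension over `S`
(`GdimLE.of_tateVanishing`). Dividing `S` by regular elements that annihilate `R` keeps the
G-dimension finite. Once `Hom_S(R, S) ≠ 0`, a depth comparison using that `R` is Cohen–Macaulay
makes `R` totally reflexive, and `C = Hom_S(R, S)` is semidualizing
(`exists_semidualizing_of_gdimLE`). If `C` were dualizing, `S` would be Gorenstein. If `C` were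
free, hence isomorphic to `R`, then `Ext_Q(Q/I₁, Q/I₂)` would be zero except in one degree and
cyclic there, contradicting (4).

The last assertion is the vanishing of `Tor₁(Q/I₁, Q/I₂) = (I₁ ∩ I₂)/I₁I₂`. -/

namespace SemidualizingPresentation

/-! ### Short exact sequences of modules -/

section SES

variable {A : Type u} [CommRing A]

/-- A short exact sequence `0 → M₁ → M₂ → M₃ → 0` of modules. -/
structure SES {M₁ M₂ M₃ : Type*} [AddCommGroup M₁] [AddCommGroup M₂] [AddCommGroup M₃]
    [Module A M₁] [Module A M₂] [Module A M₃] (f : M₁ →ₗ[A] M₂) (g : M₂ →ₗ[A] M₃) : Prop where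
  inj : Function.Injective f
  exact : Function.Exact f g
  surj : Function.Surjective g

theorem SES.of_surjective {M₂ M₃ : Type*} [AddCommGroup M₂] [AddCommGroup M₃]
    [Module A M₂] [Module A M₃] {g : M₂ →ₗ[A] M₃} (hg : Function.Surjective g) :
    SES (LinearMap.ker g).subtype g :=
  ⟨Subtype.val_injective, LinearMap.exact_subtype_ker_map g, hg⟩

theorem SES.of_injective {M₁ M₂ : Type*} [AddCommGroup M₁] [AddCommGroup M₂]
    [Module A M₁] [Module A M₂] {f : M₁ →ₗ[A] M₂} (hf : Function.Injective f) :
    SES f (LinearMap.range f).mkQ :=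
  ⟨hf, f.exact_map_mkQ_range, Submodule.mkQ_surjective _⟩

end SES

/-! ### Vanishing of Ext along short exact sequences -/

section ExtV

variable (A : Type u) [CommRing A]

/-- The module `Extⁱ(M, N)` is zero. -/
def ExtV (M N : Type u) [AddCommGroup M] [AddCommGroup N] [Module A M] [Module A N] (i : ℕ) :
    Prop :=
  Subsingleton (Abelian.Ext (ModuleCat.of A M) (ModuleCat.of A N) i)

variable {A}
variable {M N M₁ M₂ M₃ N₁ N₂ N₃ : Type u} [AddCommGroup M] [AddCommGroup N]
  [AddCommGroup M₁] [AddCommGroup M₂] [AddCommGroup M₃]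
  [AddCommGroup N₁] [AddCommGroup N₂] [AddCommGroup N₃]
  [Module A M] [Module A N] [Module A M₁] [Module A M₂] [Module A M₃]
  [Module A N₁] [Module A N₂] [Module A N₃]

/-- A short exact sequence of modules as a short complex. -/
abbrev SES.sc {f : M₁ →ₗ[A] M₂} {g : M₂ →ₗ[A] M₃} (h : SES f g) :
    ShortComplex (ModuleCat.{u} A) :=
  ModuleCat.shortComplexOfCompEqZero f g h.exact.linearMap_comp_eq_zero

theorem SES.shortExact {f : M₁ →ₗ[A] M₂} {g : M₂ →ₗ[A] M₃} (h : SES f g) : h.sc.ShortExact :=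
  ModuleCat.shortComplex_shortExact _ h.exact h.inj h.surj

theorem extV_iff {i : ℕ} : ExtV A M N i ↔
    ∀ x : Abelian.Ext (ModuleCat.of A M) (ModuleCat.of A N) i, x = 0 :=
  subsingleton_iff_forall_eq 0

theorem extV_zero_iff : ExtV A M N 0 ↔ Subsingleton (M →ₗ[A] N) := by
  refine (Abelian.Ext.addEquiv₀.trans ModuleCat.homAddEquiv).subsingleton_congr

/-- Vanishing of Ext passes to retracts in the first variable. -/
theorem ExtV.retract {i : ℕ} (h : ExtV A M₂ N i) (s : M₁ →ₗ[A] M₂) (r : M₂ →ₗ[A] M₁)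
    (hrs : r ∘ₗ s = LinearMap.id) : ExtV A M₁ N i := by
  rw [extV_iff] at *
  intro x
  have := h ((Abelian.Ext.mk₀ (ModuleCat.ofHom r)).comp x (zero_add i))
  have h2 := congrArg (fun y => (Abelian.Ext.mk₀ (ModuleCat.ofHom s)).comp y (zero_add i)) this
  have h3 : ModuleCat.ofHom s ≫ ModuleCat.ofHom r = 𝟙 _ := by
    rw [← ModuleCat.ofHom_comp, hrs]; rfl
  simpa [h3] using h2

theorem ExtV.retract' {i : ℕ} (h : ExtV A M N₂ i) (s : N₁ →ₗ[A] N₂) (r : N₂ →ₗ[A] N₁)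
    (hrs : r ∘ₗ s = LinearMap.id) : ExtV A M N₁ i := by
  rw [extV_iff] at *
  intro x
  have := h (x.comp (Abelian.Ext.mk₀ (ModuleCat.ofHom s)) (add_zero i))
  have h2 := congrArg (fun y => y.comp (Abelian.Ext.mk₀ (ModuleCat.ofHom r)) (add_zero i)) this
  have h3 : ModuleCat.ofHom s ≫ ModuleCat.ofHom r = 𝟙 _ := by
    rw [← ModuleCat.ofHom_comp, hrs]; rfl
  simpa [h3] using h2

theorem ExtV.congr_left (e : M₁ ≃ₗ[A] M₂) {i : ℕ} (h : ExtV A M₁ N i) : ExtV A M₂ N i :=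
  h.retract e.symm.toLinearMap e.toLinearMap (by ext; simp)

theorem ExtV.congr_right (e : N₁ ≃ₗ[A] N₂) {i : ℕ} (h : ExtV A M N₁ i) : ExtV A M N₂ i :=
  h.retract' e.symm.toLinearMap e.toLinearMap (by ext; simp)

theorem extV_congr_left (e : M₁ ≃ₗ[A] M₂) {i : ℕ} : ExtV A M₁ N i ↔ ExtV A M₂ N i :=
  ⟨.congr_left e, .congr_left e.symm⟩

theorem extV_congr_right (e : N₁ ≃ₗ[A] N₂) {i : ℕ} : ExtV A M N₁ i ↔ ExtV A M N₂ i :=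
  ⟨.congr_right e, .congr_right e.symm⟩

theorem extV_of_projective [Module.Projective A M] {i : ℕ} : ExtV A M N (i + 1) := by
  have : Projective (ModuleCat.of A M) := (IsProjective.iff_projective (R := A) M).mp inferInstance
  exact extV_iff.mpr fun x => x.eq_zero_of_projective

theorem extV_of_projective' [Module.Projective A M] {i : ℕ} (hi : 1 ≤ i) : ExtV A M N i := by
  obtain ⟨i, rfl⟩ := Nat.exists_eq_add_of_le' hi
  exact extV_of_projective

theorem extV_of_injective [Module.Injective A N] {i : ℕ} : ExtV A M N (i + 1) := by
  have : Injective (ModuleCat.of A N) := Module.injective_object_of_injective_module A N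
  exact extV_iff.mpr fun x => x.eq_zero_of_injective

section contra

variable {f : M₁ →ₗ[A] M₂} {g : M₂ →ₗ[A] M₃} (h : SES f g)
include h

theorem SES.extV_mid {i : ℕ} (h₁ : ExtV A M₁ N i) (h₃ : ExtV A M₃ N i) : ExtV A M₂ N i := by
  rw [extV_iff] at *
  intro x
  obtain ⟨y, rfl⟩ := Abelian.Ext.contravariant_sequence_exact₂ h.shortExact _ x (h₁ _)
  rw [h₃ y]; simp

theorem SES.extV_left {i : ℕ} (h₂ : ExtV A M₂ N i) (h₃ : ExtV A M₃ N (i + 1)) :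
    ExtV A M₁ N i := by
  rw [extV_iff] at *
  intro x
  obtain ⟨y, rfl⟩ := Abelian.Ext.contravariant_sequence_exact₁ h.shortExact _ x (add_comm 1 i)
    (h₃ _)
  rw [h₂ y]; simp

theorem SES.extV_right {i : ℕ} (h₁ : ExtV A M₁ N i) (h₂ : ExtV A M₂ N (i + 1)) :
    ExtV A M₃ N (i + 1) := by
  rw [extV_iff] at *
  intro x
  obtain ⟨y, rfl⟩ := Abelian.Ext.contravariant_sequence_exact₃ h.shortExact _ x (h₂ _)
    (add_comm 1 i)
  rw [h₁ y]; simp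

end contra

section cov

variable {f : N₁ →ₗ[A] N₂} {g : N₂ →ₗ[A] N₃} (h : SES f g)
include h

theorem SES.extV_mid' {i : ℕ} (h₁ : ExtV A M N₁ i) (h₃ : ExtV A M N₃ i) : ExtV A M N₂ i := by
  rw [extV_iff] at *
  intro x
  obtain ⟨y, rfl⟩ := Abelian.Ext.covariant_sequence_exact₂ _ h.shortExact x (h₃ _)
  rw [h₁ y]; simp

theorem SES.extV_left' {i : ℕ} (h₃ : ExtV A M N₃ i) (h₂ : ExtV A M N₂ (i + 1)) :
    ExtV A M N₁ (i + 1) := by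
  rw [extV_iff] at *
  intro x
  obtain ⟨y, rfl⟩ := Abelian.Ext.covariant_sequence_exact₁ _ h.shortExact x (h₂ _) rfl
  rw [h₃ y]; simp

theorem SES.extV_right' {i : ℕ} (h₂ : ExtV A M N₂ i) (h₁ : ExtV A M N₁ (i + 1)) :
    ExtV A M N₃ i := by
  rw [extV_iff] at *
  intro x
  obtain ⟨y, rfl⟩ := Abelian.Ext.covariant_sequence_exact₃ _ h.shortExact x rfl (h₁ _)
  rw [h₂ y]; simp

end cov

/-- `Ext¹` is the obstruction to extending maps. This lemma and the three after it let degree-one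
vanishing be handled by linear maps alone; they supply the base cases of the dimension shifts below.
-/
theorem SES.exists_extend {f : M₁ →ₗ[A] M₂} {g : M₂ →ₗ[A] M₃} (h : SES f g)
    (h₃ : ExtV A M₃ N 1) (φ : M₁ →ₗ[A] N) : ∃ ψ : M₂ →ₗ[A] N, ψ ∘ₗ f = φ := by
  rw [extV_iff] at h₃
  obtain ⟨y, hy⟩ := Abelian.Ext.contravariant_sequence_exact₁ h.shortExact _
    (Abelian.Ext.mk₀ (ModuleCat.ofHom φ)) (add_comm 1 0) (h₃ _)
  obtain ⟨ψ, rfl⟩ := (Abelian.Ext.mk₀_bijective _ _).2 y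
  refine ⟨ψ.hom, ?_⟩
  rw [Abelian.Ext.mk₀_comp_mk₀] at hy
  have := (Abelian.Ext.mk₀_bijective _ _).1 hy
  exact congrArg ModuleCat.Hom.hom this

theorem SES.extV_one_of_extend {f : M₁ →ₗ[A] M₂} {g : M₂ →ₗ[A] M₃} (h : SES f g)
    (h₂ : ExtV A M₂ N 1) (H : ∀ φ : M₁ →ₗ[A] N, ∃ ψ : M₂ →ₗ[A] N, ψ ∘ₗ f = φ) :
    ExtV A M₃ N 1 := by
  rw [extV_iff] at *
  intro x
  obtain ⟨y, rfl⟩ := Abelian.Ext.contravariant_sequence_exact₃ h.shortExact _ x (h₂ _)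
    (add_comm 1 0)
  obtain ⟨φ, rfl⟩ := (Abelian.Ext.mk₀_bijective _ _).2 y
  obtain ⟨ψ, hψ⟩ := H φ.hom
  have : φ = h.sc.f ≫ ModuleCat.ofHom ψ := by
    ext1; exact hψ.symm
  rw [this, ← Abelian.Ext.mk₀_comp_mk₀]
  exact h.shortExact.extClass_comp_assoc _

theorem SES.exists_lift {f : N₁ →ₗ[A] N₂} {g : N₂ →ₗ[A] N₃} (h : SES f g)
    (h₁ : ExtV A M N₁ 1) (φ : M →ₗ[A] N₃) : ∃ ψ : M →ₗ[A] N₂, g ∘ₗ ψ = φ := by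
  rw [extV_iff] at h₁
  obtain ⟨y, hy⟩ := Abelian.Ext.covariant_sequence_exact₃ _ h.shortExact
    (Abelian.Ext.mk₀ (ModuleCat.ofHom φ)) (zero_add 1) (h₁ _)
  obtain ⟨ψ, rfl⟩ := (Abelian.Ext.mk₀_bijective _ _).2 y
  refine ⟨ψ.hom, ?_⟩
  rw [Abelian.Ext.mk₀_comp_mk₀] at hy
  have := (Abelian.Ext.mk₀_bijective _ _).1 hy
  exact congrArg ModuleCat.Hom.hom this

theorem SES.extV_one_of_lift {f : N₁ →ₗ[A] N₂} {g : N₂ →ₗ[A] N₃} (h : SES f g)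
    (h₂ : ExtV A M N₂ 1) (H : ∀ φ : M →ₗ[A] N₃, ∃ ψ : M →ₗ[A] N₂, g ∘ₗ ψ = φ) :
    ExtV A M N₁ 1 := by
  rw [extV_iff] at *
  intro x
  obtain ⟨y, rfl⟩ := Abelian.Ext.covariant_sequence_exact₁ _ h.shortExact x (h₂ _) (zero_add 1)
  obtain ⟨φ, rfl⟩ := (Abelian.Ext.mk₀_bijective _ _).2 y
  obtain ⟨ψ, hψ⟩ := H φ.hom
  have : φ = ModuleCat.ofHom ψ ≫ h.sc.g := by
    ext1; exact hψ.symm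
  rw [this, ← Abelian.Ext.mk₀_comp_mk₀, Abelian.Ext.comp_assoc_of_second_deg_zero,
    h.shortExact.comp_extClass, Abelian.Ext.comp_zero]

theorem extV_of_subsingleton_left [Subsingleton M] {i : ℕ} : ExtV A M N i := by
  cases i with
  | zero => rw [extV_zero_iff]; infer_instance
  | succ i =>
    have : Module.Projective A M := Module.Projective.of_free
    exact extV_of_projective

theorem ExtV.prod {i : ℕ} (h₁ : ExtV A M₁ N i) (h₂ : ExtV A M₂ N i) : ExtV A (M₁ × M₂) N i := by
  have h : SES (LinearMap.inl A M₁ M₂) (LinearMap.snd A M₁ M₂) :=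
    ⟨LinearMap.inl_injective, .inl_snd, LinearMap.snd_surjective⟩
  exact h.extV_mid h₁ h₂

theorem ExtV.prod' {i : ℕ} (h₁ : ExtV A M N₁ i) (h₂ : ExtV A M N₂ i) : ExtV A M (N₁ × N₂) i := by
  have h : SES (LinearMap.inl A N₁ N₂) (LinearMap.snd A N₁ N₂) :=
    ⟨LinearMap.inl_injective, .inl_snd, LinearMap.snd_surjective⟩
  exact h.extV_mid' h₁ h₂

theorem ExtV.pow {i : ℕ} (h : ExtV A M N i) (m : ℕ) : ExtV A (Fin m → M) N i := by
  induction m with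
  | zero => exact extV_of_subsingleton_left
  | succ m ih => exact (h.prod ih).congr_left (Fin.consLinearEquiv A (fun _ => M))

theorem ExtV.pow' {i : ℕ} (h : ExtV A M N i) (m : ℕ) : ExtV A M (Fin m → N) i := by
  induction m with
  | zero =>
    have : Subsingleton (Fin 0 → N) := inferInstance
    exact ExtV.retract' h (0 : (Fin 0 → N) →ₗ[A] N) 0 (Subsingleton.elim _ _)
  | succ m ih => exact (h.prod' ih).congr_right (Fin.consLinearEquiv A (fun _ => N))

/-- If multiplication by an element of the maximal ideal is injective on `M₂` with cokernel `M₃` and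
`Extⁱ⁺¹(M₃, N) = 0`, then `Extⁱ(M₂, N) = 0`. -/
theorem SES.extV_nakayama [IsLocalRing A] [IsNoetherianRing A] [Module.Finite A M₂]
    [Module.Finite A N] {x : A} (hx : x ∈ IsLocalRing.maximalIdeal A) {g : M₂ →ₗ[A] M₃}
    (h : SES (x • LinearMap.id : M₂ →ₗ[A] M₂) g) {i : ℕ} (h₃ : ExtV A M₃ N (i + 1)) :
    ExtV A M₂ N i := by
  -- By the long exact sequence, multiplication by `x` is onto on the finitely generated module
  -- `Extⁱ(M₂, N)`; Nakayama finishes.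
  have key : (⊤ : Submodule A (Abelian.Ext (ModuleCat.of A M₂) (ModuleCat.of A N) i)) ≤
      IsLocalRing.maximalIdeal A • ⊤ := by
    intro y _
    rw [extV_iff] at h₃
    obtain ⟨z, rfl⟩ := Abelian.Ext.contravariant_sequence_exact₁ h.shortExact _ y (add_comm 1 i)
      (h₃ _)
    have : h.sc.f = x • 𝟙 _ := rfl
    rw [this, Abelian.Ext.mk₀_smul]
    simp only [Abelian.Ext.smul_comp, Abelian.Ext.mk₀_id_comp]
    exact Submodule.smul_mem_smul hx trivial
  have := Submodule.eq_bot_of_le_smul_of_le_jacobson_bot (IsLocalRing.maximalIdeal A) ⊤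
    Module.Finite.fg_top key (IsLocalRing.maximalIdeal_le_jacobson _)
  exact (Submodule.subsingleton_iff A).mp (subsingleton_of_bot_eq_top this.symm)

/-- If multiplication by an element of the maximal ideal is injective on `N₂` with cokernel `N₃` and
`Extⁱ(M, N₃) = 0`, then `Extⁱ(M, N₂) = 0`. -/
theorem SES.extV_nakayama' [IsLocalRing A] [IsNoetherianRing A] [Module.Finite A M]
    [Module.Finite A N₂] {x : A} (hx : x ∈ IsLocalRing.maximalIdeal A) {g : N₂ →ₗ[A] N₃}
    (h : SES (x • LinearMap.id : N₂ →ₗ[A] N₂) g) {i : ℕ} (h₃ : ExtV A M N₃ i) :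
    ExtV A M N₂ i := by
  have key : (⊤ : Submodule A (Abelian.Ext (ModuleCat.of A M) (ModuleCat.of A N₂) i)) ≤
      IsLocalRing.maximalIdeal A • ⊤ := by
    intro y _
    rw [extV_iff] at h₃
    obtain ⟨z, rfl⟩ := Abelian.Ext.covariant_sequence_exact₂ _ h.shortExact y (h₃ _)
    have : h.sc.f = x • 𝟙 _ := rfl
    rw [this, Abelian.Ext.mk₀_smul]
    simp only [Abelian.Ext.comp_smul, Abelian.Ext.comp_mk₀_id]
    exact Submodule.smul_mem_smul hx trivial
  have := Submodule.eq_bot_of_le_smul_of_le_jacobson_bot (IsLocalRing.maximalIdeal A) ⊤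
    Module.Finite.fg_top key (IsLocalRing.maximalIdeal_le_jacobson _)
  exact (Submodule.subsingleton_iff A).mp (subsingleton_of_bot_eq_top this.symm)

theorem hasInjectiveDimensionLE_iff_extV {n : ℕ} :
    HasInjectiveDimensionLE (ModuleCat.of A N) n ↔
      ∀ (M : Type u) [AddCommGroup M] [Module A M] (i : ℕ), n < i → ExtV A M N i := by
  rw [HasInjectiveDimensionLE, hasInjectiveDimensionLT_iff.{u}]
  simp_rw [extV_iff]
  refine ⟨fun h M _ _ i hi x => h i hi x, fun h i hi Y x => h Y i hi x⟩

end ExtV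

/-! ### Dévissage by prime filtrations -/

section Devissage

variable {A : Type u} [CommRing A]
variable {M N : Type u} [AddCommGroup M] [AddCommGroup N] [Module A M] [Module A N]

open Pointwise in
theorem SES.smul_of_isSMulRegular {x : A} (hx : IsSMulRegular M x) :
    SES (x • LinearMap.id : M →ₗ[A] M) (Submodule.mkQ (x • (⊤ : Submodule A M))) := by
  refine ⟨hx, ?_, Submodule.mkQ_surjective _⟩
  intro y
  simp only [Submodule.mkQ_apply, Submodule.Quotient.mk_eq_zero, Submodule.mem_smul_pointwise_iff_exists,
    Submodule.mem_top, true_and, Set.mem_range]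
  rfl

/-- Vanishing of `Extⁱ(M, N)` for finite `M` follows from the case of the modules `A ⧸ p` with
`p` a prime containing the annihilator of `M`. -/
theorem extV_of_primes [IsNoetherianRing A] [hM : Module.Finite A M] {i : ℕ}
    (h : ∀ p : Ideal A, p.IsPrime → Module.annihilator A M ≤ p → ExtV A (A ⧸ p) N i) :
    ExtV A M N i := by
  induction hM using IsNoetherianRing.induction_on_isQuotientEquivQuotientPrime A with
  | subsingleton M => exact extV_of_subsingleton_left
  | quotient M p e =>
    refine (h p.1 p.2 ?_).congr_left e.symm
    rw [e.annihilator_eq, Ideal.annihilator_quotient]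
  | exact M₁ M₂ M₃ f g hf hg hfg h₁ h₃ =>
    exact SES.extV_mid ⟨hf, hfg, hg⟩
      (h₁ fun p hp hle => h p hp ((f.annihilator_le_of_injective hf).trans hle))
      (h₃ fun p hp hle => h p hp ((g.annihilator_le_of_surjective hg).trans hle))

theorem isSMulRegular_quotient_prime {p : Ideal A} [p.IsPrime] {x : A} (hx : x ∉ p) :
    IsSMulRegular (A ⧸ p) x := by
  refine isSMulRegular_iff_right_eq_zero_of_smul.mpr fun y hy => ?_
  rw [Algebra.smul_def] at hy
  refine (mul_eq_zero.mp hy).resolve_left fun h => hx ?_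
  rwa [Ideal.Quotient.algebraMap_eq, Ideal.Quotient.eq_zero_iff_mem] at h

variable [IsLocalRing A] [IsNoetherianRing A] [Module.Finite A N]

/-- Injective dimension of a finite module over a noetherian local ring is detected by the
residue field. -/
theorem extV_of_residueField {r : ℕ}
    (h : ∀ i, r ≤ i → ExtV A (IsLocalRing.ResidueField A) N i) [Module.Finite A M] (i : ℕ)
    (hi : r ≤ i) : ExtV A M N i := by
  suffices H : ∀ p : Ideal A, p.IsPrime → ∀ i, r ≤ i → ExtV A (A ⧸ p) N i from
    extV_of_primes fun p hp _ => H p hp i hi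
  intro p
  induction p using WellFoundedGT.induction with
  | ind p ih =>
    intro hp i hi
    by_cases hpm : p = IsLocalRing.maximalIdeal A
    · subst hpm; exact h i hi
    · obtain ⟨x, hxm, hxp⟩ := SetLike.exists_of_lt
        (lt_of_le_of_ne (IsLocalRing.le_maximalIdeal hp.ne_top) hpm)
      -- Noetherian induction: `(A ⧸ p)/x` is filtered by quotients `A ⧸ q` with `q` strictly above
      -- `p`, since `x` lies in `q` but not in `p`.
      refine SES.extV_nakayama hxm (SES.smul_of_isSMulRegular (isSMulRegular_quotient_prime hxp)) ?_
      refine extV_of_primes fun q hq hle => ih q ?_ hq _ (by omega)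
      have h1 : p ≤ q := by
        refine le_trans ?_ hle
        refine le_trans ?_ (LinearMap.annihilator_le_of_surjective _ (Submodule.mkQ_surjective _))
        rw [Ideal.annihilator_quotient]
      refine lt_of_le_of_ne h1 ?_
      rintro rfl
      refine hxp (hle ?_)
      rw [Module.mem_annihilator]
      intro m
      obtain ⟨m, rfl⟩ := Submodule.mkQ_surjective _ m
      rw [← map_smul, Submodule.mkQ_apply, Submodule.Quotient.mk_eq_zero]
      exact Submodule.smul_mem_pointwise_smul _ _ _ trivial

open Pointwise in
-- Ischebeck's bound: `Extⁱ(M, N)` vanishes for `i < depth N - dim M`. Cutting `A ⧸ p` by an element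
-- outside `p` lowers the dimension by one while Nakayama raises the degree by one, so `i + n` is
-- preserved. The inequality `dim < n` is strict, so that `n = 0` means `M = 0`.
theorem extV_of_ringKrullDim_lt {r : ℕ}
    (h : ∀ i, i < r → ExtV A (IsLocalRing.ResidueField A) N i) [Module.Finite A M] (n i : ℕ)
    (hdim : ringKrullDim (A ⧸ Module.annihilator A M) < n) (hi : i + n ≤ r) : ExtV A M N i := by
  induction n generalizing M i with
  | zero =>
    have h1 : ringKrullDim (A ⧸ Module.annihilator A M) = ⊥ := by
      by_contra hb
      have : Nontrivial (A ⧸ Module.annihilator A M) := by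
        by_contra hc
        rw [not_nontrivial_iff_subsingleton] at hc
        exact hb ringKrullDim_eq_bot_of_subsingleton
      exact absurd hdim (not_lt.mpr ringKrullDim_nonneg_of_nontrivial)
    have : Subsingleton (A ⧸ Module.annihilator A M) := by
      rw [← not_nontrivial_iff_subsingleton]
      intro hc
      have := ringKrullDim_nonneg_of_nontrivial (R := A ⧸ Module.annihilator A M)
      rw [h1] at this
      exact absurd this (by simp)
    rw [Ideal.Quotient.subsingleton_iff, Module.annihilator_eq_top_iff] at this
    exact extV_of_subsingleton_left
  | succ n ih =>
    refine extV_of_primes fun p hp hle => ?_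
    by_cases hpm : p = IsLocalRing.maximalIdeal A
    · subst hpm; exact h i (by omega)
    · obtain ⟨x, hxm, hxp⟩ := SetLike.exists_of_lt
        (lt_of_le_of_ne (IsLocalRing.le_maximalIdeal hp.ne_top) hpm)
      refine SES.extV_nakayama hxm (SES.smul_of_isSMulRegular (isSMulRegular_quotient_prime hxp)) ?_
      refine ih _ ?_ (by omega)
      generalize hI : Module.annihilator A ((A ⧸ p) ⧸ x • (⊤ : Submodule A (A ⧸ p))) = I
      have h1 : p ≤ I := by
        rw [← hI]
        refine le_trans ?_ (LinearMap.annihilator_le_of_surjective _ (Submodule.mkQ_surjective _))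
        rw [Ideal.annihilator_quotient]
      have h2 : x ∈ I := by
        rw [← hI, Module.mem_annihilator]
        intro m
        obtain ⟨m, rfl⟩ := Submodule.mkQ_surjective _ m
        rw [← map_smul, Submodule.mkQ_apply, Submodule.Quotient.mk_eq_zero]
        exact Submodule.smul_mem_pointwise_smul _ _ _ trivial
      have h3 := ringKrullDim_succ_le_of_surjective (Ideal.Quotient.factor h1)
        (Ideal.Quotient.factor_surjective h1) (r := Ideal.Quotient.mk p x)
        (mem_nonZeroDivisors_of_ne_zero (by rwa [Ne, Ideal.Quotient.eq_zero_iff_mem]))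
        (by rw [Ideal.Quotient.factor_mk]; rwa [Ideal.Quotient.eq_zero_iff_mem])
      have h4 := ringKrullDim_le_of_surjective (Ideal.Quotient.factor hle)
        (Ideal.Quotient.factor_surjective hle)
      have h5 := (h3.trans h4).trans_lt hdim
      push_cast at h5
      exact lt_of_add_lt_add_right h5

end Devissage

/-! ### Finite injective dimension -/

section InjDim

variable {A : Type u} [CommRing A]

theorem exists_injective_embedding (N : Type u) [AddCommGroup N] [Module A N] :
    ∃ (E : Type u) (_ : AddCommGroup E) (_ : Module A E) (f : N →ₗ[A] E),
      Module.Injective A E ∧ Function.Injective f := by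
  let p := (EnoughInjectives.presentation (ModuleCat.of A N)).some
  have := p.injective
  have := p.mono
  exact ⟨p.J, inferInstance, inferInstance, p.f.hom,
    Module.injective_module_of_injective_object A p.J, (ModuleCat.mono_iff_injective p.f).mp p.mono⟩

/-- A module `N` has injective dimension at most `n` if `Extⁿ⁺¹(A ⧸ I, N) = 0` for all ideals. -/
theorem extV_of_ideals {N : Type u} [AddCommGroup N] [Module A N] {n : ℕ}
    (h : ∀ I : Ideal A, ExtV A (A ⧸ I) N (n + 1)) (M : Type u) [AddCommGroup M] [Module A M]
    (i : ℕ) (hi : n < i) : ExtV A M N i := by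
  induction n generalizing N i with
  | zero =>
    have : Module.Injective A N := by
      apply Module.Baer.injective
      intro I g
      obtain ⟨ψ, hψ⟩ := (SES.of_surjective (Submodule.mkQ_surjective I)).exists_extend
        (h I) (g ∘ₗ (LinearEquiv.ofEq _ _ (Submodule.ker_mkQ I)).toLinearMap)
      exact ⟨ψ, fun x hx => LinearMap.congr_fun hψ ⟨x, by simpa using hx⟩⟩
    obtain ⟨i, rfl⟩ := Nat.exists_eq_add_of_lt hi
    exact extV_of_injective
  | succ n ih =>
    obtain ⟨E, _, _, f, _, hf⟩ := exists_injective_embedding (A := A) N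
    have hs := SES.of_injective hf
    obtain ⟨i, rfl⟩ := Nat.exists_eq_add_of_lt hi
    refine hs.extV_left' (ih (fun I => ?_) _ (by omega)) extV_of_injective
    exact hs.extV_right' extV_of_injective (h I)

variable {N : Type u} [AddCommGroup N] [Module A N]

/-- Testing on the residue field alone is what allows finiteness of injective dimension to pass
between a ring and its quotients, which share that field. -/
theorem exists_injDimLE_iff [IsLocalRing A] [IsNoetherianRing A] [Module.Finite A N] :
    (∃ n : ℕ, HasInjectiveDimensionLE (ModuleCat.of A N) n) ↔
      ∃ r : ℕ, ∀ i, r ≤ i → ExtV A (IsLocalRing.ResidueField A) N i := by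
  simp_rw [hasInjectiveDimensionLE_iff_extV]
  constructor
  · rintro ⟨n, h⟩
    exact ⟨n + 1, fun i hi => h _ i hi⟩
  · rintro ⟨r, h⟩
    exact ⟨r, extV_of_ideals fun I => extV_of_residueField h _ (by omega)⟩

end InjDim

/-! ### Coextension of scalars -/

section Coext

variable {A B : Type u} [CommRing A] [CommRing B] [Algebra A B]

variable (A B) in
/-- The module `Hom(B, N)` with `B` acting on the source. -/
def CoextHom (N : Type u) [AddCommGroup N] [Module A N] : Type u := B →ₗ[A] N

variable {N E N' W : Type u} [AddCommGroup N] [Module A N] [AddCommGroup E] [Module A E]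
  [AddCommGroup N'] [Module A N'] [AddCommGroup W] [Module B W] [Module A W] [IsScalarTower A B W]
variable {M : Type u} [AddCommGroup M] [Module B M] [Module A M] [IsScalarTower A B M]

instance : AddCommGroup (CoextHom A B N) := inferInstanceAs (AddCommGroup (B →ₗ[A] N))

instance : Module B (CoextHom A B N) where
  smul b φ := (show B →ₗ[A] N from φ) ∘ₗ LinearMap.mulLeft A b
  one_smul φ := LinearMap.ext fun x => congrArg (show B →ₗ[A] N from φ) (one_mul x)
  mul_smul a b φ := LinearMap.ext fun x => congrArg (show B →ₗ[A] N from φ)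
    (show a * b * x = b * (a * x) by ring)
  smul_zero b := LinearMap.ext fun x => rfl
  smul_add b φ ψ := LinearMap.ext fun x => rfl
  add_smul a b φ := LinearMap.ext fun x => (congrArg (show B →ₗ[A] N from φ)
    (add_mul a b x)).trans (map_add _ _ _)
  zero_smul φ := LinearMap.ext fun x => (congrArg (show B →ₗ[A] N from φ)
    (zero_mul x)).trans (map_zero _)

instance : Module A (CoextHom A B N) := inferInstanceAs (Module A (B →ₗ[A] N))

/-- An element of the coextension as a function. -/
def CoextHom.toHom (φ : CoextHom A B N) : B →ₗ[A] N := φ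

theorem CoextHom.smul_toHom (b : B) (φ : CoextHom A B N) (x : B) :
    (b • φ).toHom x = φ.toHom (b * x) := rfl

instance : IsScalarTower A B (CoextHom A B N) where
  smul_assoc a b φ := LinearMap.ext fun x => by
    change φ.toHom (a • b * x) = a • φ.toHom (b * x)
    rw [smul_mul_assoc, map_smul]

/-- The adjoint of an `A`-linear map `M → N`. -/
def CoextHom.lift (φ : M →ₗ[A] N) : M →ₗ[B] CoextHom A B N where
  toFun m := φ ∘ₗ (LinearMap.toSpanSingleton B M m).restrictScalars A
  map_add' m n := LinearMap.ext fun x => by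
    change φ (x • (m + n)) = φ (x • m) + φ (x • n)
    rw [smul_add, map_add]
  map_smul' b m := LinearMap.ext fun x => by
    change φ (x • b • m) = φ ((b * x) • m)
    rw [smul_smul, mul_comm]

theorem CoextHom.lift_apply (φ : M →ₗ[A] N) (m : M) (b : B) :
    (CoextHom.lift φ m).toHom b = φ (b • m) := rfl

/-- The adjoint of a `B`-linear map `M → Hom(B, N)`. -/
def CoextHom.unlift (ψ : M →ₗ[B] CoextHom A B N) : M →ₗ[A] N where
  toFun m := (ψ m).toHom 1
  map_add' m n := by rw [map_add]; rfl
  map_smul' a m := by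
    rw [← algebraMap_smul B a m, map_smul, CoextHom.smul_toHom, RingHom.id_apply, mul_one,
      Algebra.algebraMap_eq_smul_one, map_smul]

theorem CoextHom.unlift_lift (φ : M →ₗ[A] N) : unlift (B := B) (lift φ) = φ := by
  ext m; change φ ((1 : B) • m) = φ m; rw [one_smul]

theorem CoextHom.lift_unlift (ψ : M →ₗ[B] CoextHom A B N) : lift (unlift ψ) = ψ := by
  refine LinearMap.ext fun m => LinearMap.ext fun b => ?_
  change (ψ (b • m)).toHom 1 = (ψ m).toHom b
  rw [map_smul, smul_toHom, mul_one]

/-- Functoriality of coextension. -/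
def CoextHom.map (g : N →ₗ[A] N') : CoextHom A B N →ₗ[B] CoextHom A B N' where
  toFun φ := g ∘ₗ φ.toHom
  map_add' _ _ := LinearMap.ext fun _ => map_add g _ _
  map_smul' _ _ := rfl

theorem CoextHom.unlift_map_comp (g : N →ₗ[A] N') (ψ : M →ₗ[B] CoextHom A B N) :
    unlift (map g ∘ₗ ψ) = g ∘ₗ unlift ψ := rfl

theorem CoextHom.unlift_injective {ψ ψ' : M →ₗ[B] CoextHom A B N} (h : unlift ψ = unlift ψ') :
    ψ = ψ' := by
  rw [← lift_unlift ψ, h, lift_unlift]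

instance [Module.Injective A E] : Module.Injective B (CoextHom A B E) where
  out X Y _ _ _ _ f hf g := by
    let := Module.compHom X (algebraMap A B)
    let := Module.compHom Y (algebraMap A B)
    have : IsScalarTower A B X := ⟨fun a b x => by
      rw [Algebra.smul_def, mul_smul]; rfl⟩
    have : IsScalarTower A B Y := ⟨fun a b x => by
      rw [Algebra.smul_def, mul_smul]; rfl⟩
    obtain ⟨h, hh⟩ := Module.Injective.out (R := A) (Q := E) (f.restrictScalars A) hf
      (CoextHom.unlift g)
    refine ⟨CoextHom.lift h, fun x => ?_⟩
    have : CoextHom.lift h ∘ₗ f = g := by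
      apply CoextHom.unlift_injective
      ext x
      change h ((1 : B) • f x) = _
      rw [one_smul]; exact hh x
    exact LinearMap.congr_fun this x

theorem SES.coext {f : N →ₗ[A] E} {g : E →ₗ[A] N'} (h : SES f g) (hB : ExtV A B N 1) :
    SES (CoextHom.map (B := B) f) (CoextHom.map (B := B) g) := by
  refine ⟨fun φ ψ hh => LinearMap.ext fun b => h.inj (LinearMap.congr_fun hh b), ?_, ?_⟩
  · intro φ
    constructor
    · intro hφ
      have : ∀ b, φ.toHom b ∈ LinearMap.range f := fun b =>
        (h.exact _).mp (LinearMap.congr_fun hφ b)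
      refine ⟨(LinearEquiv.ofInjective f h.inj).symm.toLinearMap ∘ₗ φ.toHom.codRestrict _ this, ?_⟩
      refine LinearMap.ext fun b => ?_
      change f ((LinearEquiv.ofInjective f h.inj).symm (φ.toHom.codRestrict _ this b)) = _
      exact congrArg Subtype.val
        ((LinearEquiv.ofInjective f h.inj).apply_symm_apply (φ.toHom.codRestrict _ this b))
    · rintro ⟨ψ, rfl⟩
      refine LinearMap.ext fun b => h.exact.apply_apply_eq_zero _
  · intro φ
    obtain ⟨ψ, hψ⟩ := h.exists_lift hB φ.toHom
    exact ⟨ψ, hψ⟩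

/-- `Hom(B, -)` is right adjoint to restriction, so it preserves injectives. Since `Ext_A(B, N)`
vanishes in positive degrees, it also keeps `0 → N → E → E/N → 0` exact. Degree one is then the
adjunction, and the higher degrees follow by shifting. -/
theorem extV_coextHom_iff (hB : ∀ i, 1 ≤ i → ExtV A B N i) {i : ℕ} (hi : 1 ≤ i) :
    ExtV B M (CoextHom A B N) i ↔ ExtV A M N i := by
  obtain ⟨i, rfl⟩ := Nat.exists_eq_add_of_le' hi
  clear hi
  induction i generalizing N with
  | zero =>
    obtain ⟨E, _, _, f, _, hf⟩ := exists_injective_embedding (A := A) N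
    have hs := SES.of_injective hf
    have hc := hs.coext (B := B) (hB 1 le_rfl)
    constructor
    · intro h
      refine hs.extV_one_of_lift extV_of_injective fun φ => ?_
      obtain ⟨ψ, hψ⟩ := hc.exists_lift h (CoextHom.lift φ)
      refine ⟨CoextHom.unlift ψ, ?_⟩
      rw [← CoextHom.unlift_map_comp, hψ, CoextHom.unlift_lift]
    · intro h
      refine hc.extV_one_of_lift extV_of_injective fun φ => ?_
      obtain ⟨ψ, hψ⟩ := hs.exists_lift h (CoextHom.unlift φ)
      refine ⟨CoextHom.lift ψ, CoextHom.unlift_injective ?_⟩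
      rw [CoextHom.unlift_map_comp, CoextHom.unlift_lift, hψ]
  | succ i ih =>
    obtain ⟨E, _, _, f, _, hf⟩ := exists_injective_embedding (A := A) N
    have hs := SES.of_injective hf
    have hc := hs.coext (B := B) (hB 1 le_rfl)
    have key := ih (N := E ⧸ LinearMap.range f) fun j hj => by
      obtain ⟨j, rfl⟩ := Nat.exists_eq_add_of_le' hj
      exact hs.extV_right' extV_of_injective (hB _ (by omega))
    constructor
    · intro h
      exact hs.extV_left' (key.mp (hc.extV_right' extV_of_injective h)) extV_of_injective
    · intro h
      exact hc.extV_left' (key.mpr (hs.extV_right' extV_of_injective h)) extV_of_injective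

/-- `W` is the coextension of `N` along `A → B`, with counit `ev`: the map
`W → Hom(B, N)`, `w ↦ (b ↦ ev (b • w))` is bijective. -/
def IsCoext (B : Type u) [CommRing B] [Algebra A B] [Module B W] [IsScalarTower A B W]
    (ev : W →ₗ[A] N) : Prop :=
  Function.Bijective (CoextHom.lift (B := B) ev)

/-- The isomorphism of a coextension with the standard one. -/
noncomputable def IsCoext.equiv {ev : W →ₗ[A] N} (h : IsCoext B ev) : W ≃ₗ[B] CoextHom A B N :=
  LinearEquiv.ofBijective _ h

theorem IsCoext.extV_iff {ev : W →ₗ[A] N} (h : IsCoext B ev) (hB : ∀ i, 1 ≤ i → ExtV A B N i)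
    {i : ℕ} (hi : 1 ≤ i) : ExtV B M W i ↔ ExtV A M N i :=
  (extV_congr_right h.equiv).trans (extV_coextHom_iff hB hi)

theorem IsCoext.hasInjectiveDimensionLE {ev : W →ₗ[A] N} (h : IsCoext B ev)
    (hB : ∀ i, 1 ≤ i → ExtV A B N i) {n : ℕ}
    (hN : HasInjectiveDimensionLE (ModuleCat.of A N) n) :
    HasInjectiveDimensionLE (ModuleCat.of B W) n := by
  rw [hasInjectiveDimensionLE_iff_extV] at *
  intro M _ _ i hi
  let := Module.compHom M (algebraMap A B)
  have : IsScalarTower A B M := ⟨fun a b x => by rw [Algebra.smul_def, mul_smul]; rfl⟩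
  exact (h.extV_iff hB (by omega)).mpr (hN M i hi)

variable (A B N) in
/-- Evaluation at `1`. -/
def CoextHom.ev : CoextHom A B N →ₗ[A] N where
  toFun φ := φ.toHom 1
  map_add' _ _ := rfl
  map_smul' _ _ := rfl

theorem CoextHom.isCoext_ev : IsCoext B (CoextHom.ev A B N) := by
  have : CoextHom.lift (B := B) (CoextHom.ev A B N) = LinearMap.id :=
    LinearMap.ext fun φ => LinearMap.ext fun b => by
      change φ.toHom (b * 1) = φ.toHom b
      rw [mul_one]
  rw [IsCoext, this]
  exact Function.bijective_id

end Coext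

/-! ### Restriction along surjections -/

section Restrict

variable {A B : Type u} [CommRing A] [CommRing B] [Algebra A B]
variable {M₁ M₂ M₃ : Type u} [AddCommGroup M₁] [AddCommGroup M₂] [AddCommGroup M₃]
  [Module A M₁] [Module A M₂] [Module A M₃] [Module B M₁] [Module B M₂] [Module B M₃]
  [IsScalarTower A B M₁] [IsScalarTower A B M₂] [IsScalarTower A B M₃]

theorem SES.restrictScalars {f : M₁ →ₗ[B] M₂} {g : M₂ →ₗ[B] M₃} (h : SES f g) :
    SES (f.restrictScalars A) (g.restrictScalars A) :=
  ⟨h.inj, h.exact, h.surj⟩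

/-- A linear map over `A` between modules over a quotient of `A` is linear over the quotient. -/
def extendScalarsOfSurjective (hB : Function.Surjective (algebraMap A B)) (f : M₁ →ₗ[A] M₂) :
    M₁ →ₗ[B] M₂ where
  __ := f
  map_smul' b m := by
    obtain ⟨a, rfl⟩ := hB b
    simp

end Restrict

/-! ### Rees change of rings modulo a regular element -/

section Rees

variable {A B : Type u} [CommRing A] [CommRing B] [Algebra A B]
variable {M N N' : Type u} [AddCommGroup M] [AddCommGroup N] [AddCommGroup N']
  [Module A N] [Module A M] [Module B M] [IsScalarTower A B M]
  [Module A N']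
variable {x : A} {π : N →ₗ[A] N'}

theorem SES.algebraMap_eq_zero (hB : SES (x • LinearMap.id : A →ₗ[A] A) (Algebra.linearMap A B)) :
    algebraMap A B x = 0 := by
  have := hB.exact.apply_apply_eq_zero 1
  simpa using this

theorem SES.smul_eq_zero (hB : SES (x • LinearMap.id : A →ₗ[A] A) (Algebra.linearMap A B)) (m : M) :
    x • m = 0 := by
  rw [← algebraMap_smul B x m, hB.algebraMap_eq_zero, zero_smul]

-- A free `B`-module has projective dimension at most one over `A`, by the direct sum of copies of
-- `0 → A → A → B → 0`.
open Classical in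
theorem SES.extV_finsupp (hB : SES (x • LinearMap.id : A →ₗ[A] A) (Algebra.linearMap A B))
    (ι : Type u) (i : ℕ) : ExtV A (ι →₀ B) N (i + 2) := by
  have h : SES (x • LinearMap.id : (ι →₀ A) →ₗ[A] (ι →₀ A))
      (Finsupp.mapRange.linearMap (Algebra.linearMap A B)) := by
    refine ⟨fun a b hab => Finsupp.ext fun i => hB.inj ?_, fun a => ⟨fun ha => ?_, ?_⟩, ?_⟩
    · simpa using DFunLike.congr_fun hab i
    · have h1 : ∀ i, ∃ b, x * b = a i := fun i => by
        obtain ⟨b, hb⟩ := (hB.exact (a i)).mp (by simpa using DFunLike.congr_fun ha i)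
        exact ⟨b, by simpa using hb⟩
      choose b hb using h1
      refine ⟨Finsupp.onFinset a.support (fun i => if a i = 0 then 0 else b i) ?_, ?_⟩
      · intro i hi
        simp only [ne_eq, ite_eq_left_iff, not_forall, exists_prop] at hi
        simpa using hi.1
      · ext i
        by_cases h0 : a i = 0 <;> simp [h0, hb]
    · rintro ⟨b, rfl⟩
      ext i
      simp [hB.smul_eq_zero]
    · exact Finsupp.mapRange_surjective _ (map_zero _) hB.surj
  exact h.extV_right extV_of_projective extV_of_projective

theorem SES.eq_zero_of_torsion (hB : SES (x • LinearMap.id : A →ₗ[A] A) (Algebra.linearMap A B))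
    (hN : SES (x • LinearMap.id : N →ₗ[A] N) π) (η : M →ₗ[A] N) : η = 0 := by
  ext m
  apply hN.inj
  change x • η m = x • 0
  rw [← map_smul, hB.smul_eq_zero, map_zero, smul_zero]

/-- Since `x` kills `M`, it acts as zero on `Ext(M, N)`, so the connecting map from `Ext(M, N')` is
onto. -/
theorem SES.exists_comp_extClass (hN : SES (x • LinearMap.id : N →ₗ[A] N) π)
    (hM : ∀ m : M, x • m = 0) {i : ℕ}
    (β : Abelian.Ext (ModuleCat.of A M) (ModuleCat.of A N) (i + 1)) :
    ∃ φ : Abelian.Ext (ModuleCat.of A M) (ModuleCat.of A N') i,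
      φ.comp hN.shortExact.extClass rfl = β := by
  refine Abelian.Ext.covariant_sequence_exact₁ _ hN.shortExact β ?_ rfl
  have h1 : hN.sc.f = x • 𝟙 _ := rfl
  have h2 : (x • 𝟙 (ModuleCat.of A M)) = 0 := by
    ext m
    exact hM m
  rw [h1, ← Abelian.Ext.smul_eq_comp_mk₀]
  have : x • β = (Abelian.Ext.mk₀ (x • 𝟙 (ModuleCat.of A M))).comp β (zero_add _) := by
    rw [Abelian.Ext.mk₀_smul, Abelian.Ext.smul_comp, Abelian.Ext.mk₀_id_comp]
  rw [this, h2]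
  simp

theorem SES.extV_succ_of_torsion (hN : SES (x • LinearMap.id : N →ₗ[A] N) π)
    (hM : ∀ m : M, x • m = 0) {i : ℕ} (h : ExtV A M N' i) : ExtV A M N (i + 1) := by
  rw [extV_iff] at *
  intro β
  obtain ⟨φ, rfl⟩ := hN.exists_comp_extClass hM β
  rw [h φ, Abelian.Ext.zero_comp]

theorem SES.extV_zero_of_torsion (hN : SES (x • LinearMap.id : N →ₗ[A] N) π)
    (hM : ∀ m : M, x • m = 0) : ExtV A M N 0 := by
  rw [extV_zero_iff]
  refine subsingleton_of_forall_eq 0 fun φ => LinearMap.ext fun m => hN.inj ?_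
  change x • φ m = x • 0
  rw [← map_smul, hM, map_zero, smul_zero]

variable [Module B N'] [IsScalarTower A B N']

theorem SES.extV_one_iff_rees (hB : SES (x • LinearMap.id : A →ₗ[A] A) (Algebra.linearMap A B))
    (hN : SES (x • LinearMap.id : N →ₗ[A] N) π) : ExtV B M N' 0 ↔ ExtV A M N 1 := by
  rw [extV_zero_iff, extV_iff]
  constructor
  · intro h β
    obtain ⟨φ, rfl⟩ := hN.exists_comp_extClass hB.smul_eq_zero β
    obtain ⟨φ, rfl⟩ := (Abelian.Ext.mk₀_bijective _ _).2 φ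
    have : φ = 0 := by
      ext m
      exact LinearMap.congr_fun (Subsingleton.elim (extendScalarsOfSurjective hB.surj φ.hom) 0) m
    rw [this]
    simp
  · intro h
    refine ⟨fun φ ψ => ?_⟩
    have key : ∀ φ : M →ₗ[B] N', φ = 0 := fun φ => by
      obtain ⟨η, hη⟩ := hN.exists_lift (extV_iff.mpr h) (φ.restrictScalars A)
      rw [hB.eq_zero_of_torsion hN η] at hη
      ext m
      simpa using (LinearMap.congr_fun hη m).symm
    rw [key φ, key ψ]

/-- Along a `B`-free cover `F → M` with kernel `K`, both sides say that maps `K → N'` extend to `F`.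
A separate base case is needed because only `Ext_A` of degree at least two is known to vanish on
`F`, so the shift cannot start in degree one. -/
theorem SES.extV_two_iff_rees (hB : SES (x • LinearMap.id : A →ₗ[A] A) (Algebra.linearMap A B))
    (hN : SES (x • LinearMap.id : N →ₗ[A] N) π) : ExtV B M N' 1 ↔ ExtV A M N 2 := by
  have hs := SES.of_surjective (Finsupp.linearCombination_surjective B (Function.surjective_id (α := M)))
  set f := Finsupp.linearCombination B (id : M → M) with hf
  have hs' := hs.restrictScalars (A := A)
  constructor
  · intro h
    rw [extV_iff]
    intro α
    obtain ⟨β, rfl⟩ := Abelian.Ext.contravariant_sequence_exact₃ hs'.shortExact _ α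
      (extV_iff.mp (hB.extV_finsupp M 0) _) (show 1 + 1 = 2 from rfl)
    obtain ⟨φ, rfl⟩ := hN.exists_comp_extClass hB.smul_eq_zero β
    obtain ⟨φ, rfl⟩ := (Abelian.Ext.mk₀_bijective _ _).2 φ
    obtain ⟨ψ, hψ⟩ := hs.exists_extend h (extendScalarsOfSurjective hB.surj φ.hom)
    have : φ = hs'.sc.f ≫ ModuleCat.ofHom (ψ.restrictScalars A) := by
      ext m
      exact (LinearMap.congr_fun hψ m).symm
    rw [this, ← Abelian.Ext.mk₀_comp_mk₀, Abelian.Ext.comp_assoc_of_second_deg_zero]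
    exact hs'.shortExact.extClass_comp_assoc _
  · intro h
    refine hs.extV_one_of_extend extV_of_projective fun φ => ?_
    obtain ⟨γ, hγ⟩ := Abelian.Ext.contravariant_sequence_exact₁ hs'.shortExact _
      ((Abelian.Ext.mk₀ (ModuleCat.ofHom (φ.restrictScalars A))).comp hN.shortExact.extClass rfl)
      (add_comm 1 1) (extV_iff.mp h _)
    obtain ⟨ψ, rfl⟩ := hN.exists_comp_extClass hB.smul_eq_zero γ
    obtain ⟨ψ, rfl⟩ := (Abelian.Ext.mk₀_bijective _ _).2 ψ
    rw [← Abelian.Ext.comp_assoc_of_second_deg_zero, Abelian.Ext.mk₀_comp_mk₀, ← sub_eq_zero,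
      sub_eq_add_neg, ← Abelian.Ext.neg_comp, ← Abelian.Ext.add_comp, ← Abelian.Ext.mk₀_neg,
      ← Abelian.Ext.mk₀_add, ← sub_eq_add_neg] at hγ
    -- The difference of `φ` and the restriction of `ψ` is killed by the connecting map, so it lifts
    -- to `N`; but a map from an `x`-torsion module to `N` is zero.
    obtain ⟨η, hη⟩ := Abelian.Ext.covariant_sequence_exact₃ _ hN.shortExact _ rfl hγ
    obtain ⟨η, rfl⟩ := (Abelian.Ext.mk₀_bijective _ _).2 η
    have h0 : η = 0 := by
      ext1
      exact hB.eq_zero_of_torsion hN η.hom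
    rw [h0, Abelian.Ext.mk₀_comp_mk₀, Limits.zero_comp] at hη
    have h1 := (Abelian.Ext.mk₀_bijective _ _).1 hη
    refine ⟨extendScalarsOfSurjective hB.surj ψ.hom, ?_⟩
    ext m
    exact LinearMap.congr_fun (congrArg ModuleCat.Hom.hom
      ((sub_eq_zero (G := hs'.sc.X₁ ⟶ ModuleCat.of A N')).mp h1.symm)) m

/-- Change of rings along `A → B = A/x` for an element `x` that is regular on `A` and `N`. -/
theorem SES.extV_iff_rees (hB : SES (x • LinearMap.id : A →ₗ[A] A) (Algebra.linearMap A B))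
    (hN : SES (x • LinearMap.id : N →ₗ[A] N) π) (i : ℕ) :
    ExtV B M N' i ↔ ExtV A M N (i + 1) := by
  match i with
  | 0 => exact hB.extV_one_iff_rees hN
  | i + 1 =>
    induction i generalizing M with
    | zero => exact hB.extV_two_iff_rees hN
    | succ i ih =>
      have hs := SES.of_surjective
        (Finsupp.linearCombination_surjective B (Function.surjective_id (α := M)))
      have hs' := hs.restrictScalars (A := A)
      constructor
      · intro h
        exact hs'.extV_right (ih.mp (hs.extV_left extV_of_projective h)) (hB.extV_finsupp M _)
      · intro h
        exact hs.extV_right (ih.mpr (hs'.extV_left (hB.extV_finsupp M _) h)) extV_of_projective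

end Rees

/-! ### Base change of Ext -/

section BaseChange

variable {A B : Type u} [CommRing A] [CommRing B] [Algebra A B]

theorem SES.lTensor {M₁ M₂ M₃ : Type u} [AddCommGroup M₁] [AddCommGroup M₂] [AddCommGroup M₃]
    [Module A M₁] [Module A M₂] [Module A M₃] {f : M₁ →ₗ[A] M₂} {g : M₂ →ₗ[A] M₃} (h : SES f g)
    (hf : Function.Injective (f.lTensor B)) : SES (f.baseChange B) (g.baseChange B) :=
  ⟨hf, lTensor_exact B h.exact h.surj, LinearMap.lTensor_surjective B h.surj⟩

variable {M N : Type u} [AddCommGroup M] [Module A M] [AddCommGroup N] [Module A N] [Module B N]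
    [IsScalarTower A B N]

/-- If a class of `A`-modules admits projective covers with kernels in the class that stay
injective after tensoring with `B`, then `Ext` of modules in the class into `B`-modules can be
computed over `B`. -/
theorem extV_baseChange_iff (𝒢 : ∀ (M : Type u) [AddCommGroup M] [Module A M], Prop)
    (h𝒢 : ∀ (M : Type u) [AddCommGroup M] [Module A M], 𝒢 M →
      ∃ (K F : Type u) (_ : AddCommGroup K) (_ : AddCommGroup F) (_ : Module A K) (_ : Module A F)
        (f : K →ₗ[A] F) (g : F →ₗ[A] M), Module.Projective A F ∧ SES f g ∧ 𝒢 K ∧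
        Function.Injective (f.lTensor B)) (hM : 𝒢 M) (i : ℕ) :
    ExtV B (B ⊗[A] M) N (i + 1) ↔ ExtV A M N (i + 1) := by
  induction i generalizing M with
  | zero =>
    obtain ⟨K, F, _, _, _, _, f, g, _, hs, hK, hinj⟩ := h𝒢 M hM
    have hc := hs.lTensor (B := B) hinj
    constructor
    · intro h
      refine hs.extV_one_of_extend extV_of_projective fun φ => ?_
      obtain ⟨ψ, hψ⟩ := hc.exists_extend h (LinearMap.liftBaseChange B φ)
      refine ⟨(LinearMap.liftBaseChangeEquiv B).symm ψ, ?_⟩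
      ext k
      simpa using LinearMap.congr_fun hψ (1 ⊗ₜ k)
    · intro h
      refine hc.extV_one_of_extend extV_of_projective fun φ => ?_
      obtain ⟨ψ, hψ⟩ := hs.exists_extend h ((LinearMap.liftBaseChangeEquiv B).symm φ)
      refine ⟨LinearMap.liftBaseChange B ψ, ?_⟩
      apply (LinearMap.liftBaseChangeEquiv B).symm.injective
      ext k
      simpa using LinearMap.congr_fun hψ k
  | succ i ih =>
    obtain ⟨K, F, _, _, _, _, f, g, _, hs, hK, hinj⟩ := h𝒢 M hM
    have hc := hs.lTensor (B := B) hinj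
    exact ⟨fun h => hs.extV_right ((ih hK).mp (hc.extV_left extV_of_projective h))
      extV_of_projective, fun h => hc.extV_right ((ih hK).mpr (hs.extV_left extV_of_projective h))
      extV_of_projective⟩

end BaseChange

/-! ### Reduction modulo a regular element -/

section QuotientByRegular

variable {A : Type u} [CommRing A] {x : A}

/-- The quotient by a regular element. -/
abbrev QuotBy (x : A) : Type u := A ⧸ Ideal.span {x}

theorem SES.quotBy (hx : IsSMulRegular A x) :
    SES (x • LinearMap.id : A →ₗ[A] A) (Algebra.linearMap A (QuotBy x)) := by
  refine ⟨hx, fun a => ?_, Ideal.Quotient.mk_surjective⟩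
  change Ideal.Quotient.mk _ a = 0 ↔ _
  rw [Ideal.Quotient.eq_zero_iff_mem, Ideal.mem_span_singleton']
  simp only [Set.mem_range, LinearMap.smul_apply, LinearMap.id_apply, smul_eq_mul, mul_comm]

variable {M : Type u} [AddCommGroup M] [Module A M]

theorem quotBy_tmul_eq_zero_iff (m : M) :
    (1 : QuotBy x) ⊗ₜ[A] m = 0 ↔ ∃ m', x • m' = m := by
  have h := (TensorProduct.quotTensorEquivQuotSMul M (Ideal.span {x})).map_eq_zero_iff
    (x := (1 : QuotBy x) ⊗ₜ[A] m)
  rw [← h, ← map_one (Ideal.Quotient.mk _), TensorProduct.quotTensorEquivQuotSMul_mk_tmul, one_smul,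
    Submodule.Quotient.mk_eq_zero, Submodule.ideal_span_singleton_smul,
    Submodule.mem_smul_pointwise_iff_exists]
  simp

theorem quotBy_tmul_surjective (t : QuotBy x ⊗[A] M) : ∃ m : M, (1 : QuotBy x) ⊗ₜ m = t := by
  induction t with
  | zero => exact ⟨0, by simp⟩
  | tmul b m =>
    obtain ⟨a, rfl⟩ := Ideal.Quotient.mk_surjective b
    refine ⟨a • m, ?_⟩
    rw [← TensorProduct.smul_tmul, Algebra.smul_def, mul_one]; rfl
  | add s t hs ht =>
    obtain ⟨m, rfl⟩ := hs
    obtain ⟨n, rfl⟩ := ht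
    exact ⟨m + n, TensorProduct.tmul_add _ _ _⟩

theorem SES.quotBy_tensor (hx : IsSMulRegular M x) :
    SES (x • LinearMap.id : M →ₗ[A] M) (TensorProduct.mk A (QuotBy x) M 1) :=
  ⟨hx, fun m => quotBy_tmul_eq_zero_iff m, quotBy_tmul_surjective⟩

/-- This is `Tor₁(A/x, M₃) = 0`, by hand: if `f m = x n`, then `x` kills `g n`, so `n` comes from
`M₁`. -/
theorem SES.lTensor_quotBy_injective {M₁ M₂ M₃ : Type u} [AddCommGroup M₁] [AddCommGroup M₂]
    [AddCommGroup M₃] [Module A M₁] [Module A M₂] [Module A M₃] {f : M₁ →ₗ[A] M₂}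
    {g : M₂ →ₗ[A] M₃} (h : SES f g) (hx : IsSMulRegular M₃ x) :
    Function.Injective (f.lTensor (QuotBy x)) := by
  rw [injective_iff_map_eq_zero]
  intro t ht
  obtain ⟨m, rfl⟩ := quotBy_tmul_surjective t
  rw [LinearMap.lTensor_tmul, quotBy_tmul_eq_zero_iff] at ht
  obtain ⟨n, hn⟩ := ht
  have h1 : g n = 0 := by
    apply hx
    change x • g n = x • 0
    rw [← map_smul, hn, h.exact.apply_apply_eq_zero, smul_zero]
  obtain ⟨n', rfl⟩ := (h.exact n).mp h1
  rw [← map_smul] at hn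
  rw [quotBy_tmul_eq_zero_iff]
  exact ⟨n', h.inj hn⟩

theorem isSMulRegular_finsupp (hx : IsSMulRegular A x) (ι : Type u) : IsSMulRegular (ι →₀ A) x :=
  fun a b hab => Finsupp.ext fun i => hx (by simpa using DFunLike.congr_fun hab i)

/-- The modules on which `x` is regular are closed under free syzygies, and their covers stay exact
modulo `x`. -/
theorem extV_quotBy_iff (hx : IsSMulRegular A x) (hM : IsSMulRegular M x) {N : Type u}
    [AddCommGroup N] [Module A N] [Module (QuotBy x) N] [IsScalarTower A (QuotBy x) N] (i : ℕ) :
    ExtV (QuotBy x) (QuotBy x ⊗[A] M) N (i + 1) ↔ ExtV A M N (i + 1) := by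
  refine extV_baseChange_iff (fun M _ _ => IsSMulRegular M x) (fun M _ _ hM => ?_) hM i
  have hs := SES.of_surjective
    (Finsupp.linearCombination_surjective A (Function.surjective_id (α := M)))
  exact ⟨_, _, _, _, _, _, _, _, inferInstance, hs,
    (isSMulRegular_finsupp hx M).of_injective _ hs.inj, hs.lTensor_quotBy_injective hM⟩

end QuotientByRegular

/-! ### Exactness of duals -/

section Dual

variable {A : Type u} [CommRing A]
variable {M₁ M₂ M₃ N : Type u} [AddCommGroup M₁] [AddCommGroup M₂] [AddCommGroup M₃]
  [AddCommGroup N] [Module A M₁] [Module A M₂] [Module A M₃] [Module A N]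

theorem SES.hom {f : M₁ →ₗ[A] M₂} {g : M₂ →ₗ[A] M₃} (h : SES f g) (h₃ : ExtV A M₃ N 1) :
    SES (LinearMap.lcomp A N g) (LinearMap.lcomp A N f) := by
  refine ⟨LinearMap.lcomp_injective_of_surjective g h.surj, ?_, fun φ => h.exists_extend h₃ φ⟩
  intro φ
  constructor
  · intro hφ
    have hker : LinearMap.ker g ≤ LinearMap.ker φ := by
      intro y hy
      obtain ⟨z, rfl⟩ := (h.exact y).mp hy
      exact LinearMap.congr_fun hφ z
    refine ⟨((LinearMap.ker g).liftQ φ hker) ∘ₗ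
      (g.quotKerEquivOfSurjective h.surj).symm.toLinearMap, ?_⟩
    ext y
    have : (g.quotKerEquivOfSurjective h.surj).symm (g y) = (LinearMap.ker g).mkQ y := by
      rw [LinearEquiv.symm_apply_eq]; rfl
    simp [this]
  · rintro ⟨ψ, rfl⟩
    ext z
    simp [h.exact.apply_apply_eq_zero]

theorem SES.finite_left [IsNoetherianRing A] {f : M₁ →ₗ[A] M₂} {g : M₂ →ₗ[A] M₃} (h : SES f g)
    [Module.Finite A M₂] : Module.Finite A M₁ :=
  Module.Finite.of_injective f h.inj

theorem SES.finite_right {f : M₁ →ₗ[A] M₂} {g : M₂ →ₗ[A] M₃} (h : SES f g)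
    [Module.Finite A M₂] : Module.Finite A M₃ :=
  Module.Finite.of_surjective g h.surj

end Dual

/-! ### Totally reflexive modules -/

section TR

/-- Totally reflexive modules. -/
structure TR (A : Type u) [CommRing A] (M : Type u) [AddCommGroup M] [Module A M] : Prop where
  finite : Module.Finite A M
  reflexive : Module.IsReflexive A M
  ext : ∀ i, 1 ≤ i → ExtV A M A i
  ext_dual : ∀ i, 1 ≤ i → ExtV A (M →ₗ[A] A) A i

variable {A : Type u} [CommRing A]
variable {M M' K F : Type u} [AddCommGroup M] [AddCommGroup M'] [AddCommGroup K] [AddCommGroup F]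
  [Module A M] [Module A M'] [Module A K] [Module A F]

theorem TR.retract (h : TR A M') (s : M →ₗ[A] M') (r : M' →ₗ[A] M) (hrs : r ∘ₗ s = LinearMap.id) :
    TR A M := by
  have := h.finite
  have := h.reflexive
  refine ⟨Module.Finite.of_surjective r fun m => ⟨s m, LinearMap.congr_fun hrs m⟩,
    Module.IsReflexive.of_split s r hrs, fun i hi => (h.ext i hi).retract s r hrs,
    fun i hi => (h.ext_dual i hi).retract (LinearMap.lcomp A A r) (LinearMap.lcomp A A s) ?_⟩
  ext φ m
  exact congrArg φ (LinearMap.congr_fun hrs m)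

theorem TR.congr (h : TR A M) (e : M ≃ₗ[A] M') : TR A M' :=
  h.retract e.symm.toLinearMap e.toLinearMap (by ext; simp)

theorem TR.of_projective [Module.Finite A M] [Module.Projective A M] : TR A M where
  finite := inferInstance
  reflexive := inferInstance
  ext _ hi := extV_of_projective' hi
  ext_dual _ hi := extV_of_projective' (M := Module.Dual A M) hi

theorem TR.prod (h : TR A M) (h' : TR A M') : TR A (M × M') := by
  have := h.finite
  have := h'.finite
  have := h.reflexive
  have := h'.reflexive
  exact ⟨inferInstance, inferInstance, fun i hi => (h.ext i hi).prod (h'.ext i hi), fun i hi =>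
    ((h.ext_dual i hi).prod (h'.ext_dual i hi)).congr_left (Module.dualProdDualEquivDual A M M')⟩

theorem TR.dual [IsNoetherianRing A] (h : TR A M) : TR A (M →ₗ[A] A) := by
  have := h.finite
  have := h.reflexive
  exact ⟨inferInstance, inferInstanceAs (Module.IsReflexive A (Module.Dual A M)), h.ext_dual,
    fun i hi => (h.ext i hi).congr_left (Module.evalEquiv A M)⟩

theorem TR.exists_eval_eq (h : TR A M) (Φ : (M →ₗ[A] A) →ₗ[A] A) : ∃ m, ∀ μ, Φ μ = μ m := by
  have := h.reflexive
  obtain ⟨m, rfl⟩ := (Module.bijective_dual_eval A M).2 Φ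
  exact ⟨m, fun μ => rfl⟩

theorem TR.eq_zero (h : TR A M) {m : M} (hm : ∀ μ : M →ₗ[A] A, μ m = 0) : m = 0 := by
  have := h.reflexive
  apply (Module.bijective_dual_eval A M).1
  ext μ
  simpa using hm μ

theorem isReflexive_of_forall (h₁ : ∀ m : M, (∀ μ : M →ₗ[A] A, μ m = 0) → m = 0)
    (h₂ : ∀ Φ : (M →ₗ[A] A) →ₗ[A] A, ∃ m, ∀ μ, Φ μ = μ m) : Module.IsReflexive A M := by
  refine ⟨(injective_iff_map_eq_zero _).mpr fun m hm => h₁ m fun μ => LinearMap.congr_fun hm μ,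
    fun Φ => ?_⟩
  obtain ⟨m, hm⟩ := h₂ Φ
  exact ⟨m, LinearMap.ext fun μ => (hm μ).symm⟩

variable [Module.Finite A F] [Module.Projective A F] {f : K →ₗ[A] F} {g : F →ₗ[A] M}

theorem TR.syzygy [IsNoetherianRing A] (h : TR A M) (hs : SES f g) : TR A K := by
  have hd := hs.hom (h.ext 1 le_rfl)
  have hF : TR A F := .of_projective
  refine ⟨hs.finite_left, isReflexive_of_forall ?_ ?_, ?_, ?_⟩
  · intro k hk
    apply hs.inj
    rw [map_zero]
    exact hF.eq_zero fun μ => hk (μ ∘ₗ f)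
  · intro Φ
    obtain ⟨y, hy⟩ := hF.exists_eval_eq (Φ ∘ₗ LinearMap.lcomp A A f)
    have h1 : g y = 0 := h.eq_zero fun μ => by
      rw [← LinearMap.comp_apply, ← hy]
      have : LinearMap.lcomp A A f (μ ∘ₗ g) = 0 := hd.exact.apply_apply_eq_zero μ
      rw [LinearMap.comp_apply, this, map_zero]
    obtain ⟨k, rfl⟩ := (hs.exact y).mp h1
    refine ⟨k, fun μ => ?_⟩
    obtain ⟨ν, rfl⟩ := hd.surj μ
    exact hy ν
  · intro i hi
    exact hs.extV_left (extV_of_projective' hi) (h.ext _ (by omega))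
  · intro i hi
    obtain ⟨i, rfl⟩ := Nat.exists_eq_add_of_le' hi
    cases i with
    | succ i => exact hd.extV_right (h.ext_dual _ (by omega)) (hF.ext_dual _ (by omega))
    | zero =>
      -- A functional on `M*` is evaluation at some `m`; evaluation at a lift of `m` to `F` extends
      -- it to `F*`.
      refine hd.extV_one_of_extend (hF.ext_dual 1 le_rfl) fun Φ => ?_
      obtain ⟨m, hm⟩ := h.exists_eval_eq Φ
      obtain ⟨y, rfl⟩ := hs.surj m
      exact ⟨Module.Dual.eval A F y, LinearMap.ext fun μ => (hm μ).symm⟩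

/-- Beyond total reflexivity of the syzygy, only `Ext¹(M, A) = 0` is needed: it keeps the dual
sequence exact, and the rest is a chase in the biduals. This is the step for climbing up
resolutions. -/
theorem TR.of_syzygy (h : TR A K) (hs : SES f g) (h₁ : ExtV A M A 1) : TR A M := by
  have hd := hs.hom h₁
  have hF : TR A F := .of_projective
  refine ⟨hs.finite_right, isReflexive_of_forall ?_ ?_, ?_, ?_⟩
  · intro m hm
    obtain ⟨y, rfl⟩ := hs.surj m
    have hd2 := hd.hom (N := A) (h.ext_dual 1 le_rfl)
    obtain ⟨κ, hκ⟩ := (hd2.exact (Module.Dual.eval A F y)).mp (LinearMap.ext fun μ => hm μ)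
    obtain ⟨k, hk⟩ := h.exists_eval_eq κ
    have : y = f k := by
      rw [← sub_eq_zero]
      refine hF.eq_zero fun μ => ?_
      have h1 : κ (μ ∘ₗ f) = μ y := LinearMap.congr_fun hκ μ
      rw [map_sub, ← h1, hk, LinearMap.comp_apply, sub_self]
    rw [this, hs.exact.apply_apply_eq_zero]
  · intro Φ
    obtain ⟨Ψ, rfl⟩ := hd.exists_extend (h.ext_dual 1 le_rfl) Φ
    obtain ⟨y, hy⟩ := hF.exists_eval_eq Ψ
    exact ⟨g y, fun μ => hy _⟩
  · intro i hi
    obtain ⟨i, rfl⟩ := Nat.exists_eq_add_of_le' hi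
    cases i with
    | zero => exact h₁
    | succ i => exact hs.extV_right (h.ext _ (by omega)) extV_of_projective
  · intro i hi
    exact hd.extV_left (hF.ext_dual i hi) (h.ext_dual _ (by omega))

/-- Dualize a finite free cover of `M*` and identify `M` with `M**`. These cosyzygies extend a free
resolution to the right without end. -/
theorem TR.exists_cosyzygy [IsNoetherianRing A] (h : TR A M) :
    ∃ (F L : Type u) (_ : AddCommGroup F) (_ : AddCommGroup L) (_ : Module A F) (_ : Module A L)
      (f : M →ₗ[A] F) (g : F →ₗ[A] L), Module.Finite A F ∧ Module.Free A F ∧ SES f g ∧ TR A L := by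
  have := h.dual.finite
  obtain ⟨n, p, hp⟩ := Module.Finite.exists_fin' A (M →ₗ[A] A)
  have hs := SES.of_surjective hp
  have hK := h.dual.syzygy hs
  have hd := hs.hom (h.dual.ext 1 le_rfl)
  have := h.reflexive
  refine ⟨(Fin n → A) →ₗ[A] A, _, _, _, _, _, LinearMap.lcomp A A p ∘ₗ Module.Dual.eval A M,
    LinearMap.lcomp A A _, inferInstance, inferInstanceAs (Module.Free A (Module.Dual A (Fin n → A))),
    ⟨?_, ?_, hd.surj⟩, hK.dual⟩
  · rw [LinearMap.coe_comp]
    exact hd.inj.comp (Module.bijective_dual_eval A M).1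
  · have := hd.exact
    rw [LinearMap.exact_iff] at this ⊢
    rw [this, LinearMap.range_comp, LinearMap.range_eq_top.mpr (Module.bijective_dual_eval A M).2,
      Submodule.map_top]

end TR

/-! ### Finite G-dimension -/

section GdimLE

/-- The G-dimension of `M` is at most `n`. -/
def GdimLE (A : Type u) [CommRing A] :
    ℕ → ∀ (M : Type u) [AddCommGroup M] [Module A M], Prop
  | 0 => fun M _ _ => TR A M
  | n + 1 => fun M _ _ => ∃ (K F : Type u) (_ : AddCommGroup K) (_ : AddCommGroup F)
      (_ : Module A K) (_ : Module A F) (f : K →ₗ[A] F) (g : F →ₗ[A] M),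
      Module.Finite A F ∧ Module.Projective A F ∧ SES f g ∧ GdimLE A n K

variable {A : Type u} [CommRing A]
variable {M M' K F : Type u} [AddCommGroup M] [AddCommGroup M'] [AddCommGroup K] [AddCommGroup F]
  [Module A M] [Module A M'] [Module A K] [Module A F]

theorem SES.congr_right {f : K →ₗ[A] F} {g : F →ₗ[A] M} (h : SES f g) (e : M ≃ₗ[A] M') :
    SES f (e.toLinearMap ∘ₗ g) := by
  refine ⟨h.inj, fun y => ?_, e.surjective.comp h.surj⟩
  rw [← h.exact y]
  simp

theorem SES.congr_left {f : K →ₗ[A] F} {g : F →ₗ[A] M} (h : SES f g) (e : M' ≃ₗ[A] K) :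
    SES (f ∘ₗ e.toLinearMap) g := by
  refine ⟨h.inj.comp e.injective, fun y => ?_, h.surj⟩
  rw [h.exact y]
  exact e.surjective.exists.trans Iff.rfl |>.trans Iff.rfl

theorem GdimLE.congr {n : ℕ} (h : GdimLE A n M) (e : M ≃ₗ[A] M') : GdimLE A n M' := by
  cases n with
  | zero => exact TR.congr h e
  | succ n =>
    obtain ⟨K, F, _, _, _, _, f, g, h1, h2, h3, h4⟩ := h
    exact ⟨K, F, _, _, _, _, f, e.toLinearMap ∘ₗ g, h1, h2, h3.congr_right e, h4⟩

theorem SES.prodMap_id {f : K →ₗ[A] F} {g : F →ₗ[A] M} (h : SES f g) :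
    SES (LinearMap.inl A F M' ∘ₗ f) (g.prodMap (LinearMap.id : M' →ₗ[A] M')) := by
  refine ⟨LinearMap.inl_injective.comp h.inj, fun y => ?_, h.surj.prodMap Function.surjective_id⟩
  constructor
  · intro hy
    obtain ⟨k, hk⟩ := (h.exact y.1).mp (congrArg Prod.fst hy)
    exact ⟨k, Prod.ext hk (congrArg Prod.snd hy).symm⟩
  · rintro ⟨k, rfl⟩
    simp [h.exact.apply_apply_eq_zero]

theorem GdimLE.prod [Module.Finite A F] [Module.Projective A F] {n : ℕ} (h : GdimLE A n M) :
    GdimLE A n (M × F) := by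
  cases n with
  | zero => exact TR.prod h .of_projective
  | succ n =>
    obtain ⟨K, G, _, _, _, _, f, g, h1, h2, h3, h4⟩ := h
    exact ⟨K, G × F, _, _, _, _, _, _, inferInstance, inferInstance, h3.prodMap_id, h4⟩

/-- Restrict a cover `G → M × F` to the part lying over `M × 0`. It is projective, because the
surjection `G → F` splits, and the syzygy is unchanged. -/
theorem GdimLE.of_prod [IsNoetherianRing A] [Module.Finite A F] [Module.Projective A F] {n : ℕ}
    (h : GdimLE A n (M × F)) : GdimLE A n M := by
  cases n with
  | zero => exact TR.retract h (LinearMap.inl A M F) (LinearMap.fst A M F) (by ext; simp)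
  | succ n =>
    obtain ⟨K, G, _, _, _, _, f, g, h1, h2, h3, h4⟩ := h
    let q : G →ₗ[A] F := LinearMap.snd A M F ∘ₗ g
    have hq : Function.Surjective q := (LinearMap.snd_surjective (R := A)).comp h3.surj
    obtain ⟨s, hs⟩ := Module.projective_lifting_property q LinearMap.id hq
    have hf : ∀ k, f k ∈ LinearMap.ker q := fun k => by
      change (g (f k)).2 = 0
      rw [h3.exact.apply_apply_eq_zero]; rfl
    have hmem : ∀ y, (LinearMap.id - s ∘ₗ q : G →ₗ[A] G) y ∈ LinearMap.ker q := fun y => by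
      have := LinearMap.congr_fun hs (q y)
      simp only [LinearMap.comp_apply, LinearMap.id_apply] at this
      simp [this]
    have hproj : Module.Projective A (LinearMap.ker q) := by
      refine Module.Projective.of_split (LinearMap.ker q).subtype
        ((LinearMap.id - s ∘ₗ q).codRestrict _ hmem) ?_
      ext ⟨y, hy⟩
      have hy' : q y = 0 := hy
      simp [hy']
    refine ⟨K, LinearMap.ker q, _, _, _, _, f.codRestrict _ hf,
      LinearMap.fst A M F ∘ₗ g ∘ₗ (LinearMap.ker q).subtype, inferInstance, hproj, ⟨?_, ?_, ?_⟩, h4⟩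
    · intro a b hab
      exact h3.inj (congrArg Subtype.val hab)
    · rintro ⟨y, hy⟩
      have hy' : (g y).2 = 0 := hy
      constructor
      · intro h0
        obtain ⟨k, hk⟩ := (h3.exact y).mp (Prod.ext h0 hy')
        exact ⟨k, Subtype.ext hk⟩
      · rintro ⟨k, hk⟩
        have : f k = y := congrArg Subtype.val hk
        change (g y).1 = 0
        rw [← this, h3.exact.apply_apply_eq_zero]; rfl
    · intro m
      obtain ⟨y, hy⟩ := h3.surj (m, 0)
      exact ⟨⟨y, congrArg Prod.snd hy⟩, congrArg Prod.fst hy⟩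

/-- The pullback of two covers of a module. -/
noncomputable def SES.pullbackEquiv {F' : Type u} [AddCommGroup F'] [Module A F']
    {f : K →ₗ[A] F} {g : F →ₗ[A] M} (h : SES f g) {g' : F' →ₗ[A] M} (s : F' →ₗ[A] F)
    (hs : g ∘ₗ s = g') :
    (K × F') ≃ₗ[A] LinearMap.eqLocus (g ∘ₗ LinearMap.fst A F F') (g' ∘ₗ LinearMap.snd A F F') :=
  LinearEquiv.ofBijective
    (LinearMap.codRestrict _ ((f.coprod s).prod (LinearMap.snd A K F')) fun ⟨k, y⟩ => by
      have := LinearMap.congr_fun hs y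
      simp only [LinearMap.comp_apply] at this
      simp [h.exact.apply_apply_eq_zero, this]) <| by
    constructor
    · rintro ⟨k, y⟩ ⟨k', y'⟩ hh
      have h1 := congrArg Subtype.val hh
      have h2 : y = y' := congrArg Prod.snd h1
      have h3 : f k + s y = f k' + s y' := congrArg Prod.fst h1
      subst h2
      rw [h.inj (add_right_cancel h3)]
    · rintro ⟨⟨x, y⟩, hxy⟩
      have hxy' : g x = g' y := hxy
      have h1 : g (x - s y) = 0 := by
        rw [map_sub, hxy', ← hs, LinearMap.comp_apply, sub_self]
      obtain ⟨k, hk⟩ := (h.exact _).mp h1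
      exact ⟨(k, y), Subtype.ext (Prod.ext (by simp [hk]) rfl)⟩

/-- Schanuel's lemma. -/
theorem SES.schanuel {K' F' : Type u} [AddCommGroup F'] [Module A F'] [AddCommGroup K']
    [Module A K'] {f : K →ₗ[A] F} {g : F →ₗ[A] M} (h : SES f g) {f' : K' →ₗ[A] F'}
    {g' : F' →ₗ[A] M} (h' : SES f' g') [Module.Projective A F] [Module.Projective A F'] :
    Nonempty ((K × F') ≃ₗ[A] (K' × F)) := by
  obtain ⟨s, hs⟩ := Module.projective_lifting_property g g' h.surj
  obtain ⟨s', hs'⟩ := Module.projective_lifting_property g' g h'.surj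
  refine ⟨(h.pullbackEquiv s hs).trans (LinearEquiv.trans ((LinearEquiv.prodComm A F F').ofSubmodules _ _ (by
    ext ⟨y, x⟩
    simp [eq_comm])) (h'.pullbackEquiv s' hs').symm)⟩

/-- By Schanuel's lemma the bound holds for every syzygy, not only for the one in the definition. -/
theorem GdimLE.syzygy [IsNoetherianRing A] {n : ℕ} (h : GdimLE A (n + 1) M) [Module.Finite A F]
    [Module.Projective A F] {f : K →ₗ[A] F} {g : F →ₗ[A] M} (hs : SES f g) : GdimLE A n K := by
  obtain ⟨K', F', _, _, _, _, f', g', _, _, h3, h4⟩ := h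
  obtain ⟨e⟩ := h3.schanuel hs
  exact ((GdimLE.prod (F := F) h4).congr e).of_prod

theorem GdimLE.succ [IsNoetherianRing A] {n : ℕ} (h : GdimLE A n M) : GdimLE A (n + 1) M := by
  induction n generalizing M with
  | zero =>
    have := h.finite
    obtain ⟨n, p, hp⟩ := Module.Finite.exists_fin' A M
    have hs := SES.of_surjective hp
    exact ⟨_, _, _, _, _, _, _, _, inferInstance, inferInstance, hs, TR.syzygy h hs⟩
  | succ n ih =>
    obtain ⟨K, F, _, _, _, _, f, g, h1, h2, h3, h4⟩ := h
    exact ⟨K, F, _, _, _, _, f, g, h1, h2, h3, ih h4⟩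

/-- Ext vanishing passes to all syzygies; starting from the last one, which is totally reflexive,
`TR.of_syzygy` climbs back to `M`. -/
theorem GdimLE.tr {n : ℕ} (h : GdimLE A n M) (hM : ∀ i, 1 ≤ i → ExtV A M A i) : TR A M := by
  induction n generalizing M with
  | zero => exact h
  | succ n ih =>
    obtain ⟨K, F, _, _, _, _, f, g, h1, h2, h3, h4⟩ := h
    refine (ih h4 fun i hi => ?_).of_syzygy h3 (hM 1 le_rfl)
    exact h3.extV_left (extV_of_projective' hi) (hM _ (by omega))

end GdimLE

/-! ### Total reflexivity and G-dimension modulo a regular element -/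

section ModRegular

variable {A : Type u} [CommRing A] {x : A}
variable {M K F : Type u} [AddCommGroup M] [AddCommGroup K] [AddCommGroup F]
  [Module A M] [Module A K] [Module A F]

theorem TR.isSMulRegular (h : TR A M) (hx : IsSMulRegular A x) : IsSMulRegular M x := by
  refine isSMulRegular_iff_right_eq_zero_of_smul.mpr fun m hm => h.eq_zero fun μ => ?_
  refine isSMulRegular_iff_right_eq_zero_of_smul.mp hx _ ?_
  rw [← map_smul, hm, map_zero]

theorem quotBy_algebraMap_eq_zero_iff (a : A) : algebraMap A (QuotBy x) a = 0 ↔ ∃ b, x * b = a := by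
  rw [Ideal.Quotient.algebraMap_eq, Ideal.Quotient.eq_zero_iff_mem, Ideal.mem_span_singleton']
  simp only [mul_comm]

/-- A linear map all of whose values are multiples of `x` is a multiple of `x`. -/
theorem exists_eq_smul_of_forall (hx : IsSMulRegular A x) (μ : M →ₗ[A] A)
    (h : ∀ m, ∃ b, x * b = μ m) : ∃ ν : M →ₗ[A] A, x • ν = μ := by
  have hs := SES.smul_of_isSMulRegular hx
  have : ∀ m, μ m ∈ LinearMap.range (x • LinearMap.id : A →ₗ[A] A) := h
  refine ⟨(LinearEquiv.ofInjective _ hs.inj).symm.toLinearMap ∘ₗ μ.codRestrict _ this, ?_⟩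
  ext m
  exact congrArg Subtype.val
    ((LinearEquiv.ofInjective _ hs.inj).apply_symm_apply (μ.codRestrict _ this m))

theorem extV_quotBy_right {N : Type u} [AddCommGroup N] [Module A N] (hx : IsSMulRegular A x)
    (h : ∀ i, 1 ≤ i → ExtV A N A i) (i : ℕ) (hi : 1 ≤ i) : ExtV A N (QuotBy x) i :=
  (SES.quotBy hx).extV_right' (h i hi) (h _ (by omega))

theorem SES.exists_lift_quotBy (hx : IsSMulRegular A x) (hM : ExtV A M A 1)
    (ψ : QuotBy x ⊗[A] M →ₗ[QuotBy x] QuotBy x) :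
    ∃ μ : M →ₗ[A] A, ∀ m, ψ (1 ⊗ₜ m) = algebraMap A (QuotBy x) (μ m) := by
  obtain ⟨μ, hμ⟩ := (SES.quotBy hx).exists_lift hM ((LinearMap.liftBaseChangeEquiv _).symm ψ)
  refine ⟨μ, fun m => ?_⟩
  simpa using (LinearMap.congr_fun hμ m).symm

variable (x M) in
/-- The comparison map from the reduction of the dual to the dual of the reduction. -/
noncomputable def dualReduction :
    QuotBy x ⊗[A] (M →ₗ[A] A) →ₗ[QuotBy x] (QuotBy x ⊗[A] M →ₗ[QuotBy x] QuotBy x) :=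
  LinearMap.liftBaseChange (QuotBy x)
    (((LinearMap.liftBaseChangeEquiv (QuotBy x)).toLinearMap.restrictScalars A) ∘ₗ
      LinearMap.llcomp A M A (QuotBy x) (Algebra.linearMap A (QuotBy x)))

theorem dualReduction_tmul (μ : M →ₗ[A] A) (m : M) :
    dualReduction x M (1 ⊗ₜ μ) (1 ⊗ₜ m) = algebraMap A (QuotBy x) (μ m) := by
  simp [dualReduction]

theorem quotBy_hom_ext {N : Type*} [AddCommGroup N] [Module (QuotBy x) N]
    {φ ψ : QuotBy x ⊗[A] M →ₗ[QuotBy x] N} (h : ∀ m, φ (1 ⊗ₜ m) = ψ (1 ⊗ₜ m)) : φ = ψ := by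
  ext t
  obtain ⟨m, rfl⟩ := quotBy_tmul_surjective t
  exact h m

/-- Apply `Hom(M, -)` to `0 → A → A → A/x → 0`: functionals into `A/x` lift because `Ext¹(M, A) =
0`, and a functional with values in `xA` is divisible by `x`. -/
theorem dualReduction_bijective (hx : IsSMulRegular A x) (hM : ExtV A M A 1) :
    Function.Bijective (dualReduction x M) := by
  constructor
  · rw [injective_iff_map_eq_zero]
    intro t ht
    obtain ⟨μ, rfl⟩ := quotBy_tmul_surjective t
    rw [quotBy_tmul_eq_zero_iff]
    refine exists_eq_smul_of_forall hx μ fun m => ?_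
    rw [← quotBy_algebraMap_eq_zero_iff, ← dualReduction_tmul, ht, LinearMap.zero_apply]
  · intro ψ
    obtain ⟨μ, hμ⟩ := SES.exists_lift_quotBy hx hM ψ
    refine ⟨1 ⊗ₜ μ, quotBy_hom_ext fun m => ?_⟩
    rw [dualReduction_tmul, hμ]

theorem TR.quotBy (h : TR A M) (hx : IsSMulRegular A x) : TR (QuotBy x) (QuotBy x ⊗[A] M) := by
  have hMx := h.isSMulRegular hx
  have := h.finite
  have hd : IsSMulRegular (M →ₗ[A] A) x := fun a b hab =>
    LinearMap.ext fun m => hx (LinearMap.congr_fun hab m)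
  refine ⟨inferInstance, isReflexive_of_forall ?_ ?_, ?_, ?_⟩
  · intro t ht
    obtain ⟨m, rfl⟩ := quotBy_tmul_surjective t
    rw [quotBy_tmul_eq_zero_iff]
    obtain ⟨Φ, hΦ⟩ := exists_eq_smul_of_forall hx (Module.Dual.eval A M m) fun μ => by
      rw [← quotBy_algebraMap_eq_zero_iff]
      have := ht (dualReduction x M (1 ⊗ₜ μ))
      rwa [dualReduction_tmul] at this
    obtain ⟨m', hm'⟩ := h.exists_eval_eq Φ
    refine ⟨m', sub_eq_zero.mp (h.eq_zero fun μ => ?_)⟩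
    have h1 : x • Φ μ = μ m := LinearMap.congr_fun hΦ μ
    rw [map_sub, map_smul, ← hm', h1, sub_self]
  · intro Φ
    obtain ⟨μ, hμ⟩ := (SES.quotBy hx).exists_lift (h.ext_dual 1 le_rfl)
      ((LinearMap.liftBaseChangeEquiv (QuotBy x)).symm (Φ ∘ₗ dualReduction x M))
    obtain ⟨m, hm⟩ := h.exists_eval_eq μ
    refine ⟨1 ⊗ₜ m, fun ψ => ?_⟩
    obtain ⟨t, rfl⟩ := (dualReduction_bijective hx (h.ext 1 le_rfl)).2 ψ
    obtain ⟨ν, rfl⟩ := quotBy_tmul_surjective t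
    rw [dualReduction_tmul, ← hm]
    simpa using (LinearMap.congr_fun hμ ν).symm
  · intro i hi
    obtain ⟨i, rfl⟩ := Nat.exists_eq_add_of_le' hi
    exact (extV_quotBy_iff hx hMx i).mpr (extV_quotBy_right hx h.ext _ hi)
  · intro i hi
    obtain ⟨i, rfl⟩ := Nat.exists_eq_add_of_le' hi
    refine ((extV_quotBy_iff hx hd i).mpr (extV_quotBy_right hx h.ext_dual _ hi)).congr_left ?_
    exact LinearEquiv.ofBijective _ (dualReduction_bijective hx (h.ext 1 le_rfl))

theorem GdimLE.quotBy {n : ℕ} (h : GdimLE A n M) (hx : IsSMulRegular A x)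
    (hM : IsSMulRegular M x) : GdimLE (QuotBy x) n (QuotBy x ⊗[A] M) := by
  induction n generalizing M with
  | zero => exact TR.quotBy h hx
  | succ n ih =>
    obtain ⟨K, F, _, _, _, _, f, g, h1, h2, h3, h4⟩ := h
    have hF : TR A F := .of_projective
    exact ⟨_, _, _, _, _, _, _, _, inferInstance, inferInstance,
      h3.lTensor (h3.lTensor_quotBy_injective hM),
      ih h4 ((hF.isSMulRegular hx).of_injective f h3.inj)⟩

end ModRegular

/-! ### Comparing syzygies over a ring and over its quotient -/

section Descent

variable {A : Type u} [CommRing A] {x : A}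
variable {M : Type u} [AddCommGroup M] [Module A M] [Module (QuotBy x) M]
  [IsScalarTower A (QuotBy x) M]

theorem SES.compLeft {M₁ M₂ M₃ : Type*} [AddCommGroup M₁] [AddCommGroup M₂] [AddCommGroup M₃]
    [Module A M₁] [Module A M₂] [Module A M₃] {f : M₁ →ₗ[A] M₂} {g : M₂ →ₗ[A] M₃} (h : SES f g)
    (ι : Type*) : SES (f.compLeft ι) (g.compLeft ι) := by
  refine ⟨fun a b hab => funext fun i => h.inj (congrFun hab i), fun y => ⟨fun hy => ?_, ?_⟩,
    fun y => ?_⟩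
  · choose z hz using fun i => (h.exact (y i)).mp (congrFun hy i)
    exact ⟨z, funext hz⟩
  · rintro ⟨z, rfl⟩
    exact funext fun i => h.exact.apply_apply_eq_zero _
  · choose z hz using fun i => h.surj (y i)
    exact ⟨z, funext hz⟩

variable {m : ℕ} (q : (Fin m → QuotBy x) →ₗ[QuotBy x] M)

/-- The cover over `A` induced by a cover over a quotient of `A`. -/
noncomputable def liftCover : (Fin m → A) →ₗ[A] M :=
  q.restrictScalars A ∘ₗ (Algebra.linearMap A (QuotBy x)).compLeft (Fin m)

theorem quotBy_compLeft (hx : IsSMulRegular A x) :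
    SES (x • LinearMap.id : (Fin m → A) →ₗ[A] (Fin m → A))
      ((Algebra.linearMap A (QuotBy x)).compLeft (Fin m)) :=
  (SES.quotBy hx).compLeft (Fin m)

variable {q}

theorem liftCover_surjective (hq : Function.Surjective q) : Function.Surjective (liftCover q) :=
  hq.comp (Function.Surjective.comp_left Ideal.Quotient.mk_surjective)

variable (q)

theorem smul_mem_ker_liftCover (v : Fin m → A) : x • v ∈ LinearMap.ker (liftCover q) := by
  have : x • liftCover q v = 0 := by
    rw [← algebraMap_smul (QuotBy x) x (liftCover q v),
      (quotBy_algebraMap_eq_zero_iff x).mpr ⟨1, mul_one x⟩, zero_smul]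
  rw [LinearMap.mem_ker, map_smul, this]

/-- The map from the syzygy over `A` to the syzygy over the quotient. -/
noncomputable def syzygyMap : LinearMap.ker (liftCover q) →ₗ[A] LinearMap.ker q :=
  LinearMap.codRestrict ((LinearMap.ker q).restrictScalars A)
    ((Algebra.linearMap A (QuotBy x)).compLeft (Fin m) ∘ₗ (LinearMap.ker (liftCover q)).subtype)
    fun k => k.2

theorem syzygyMap_surjective : Function.Surjective (syzygyMap q) := by
  rintro ⟨w, hw⟩
  obtain ⟨v, rfl⟩ := Function.Surjective.comp_left (α := Fin m)
    (Ideal.Quotient.mk_surjective (I := Ideal.span {x})) w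
  exact ⟨⟨v, hw⟩, rfl⟩

/-- Multiplication by `x` from the free cover to the syzygy. -/
noncomputable def smulToSyzygy : (Fin m → A) →ₗ[A] LinearMap.ker (liftCover q) :=
  (x • LinearMap.id : (Fin m → A) →ₗ[A] (Fin m → A)).codRestrict _ (smul_mem_ker_liftCover q)

theorem SES.smulToSyzygy (hx : IsSMulRegular A x) : SES (smulToSyzygy q) (syzygyMap q) := by
  have h := quotBy_compLeft (m := m) hx
  refine ⟨fun a b hab => h.inj (congrArg Subtype.val hab), ?_, syzygyMap_surjective q⟩
  rintro ⟨v, hv⟩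
  constructor
  · intro h0
    obtain ⟨w, hw⟩ := (h.exact v).mp (congrArg Subtype.val h0)
    exact ⟨w, Subtype.ext hw⟩
  · rintro ⟨w, hw⟩
    have : x • w = v := congrArg Subtype.val hw
    exact Subtype.ext ((h.exact v).mpr ⟨w, this⟩)

/-- In `0 → Aᵐ → ker (liftCover q) → ker q → 0` the left term is free, so a syzygy of the right term
is also a syzygy of the middle one. -/
theorem GdimLE.ker_of_ker_liftCover [IsNoetherianRing A] (hx : IsSMulRegular A x) {n : ℕ}
    (h : GdimLE A (n + 1) (LinearMap.ker (liftCover q))) : GdimLE A (n + 1) (LinearMap.ker q) := by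
  have hs := SES.smulToSyzygy q hx
  have : Module.Finite A (LinearMap.ker q) := hs.finite_right
  obtain ⟨l, p, hp⟩ := Module.Finite.exists_fin' A (LinearMap.ker q)
  obtain ⟨t, ht⟩ := Module.projective_lifting_property (syzygyMap q) p hs.surj
  refine ⟨_, _, _, _, _, _, _, p, inferInstance, inferInstance, SES.of_surjective hp, ?_⟩
  have ht' : ∀ v, syzygyMap q (t v) = p v := LinearMap.congr_fun ht
  have h1 : ∀ y : LinearMap.ker p, t y ∈ LinearMap.range (SemidualizingPresentation.smulToSyzygy q) :=
    fun y => (hs.exact _).mp ((ht' y).trans y.2)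
  let s : LinearMap.ker p →ₗ[A] (Fin m → A) :=
    (LinearEquiv.ofInjective _ hs.inj).symm.toLinearMap ∘ₗ
      (t ∘ₗ (LinearMap.ker p).subtype).codRestrict _ h1
  have hsv : ∀ y, SemidualizingPresentation.smulToSyzygy q (s y) = t y := fun y =>
    congrArg Subtype.val ((LinearEquiv.ofInjective _ hs.inj).apply_symm_apply
      ((t ∘ₗ (LinearMap.ker p).subtype).codRestrict _ h1 y))
  -- Horseshoe: the middle term is covered by `Aˡ × Aᵐ`, with kernel `ker p`. The correction `-s`
  -- records by how much the lift `t` of `p` fails to kill `ker p`.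
  refine GdimLE.syzygy h (F := (Fin l → A) × (Fin m → A))
    (f := (LinearMap.ker p).subtype.prod (-s))
    (g := t.coprod (SemidualizingPresentation.smulToSyzygy q)) ⟨?_, ?_, ?_⟩
  · intro a b hab
    exact Subtype.ext (congrArg Prod.fst hab)
  · rintro ⟨v, w⟩
    constructor
    · intro h0
      have h0' : t v + SemidualizingPresentation.smulToSyzygy q w = 0 := h0
      have hv : p v = 0 := by
        rw [← ht', eq_neg_of_add_eq_zero_left h0', map_neg, hs.exact.apply_apply_eq_zero, neg_zero]
      refine ⟨⟨v, hv⟩, Prod.ext rfl ?_⟩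
      apply hs.inj
      change SemidualizingPresentation.smulToSyzygy q (-s _) = _
      rw [map_neg, hsv]
      exact (eq_neg_of_add_eq_zero_right h0').symm
    · rintro ⟨y, hy⟩
      rw [← hy]
      change t y + SemidualizingPresentation.smulToSyzygy q (-s y) = 0
      rw [map_neg, hsv, add_neg_cancel]
  · intro k
    obtain ⟨v, hv⟩ := hp (syzygyMap q k)
    obtain ⟨w, hw⟩ := (hs.exact (k - t v)).mp (by rw [map_sub, ht', hv, sub_self])
    exact ⟨(v, w), by simp [hw]⟩

theorem ker_liftCover_le : LinearMap.ker (liftCover q) ≤ LinearMap.ker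
    (TensorProduct.mk A (QuotBy x) (LinearMap.ker (liftCover q)) 1 ∘ₗ smulToSyzygy q) :=
  fun v hv => (quotBy_tmul_eq_zero_iff _).mpr ⟨⟨v, hv⟩, rfl⟩

/-- The connecting map from `M` to the reduction of its syzygy over `A`. -/
noncomputable def toReducedSyzygy (hq : Function.Surjective q) :
    M →ₗ[QuotBy x] QuotBy x ⊗[A] LinearMap.ker (liftCover q) :=
  extendScalarsOfSurjective (A := A) Ideal.Quotient.mk_surjective <|
    (LinearMap.ker (liftCover q)).liftQ
      (TensorProduct.mk A (QuotBy x) (LinearMap.ker (liftCover q)) 1 ∘ₗ smulToSyzygy q)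
      (ker_liftCover_le q) ∘ₗ
    ((liftCover q).quotKerEquivOfSurjective (liftCover_surjective hq)).symm.toLinearMap

theorem toReducedSyzygy_apply (hq : Function.Surjective q) (v : Fin m → A) :
    toReducedSyzygy q hq (liftCover q v) = 1 ⊗ₜ smulToSyzygy q v := by
  have : ((liftCover q).quotKerEquivOfSurjective (liftCover_surjective hq)).symm (liftCover q v) =
      (LinearMap.ker (liftCover q)).mkQ v := by
    rw [LinearEquiv.symm_apply_eq]; rfl
  exact congrArg (Submodule.liftQ _ _ (ker_liftCover_le q)) this

/-- With `K = ker (liftCover q)`, the kernel of `K/xK → ker q` is `xAᵐ/xK ≅ Aᵐ/K ≅ M`. So `M` embeds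
in the reduction of `K`, with cokernel a syzygy of `M` over `A/x`. -/
theorem SES.toReducedSyzygy (hx : IsSMulRegular A x) (hq : Function.Surjective q) :
    SES (toReducedSyzygy q hq) (LinearMap.liftBaseChange (QuotBy x) (syzygyMap q)) := by
  have hs := SES.smulToSyzygy q hx
  refine ⟨?_, ?_, ?_⟩
  · rw [injective_iff_map_eq_zero]
    intro y hy
    obtain ⟨v, rfl⟩ := liftCover_surjective hq y
    rw [toReducedSyzygy_apply, quotBy_tmul_eq_zero_iff] at hy
    obtain ⟨k, hk⟩ := hy
    have : k.1 = v := (quotBy_compLeft (m := m) hx).inj (congrArg Subtype.val hk)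
    rw [← this]
    exact k.2
  · intro t
    obtain ⟨k, rfl⟩ := quotBy_tmul_surjective t
    rw [LinearMap.liftBaseChange_tmul, one_smul, hs.exact]
    constructor
    · rintro ⟨v, rfl⟩
      exact ⟨liftCover q v, toReducedSyzygy_apply q hq v⟩
    · rintro ⟨y, hy⟩
      obtain ⟨v, rfl⟩ := liftCover_surjective hq y
      rw [toReducedSyzygy_apply, ← sub_eq_zero, ← TensorProduct.tmul_sub,
        quotBy_tmul_eq_zero_iff] at hy
      obtain ⟨k', hk'⟩ := hy
      refine ⟨v - k'.1, ?_⟩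
      have : SemidualizingPresentation.smulToSyzygy q k'.1 = x • k' := rfl
      rw [map_sub, this, hk', sub_sub_cancel]
  · intro w
    obtain ⟨k, rfl⟩ := syzygyMap_surjective q w
    exact ⟨1 ⊗ₜ k, by simp⟩

end Descent

/-! ### Descent of finite G-dimension to a quotient by a regular element -/

section DescentTR

theorem TR.eq_zero_of_injective {B : Type u} [CommRing B] {M N : Type u} [AddCommGroup M]
    [AddCommGroup N] [Module B M] [Module B N] (hN : TR B N) {f : M →ₗ[B] N}
    (hf : Function.Injective f) {m : M} (hm : ∀ μ : M →ₗ[B] B, μ m = 0) : m = 0 := by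
  apply hf
  rw [map_zero]
  exact hN.eq_zero fun μ => hm (μ ∘ₗ f)

/-- A class of modules with `Extⁱ(M, B) = 0` for `i ≥ 1`, each of which embeds in a totally
reflexive module with cokernel in the class, consists of totally reflexive modules. -/
theorem TR.of_class {B : Type u} [CommRing B] [IsNoetherianRing B]
    (𝒞 : ∀ (M : Type u) [AddCommGroup M] [Module B M], Prop)
    (hext : ∀ (M : Type u) [AddCommGroup M] [Module B M], 𝒞 M → ∀ i, 1 ≤ i → ExtV B M B i)
    (hemb : ∀ (M : Type u) [AddCommGroup M] [Module B M], 𝒞 M →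
      ∃ (L M' : Type u) (_ : AddCommGroup L) (_ : AddCommGroup M') (_ : Module B L)
        (_ : Module B M') (f : M →ₗ[B] L) (g : L →ₗ[B] M'), TR B L ∧ SES f g ∧ 𝒞 M')
    (M : Type u) [AddCommGroup M] [Module B M] (h : 𝒞 M) : TR B M := by
  have htl : ∀ (M : Type u) [AddCommGroup M] [Module B M], 𝒞 M →
      ∀ m : M, (∀ μ : M →ₗ[B] B, μ m = 0) → m = 0 := by
    intro M _ _ h m hm
    obtain ⟨L, M', _, _, _, _, f, g, hL, hs, hM'⟩ := hemb M h
    exact hL.eq_zero_of_injective hs.inj hm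
  have hrefl : ∀ (M : Type u) [AddCommGroup M] [Module B M], 𝒞 M →
      ∀ Φ : (M →ₗ[B] B) →ₗ[B] B, ∃ m, ∀ μ, Φ μ = μ m := by
    intro M _ _ h Φ
    obtain ⟨L, M', _, _, _, _, f, g, hL, hs, hM'⟩ := hemb M h
    have hd := hs.hom (hext M' hM' 1 le_rfl)
    obtain ⟨y, hy⟩ := hL.exists_eval_eq (Φ ∘ₗ LinearMap.lcomp _ _ f)
    -- The image of `y` in `M'` is killed by every functional, hence is zero by torsionlessness of
    -- the class; so `y` comes from `M`.
    have h1 : g y = 0 := htl M' hM' _ fun μ => by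
      rw [← LinearMap.comp_apply, ← hy, LinearMap.comp_apply]
      exact (congrArg Φ (hd.exact.apply_apply_eq_zero μ)).trans (map_zero Φ)
    obtain ⟨m, rfl⟩ := (hs.exact y).mp h1
    refine ⟨m, fun μ => ?_⟩
    obtain ⟨ν, rfl⟩ := hd.surj μ
    exact hy ν
  refine ⟨?_, isReflexive_of_forall (htl M h) (hrefl M h), hext M h, fun i hi => ?_⟩
  · obtain ⟨L, M', _, _, _, _, f, g, hL, hs, hM'⟩ := hemb M h
    have := hL.finite
    exact hs.finite_left
  obtain ⟨i, rfl⟩ := Nat.exists_eq_add_of_le' hi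
  clear hi
  induction i generalizing M with
  | zero =>
    obtain ⟨L, M', _, _, _, _, f, g, hL, hs, hM'⟩ := hemb M h
    have hd := hs.hom (hext M' hM' 1 le_rfl)
    refine hd.extV_one_of_extend (hL.ext_dual 1 le_rfl) fun Φ => ?_
    obtain ⟨m, hm⟩ := hrefl M' hM' Φ
    obtain ⟨y, rfl⟩ := hs.surj m
    exact ⟨Module.Dual.eval _ L y, LinearMap.ext fun μ => (hm μ).symm⟩
  | succ i ih =>
    obtain ⟨L, M', _, _, _, _, f, g, hL, hs, hM'⟩ := hemb M h
    have hd := hs.hom (hext M' hM' 1 le_rfl)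
    exact hd.extV_right (ih M' hM') (hL.ext_dual _ (by omega))

variable {A : Type u} [CommRing A] [IsNoetherianRing A] {x : A}

/-- A module over `A/x` of G-dimension at most one over `A` is totally reflexive. -/
theorem TR.of_gdimLE_one (hx : IsSMulRegular A x) (M : Type u) [AddCommGroup M] [Module A M]
    [Module (QuotBy x) M] [IsScalarTower A (QuotBy x) M] [Module.Finite (QuotBy x) M]
    (h : GdimLE A 1 M) : TR (QuotBy x) M := by
  refine TR.of_class (fun M _ _ => Module.Finite (QuotBy x) M ∧ ∃ (_ : Module A M)
    (_ : IsScalarTower A (QuotBy x) M), GdimLE A 1 M) ?_ ?_ M ⟨inferInstance, _, inferInstance, h⟩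
  · rintro M _ _ ⟨_, _, _, h⟩ i hi
    -- Rees: `Extⁱ` over `A/x` is `Extⁱ⁺¹` over `A`, which vanishes for `i ≥ 1` as the syzygy is
    -- totally reflexive.
    rw [SES.extV_iff_rees (SES.quotBy hx) (SES.quotBy hx)]
    obtain ⟨K, F, _, _, _, _, f, g, h1, h2, h3, h4⟩ := h
    exact h3.extV_right (h4.ext i hi) extV_of_projective
  · rintro M _ _ ⟨_, _, _, h⟩
    obtain ⟨m, q, hq⟩ := Module.Finite.exists_fin' (QuotBy x) M
    have hK : GdimLE A 0 (LinearMap.ker (liftCover q)) :=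
      h.syzygy (SES.of_surjective (liftCover_surjective hq))
    exact ⟨_, LinearMap.ker q, _, _, _, _, _, _, TR.quotBy hK hx, SES.toReducedSyzygy q hx hq,
      inferInstance, _, inferInstance, hK.succ.ker_of_ker_liftCover q hx⟩

/-- Finite G-dimension over `A` implies finite G-dimension over `A/x`. -/
theorem GdimLE.exists_quotBy (hx : IsSMulRegular A x) (M : Type u) [AddCommGroup M] [Module A M]
    [Module (QuotBy x) M] [IsScalarTower A (QuotBy x) M] [Module.Finite (QuotBy x) M] (n : ℕ)
    (h : GdimLE A n M) : ∃ k, GdimLE (QuotBy x) k M := by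
  match n with
  | 0 => exact ⟨0, TR.of_gdimLE_one hx M h.succ⟩
  | n + 1 =>
    induction n generalizing M with
    | zero => exact ⟨0, TR.of_gdimLE_one hx M h⟩
    | succ n ih =>
      obtain ⟨m, q, hq⟩ := Module.Finite.exists_fin' (QuotBy x) M
      have hK : GdimLE A (n + 1) (LinearMap.ker (liftCover q)) :=
        h.syzygy (SES.of_surjective (liftCover_surjective hq))
      obtain ⟨k, hk⟩ := ih (LinearMap.ker q) (hK.ker_of_ker_liftCover q hx)
      exact ⟨k + 1, _, _, _, _, _, _, _, q, inferInstance, inferInstance, SES.of_surjective hq, hk⟩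

end DescentTR

/-! ### The residue field, and a depth criterion for total reflexivity -/

section ResidueField

open IsLocalRing

theorem nonempty_residueField_equiv {A B : Type u} [CommRing A] [CommRing B] [Algebra A B]
    [IsLocalRing A] [IsLocalRing B] (hB : Function.Surjective (algebraMap A B)) :
    Nonempty (ResidueField B ≃ₗ[A] ResidueField A) := by
  have hs : Function.Surjective (Algebra.linearMap A (ResidueField B)) := by
    intro y
    obtain ⟨b, rfl⟩ := residue_surjective y
    obtain ⟨a, rfl⟩ := hB b
    exact ⟨a, rfl⟩
  have hk : LinearMap.ker (Algebra.linearMap A (ResidueField B)) = maximalIdeal A := by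
    have : (RingHom.ker (algebraMap A (ResidueField B))).IsMaximal :=
      RingHom.ker_isMaximal_of_surjective _ hs
    exact eq_maximalIdeal this
  exact ⟨((Submodule.quotEquivOfEq _ _ hk.symm).trans
    ((Algebra.linearMap A (ResidueField B)).quotKerEquivOfSurjective hs)).symm⟩

theorem isLocalRing_quotBy {A : Type u} [CommRing A] [IsLocalRing A] {x : A}
    (hx : x ∈ maximalIdeal A) : IsLocalRing (QuotBy x) := by
  have : Nontrivial (QuotBy x) := Ideal.Quotient.nontrivial_iff.mpr <|
    ne_top_of_le_ne_top (maximalIdeal.isMaximal A).ne_top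
      ((Ideal.span_singleton_le_iff_mem _).mpr hx)
  exact .of_surjective' _ Ideal.Quotient.mk_surjective

variable {A : Type u} [CommRing A] [IsLocalRing A]
variable {M N : Type u} [AddCommGroup M] [Module A M] [AddCommGroup N] [Module A N]

theorem extV_residueField_zero_of_isSMulRegular {x : A} (hx : x ∈ maximalIdeal A)
    (h : IsSMulRegular N x) : ExtV A (ResidueField A) N 0 := by
  rw [extV_zero_iff]
  refine ⟨fun φ ψ => LinearMap.ext fun m => h ?_⟩
  have h0 : ∀ m : ResidueField A, x • m = 0 := by
    rwa [← Module.mem_annihilator, show Module.annihilator A (ResidueField A) = maximalIdeal A from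
      Ideal.annihilator_quotient]
  change x • φ m = x • ψ m
  rw [← map_smul, ← map_smul, h0, map_zero, map_zero]

theorem extV_residueField_quotBy_iff {x : A} (hxA : IsSMulRegular A x)
    [IsLocalRing (QuotBy x)] {N' : Type u} [AddCommGroup N'] [Module A N'] [Module (QuotBy x) N']
    [IsScalarTower A (QuotBy x) N'] {π : N →ₗ[A] N'}
    (hN : SES (x • LinearMap.id : N →ₗ[A] N) π) (i : ℕ) :
    ExtV (QuotBy x) (ResidueField (QuotBy x)) N' i ↔ ExtV A (ResidueField A) N (i + 1) := by
  obtain ⟨e⟩ := nonempty_residueField_equiv (A := A) (B := QuotBy x) Ideal.Quotient.mk_surjective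
  rw [SES.extV_iff_rees (SES.quotBy hxA) hN, extV_congr_left e]

variable [IsNoetherianRing A]

theorem exists_isSMulRegular_of_extV_zero [Module.Finite A N]
    (h : ExtV A (ResidueField A) N 0) : ∃ x ∈ maximalIdeal A, IsSMulRegular N x := by
  rw [extV_zero_iff, IsSMulRegular.subsingleton_linearMap_iff] at h
  obtain ⟨x, hx, h⟩ := h
  refine ⟨x, ?_, h⟩
  rwa [show Module.annihilator A (ResidueField A) = maximalIdeal A from
    Ideal.annihilator_quotient] at hx

/-- Over a ring of depth zero, modules of finite G-dimension are totally reflexive. -/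
theorem TR.of_gdimLE_of_depth_zero {n : ℕ} (h : GdimLE A n M)
    (hA : ¬ ExtV A (ResidueField A) A 0) : TR A M := by
  induction n generalizing M with
  | zero => exact h
  | succ n ih =>
    obtain ⟨K, F, _, _, _, _, f, g, h1, h2, h3, h4⟩ := h
    have hK := ih h4
    have hKf := hK.finite
    have hF : TR A F := .of_projective
    refine hK.of_syzygy h3 (h3.extV_one_of_extend extV_of_projective fun φ => ?_)
    let d := LinearMap.lcomp A A f
    -- The cokernel of `F* → K*` has zero dual: a functional on it is evaluation at some `k` in `K`
    -- that all functionals of `F` kill. So an `A`-regular element annihilates the cokernel; in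
    -- depth zero it is a unit, and `F* → K*` is onto.
    have h0 : Subsingleton (((K →ₗ[A] A) ⧸ LinearMap.range d) →ₗ[A] A) := by
      refine subsingleton_of_forall_eq 0 fun Φ => ?_
      obtain ⟨k, hk⟩ := hK.exists_eval_eq (Φ ∘ₗ (LinearMap.range d).mkQ)
      have : k = 0 := by
        apply h3.inj
        rw [map_zero]
        refine hF.eq_zero fun μ => ?_
        have := hk (d μ)
        rw [LinearMap.comp_apply, Submodule.mkQ_apply, 
          (Submodule.Quotient.mk_eq_zero _).mpr (LinearMap.mem_range_self d μ), map_zero] at this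
        exact this.symm
      ext μ
      rw [hk, this, map_zero]
      rfl
    rw [IsSMulRegular.subsingleton_linearMap_iff] at h0
    obtain ⟨x, hx, hxA⟩ := h0
    by_cases hxm : x ∈ maximalIdeal A
    · exact absurd (extV_residueField_zero_of_isSMulRegular hxm hxA) hA
    · obtain ⟨y, hy⟩ := (notMem_maximalIdeal.mp hxm).exists_left_inv
      have := Module.mem_annihilator.mp hx (Submodule.Quotient.mk (y • φ))
      rw [← Submodule.Quotient.mk_smul, smul_smul, mul_comm, hy, one_smul,
        Submodule.Quotient.mk_eq_zero] at this
      exact this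

/-- A module of finite G-dimension whose depth is at least that of the ring is totally
reflexive. -/
theorem TR.of_gdimLE {n : ℕ} (h : GdimLE A n M) [Module.Finite A M] (r : ℕ)
    (hr : ¬ ∀ i < r + 1, ExtV A (ResidueField A) A i)
    (hM : ∀ s, (∀ i < s, ExtV A (ResidueField A) A i) → ∀ i < s, ExtV A (ResidueField A) M i) :
    TR A M := by
  by_cases h0 : ExtV A (ResidueField A) A 0
  swap
  · exact TR.of_gdimLE_of_depth_zero h h0
  induction r generalizing A M with
  | zero =>
    refine absurd ?_ hr
    intro i hi
    obtain rfl : i = 0 := by omega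
    exact h0
  | succ r ih =>
    -- Using `A × M` gives one element regular on both.
    obtain ⟨x, hx, hreg⟩ := exists_isSMulRegular_of_extV_zero
      (h0.prod' (hM 1 (fun i hi => by obtain rfl : i = 0 := by omega
                                      exact h0) 0 one_pos))
    have hxA : IsSMulRegular A x := hreg.of_injective (LinearMap.inl A A M) LinearMap.inl_injective
    have hxM : IsSMulRegular M x := hreg.of_injective (LinearMap.inr A A M) LinearMap.inr_injective
    have := isLocalRing_quotBy hx
    have hA := extV_residueField_quotBy_iff hxA (SES.quotBy hxA)
    have hM' := extV_residueField_quotBy_iff hxA (SES.quotBy_tensor hxM)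
    have hb := h.quotBy hxA hxM
    have key : TR (QuotBy x) (QuotBy x ⊗[A] M) := by
      by_cases h0' : ExtV (QuotBy x) (ResidueField (QuotBy x)) (QuotBy x) 0
      swap
      · exact TR.of_gdimLE_of_depth_zero hb h0'
      refine ih hb (fun H => hr fun i hi => ?_) (fun s hs i hi => ?_) h0'
      · cases i with
        | zero => exact h0
        | succ i => exact (hA i).mp (H i (by omega))
      · rw [hM']
        refine hM (s + 1) (fun j hj => ?_) _ (by omega)
        cases j with
        | zero => exact h0
        | succ j => exact (hA j).mp (hs j (by omega))
    refine h.tr fun i hi => ?_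
    -- Total reflexivity modulo `x` gives `Extⁱ(M, A/x) = 0`, and Nakayama lifts this to `Extⁱ(M, A)
    -- = 0`.
    refine (SES.quotBy hxA).extV_nakayama' hx ?_
    obtain ⟨i, rfl⟩ := Nat.exists_eq_add_of_le' hi
    exact (extV_quotBy_iff hxA hxM i).mp (key.ext _ hi)

end ResidueField

/-! ### Depth through Ext, and Cohen–Macaulay rings -/

section Depth

open IsLocalRing

/-- The depth of the module `N` is at least `n`. -/
def DepthGE (A : Type u) [CommRing A] [IsLocalRing A] (N : Type u) [AddCommGroup N] [Module A N]
    (n : ℕ) : Prop :=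
  ∀ i < n, ExtV A (ResidueField A) N i

variable {A : Type u} [CommRing A] [IsLocalRing A]
variable {M N N' : Type u} [AddCommGroup M] [Module A M] [AddCommGroup N] [Module A N]
  [AddCommGroup N'] [Module A N'] {x : A} {π : N →ₗ[A] N'}

theorem smul_residueField_eq_zero (hx : x ∈ maximalIdeal A) (m : ResidueField A) : x • m = 0 := by
  revert m
  rwa [← Module.mem_annihilator, show Module.annihilator A (ResidueField A) = maximalIdeal A from
      Ideal.annihilator_quotient]

theorem DepthGE.mono {m n : ℕ} (h : DepthGE A N n) (hmn : m ≤ n) : DepthGE A N m :=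
  fun i hi => h i (hi.trans_le hmn)

theorem DepthGE.congr {n : ℕ} (h : DepthGE A N n) (e : N ≃ₗ[A] N') : DepthGE A N' n :=
  fun i hi => (h i hi).congr_right e

theorem DepthGE.prod {n : ℕ} (h : DepthGE A N n) (h' : DepthGE A N' n) : DepthGE A (N × N') n :=
  fun i hi => (h i hi).prod' (h' i hi)

theorem DepthGE.quot {n : ℕ} (h : DepthGE A N (n + 1))
    (hN : SES (x • LinearMap.id : N →ₗ[A] N) π) : DepthGE A N' n :=
  fun i hi => hN.extV_right' (h i (by omega)) (h (i + 1) (by omega))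

theorem DepthGE.of_quot {n : ℕ} (h : DepthGE A N' n) (hx : x ∈ maximalIdeal A)
    (hN : SES (x • LinearMap.id : N →ₗ[A] N) π) : DepthGE A N (n + 1)
  | 0, _ => hN.extV_zero_of_torsion (smul_residueField_eq_zero hx)
  | i + 1, hi => hN.extV_succ_of_torsion (smul_residueField_eq_zero hx) (h i (by omega))

variable [IsNoetherianRing A]

theorem DepthGE.exists_isSMulRegular [Module.Finite A N] {n : ℕ} (h : DepthGE A N (n + 1)) :
    ∃ x ∈ maximalIdeal A, IsSMulRegular N x :=
  exists_isSMulRegular_of_extV_zero (h 0 n.succ_pos)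

/-- If the depth exceeded the dimension, `extV_of_ringKrullDim_lt` would give `Hom(A, A) = 0`. -/
theorem DepthGE.le_ringKrullDim {n : ℕ} (h : DepthGE A A n) : n ≤ ringKrullDim A := by
  by_contra! hlt
  have h0 : ExtV A A A 0 := extV_of_ringKrullDim_lt h n 0
    ((ringKrullDim_le_of_surjective _ Ideal.Quotient.mk_surjective).trans_lt hlt) (by omega)
  rw [extV_zero_iff] at h0
  exact one_ne_zero (LinearMap.congr_fun (Subsingleton.elim (LinearMap.id : A →ₗ[A] A) 0) 1)

theorem exists_isRegular_iff_depthGE [Module.Finite A N] [Nontrivial N] {n : ℕ} :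
    (∃ rs : List A, rs.length = n ∧ (∀ r ∈ rs, r ∈ maximalIdeal A) ∧
      RingTheory.Sequence.IsRegular N rs) ↔ DepthGE A N n := by
  have hlt : maximalIdeal A • (⊤ : Submodule A N) < ⊤ := by
    rw [lt_top_iff_ne_top]
    exact Submodule.top_ne_ideal_smul_of_le_jacobson_annihilator
      (maximalIdeal_le_jacobson _) |>.symm
  have hsupp : Module.support A (ResidueField A) = PrimeSpectrum.zeroLocus (maximalIdeal A) := by
    rw [Module.support_eq_zeroLocus]
    congr 2
    exact Ideal.annihilator_quotient
  constructor
  · rintro ⟨rs, rfl, hm, hr⟩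
    exact ModuleCat.subsingleton_ext_of_exists_isRegular (maximalIdeal A)
      (ModuleCat.of A (ResidueField A)) hsupp.le (ModuleCat.of A N) hlt rs hm hr
  · intro h
    exact ModuleCat.exists_isRegular_of_exists_subsingleton_ext (maximalIdeal A) n
      (ModuleCat.of A N) hlt (ModuleCat.of A (ResidueField A)) hsupp h

theorem isCohenMacaulayLocal_iff :
    IsCohenMacaulayLocal A ↔ ∃ d : ℕ, ringKrullDim A = d ∧ DepthGE A A d := by
  obtain ⟨d, hd⟩ : ∃ d : ℕ, ringKrullDim A = d := by
    have h1 := ringKrullDim_ne_top (R := A)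
    have h2 := ringKrullDim_ne_bot (R := A)
    obtain ⟨e, he⟩ := WithBot.ne_bot_iff_exists.mp h2
    rw [← he] at h1 ⊢
    obtain ⟨d, rfl⟩ := ENat.ne_top_iff_exists.mp (show e ≠ ⊤ by rintro rfl; exact h1 rfl)
    exact ⟨d, rfl⟩
  have hle : depth A ≤ d := by
    refine iSup_le fun rs => ?_
    have := (exists_isRegular_iff_depthGE.mp ⟨rs.1, rfl, rs.2⟩).le_ringKrullDim
    rw [hd] at this
    exact_mod_cast this
  constructor
  · intro h
    refine ⟨d, hd, ?_⟩
    have h1 : depth A = d := by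
      have := h.depth_eq.trans hd
      exact_mod_cast this
    cases d with
    | zero => exact fun i hi => absurd hi (by omega)
    | succ d =>
      have h2 : (d : ℕ∞) < depth A := by
        rw [h1]
        exact_mod_cast d.lt_succ_self
      obtain ⟨rs, hrs⟩ := lt_iSup_iff.mp h2
      exact (exists_isRegular_iff_depthGE.mp ⟨rs.1, rfl, rs.2⟩).mono (by exact_mod_cast hrs)
  · rintro ⟨d', hd', h⟩
    obtain rfl : d = d' := by
      have := hd.symm.trans hd'
      exact_mod_cast this
    refine ⟨inferInstance, inferInstance, ?_⟩
    rw [hd]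
    refine congrArg _ (hle.antisymm ?_)
    obtain ⟨rs, rfl, hrs⟩ := exists_isRegular_iff_depthGE.mpr h
    exact le_iSup_of_le ⟨rs, hrs⟩ le_rfl

theorem DepthGE.algebra {B : Type u} [CommRing B] [IsLocalRing B] [Algebra A B]
    [IsLocalHom (algebraMap A B)] [Module B N] [IsScalarTower A B N] [Module.Finite A N]
    {n : ℕ} (h : DepthGE A N n) : DepthGE B N n := by
  induction n generalizing N with
  | zero => exact fun i hi => absurd hi (by omega)
  | succ n ih =>
    obtain ⟨a, ha, hreg⟩ := h.exists_isSMulRegular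
    have hreg' : IsSMulRegular N (algebraMap A B a) := fun x y hxy => hreg (by simpa using hxy)
    have hs := SES.smul_of_isSMulRegular hreg'
    have hs' : SES (a • LinearMap.id : N →ₗ[A] N) ((Submodule.mkQ _).restrictScalars A) :=
      ⟨hreg, fun y => (hs.exact y).trans (by simp [Set.mem_range]), hs.surj⟩
    have := hs'.finite_right
    exact (ih (h.quot hs')).of_quot (fun h => ha (h.of_map (f := algebraMap A B))) hs

/-- A module of depth at least `r` has `Extⁱ(M, D) = 0` for `i + r > n`, where `n` is the injective
dimension of `D`. -/
theorem DepthGE.extV [Module.Finite A N] {n r : ℕ}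
    (hN : ∀ (M : Type u) [AddCommGroup M] [Module A M] [Module.Finite A M] (i : ℕ),
      n < i → ExtV A M N i) [Module.Finite A M] (hM : DepthGE A M r) (i : ℕ) (hi : n < i + r) :
    ExtV A M N i := by
  induction r generalizing M i with
  | zero => exact hN M i hi
  | succ r ih =>
    obtain ⟨x, hx, hreg⟩ := hM.exists_isSMulRegular
    have hs := SES.smul_of_isSMulRegular hreg
    exact hs.extV_nakayama hx (ih (hM.quot hs) (i + 1) (by omega))

/-- Divide `M` by a maximal regular sequence: the quotient has depth zero, and each element raises
the Ext bound by one. For `M = A` this plays the role of a depth-zero module of projective dimension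
`d`. -/
theorem exists_module_of_depth_eq [Module.Finite A M] {d e : ℕ} (h : DepthGE A M d)
    (hd : ¬ DepthGE A M (d + 1)) (hM : ∀ i, e < i → ExtV A M N i) :
    ∃ (W : Type u) (_ : AddCommGroup W) (_ : Module A W), Module.Finite A W ∧
      ¬ ExtV A (ResidueField A) W 0 ∧ ∀ i, d + e < i → ExtV A W N i := by
  induction d generalizing M e with
  | zero =>
    refine ⟨M, _, _, inferInstance, fun h0 => hd fun i hi => ?_, fun i hi => hM i (by omega)⟩
    obtain rfl : i = 0 := by omega
    exact h0
  | succ d ih =>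
    obtain ⟨x, hx, hreg⟩ := h.exists_isSMulRegular
    have hs := SES.smul_of_isSMulRegular hreg
    obtain ⟨W, _, _, h1, h2, h3⟩ := ih (e := e + 1) (h.quot hs) (fun H => hd (H.of_quot hx hs))
      (fun i hi => by
        obtain ⟨i, rfl⟩ := Nat.exists_eq_add_of_le' (show 1 ≤ i by omega)
        exact hs.extV_right (hM i (by omega)) (hM _ (by omega)))
    exact ⟨W, _, _, h1, h2, fun i hi => h3 i (by omega)⟩

/-- The injective dimension of a finite module, if finite, is at most the depth of the ring. -/
theorem extV_of_depth_lt [Module.Finite A N] {d n : ℕ} (h : DepthGE A A d)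
    (hd : ¬ DepthGE A A (d + 1)) (hN : HasInjectiveDimensionLE (ModuleCat.of A N) n)
    [Module.Finite A M] (i : ℕ) (hi : d < i) : ExtV A M N i := by
  rw [hasInjectiveDimensionLE_iff_extV] at hN
  obtain ⟨W, _, _, _, hW0, hW⟩ := exists_module_of_depth_eq (N := N) h hd (e := 0)
    fun i hi => extV_of_projective' hi
  have hW0' : ∃ φ : ResidueField A →ₗ[A] W, φ ≠ 0 := by
    by_contra! H
    exact hW0 (extV_zero_iff.mpr (subsingleton_of_forall_eq 0 H))
  obtain ⟨φ, hφ⟩ := hW0'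
  have hinj : Function.Injective φ := by
    rw [injective_iff_map_eq_zero]
    intro y hy
    by_contra hy0
    apply hφ
    ext z
    obtain ⟨a, ha⟩ := residue_surjective (z * y⁻¹)
    have : z = a • y := by
      rw [Algebra.smul_def, ResidueField.algebraMap_eq, ha, inv_mul_cancel_right₀ hy0]
    rw [this, map_smul, hy, smul_zero, LinearMap.zero_apply]
  have hs := SES.of_injective hinj
  -- Descending induction on `i` from above `n`: the residue field embeds in `W`, whose Ext vanishes
  -- beyond `d`, so its `Extⁱ` is controlled by `Extⁱ⁺¹` of the cokernel.
  have key : ∀ t, ∀ i, d < i → n < i + t → ExtV A (ResidueField A) N i := by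
    intro t
    induction t with
    | zero => exact fun i _ hi => hN _ i hi
    | succ t ih =>
      intro i hi ht
      refine hs.extV_left (hW i (by omega)) ?_
      exact extV_of_residueField (r := i + 1) (fun j hj => ih j (by omega) (by omega)) _ le_rfl
  exact extV_of_residueField (r := d + 1) (fun j hj => key n j hj (by omega)) i hi

/-- Modules of maximal depth are acyclic for `Hom(-, N)` when `N` has finite injective
dimension. -/
theorem DepthGE.extV_of_injDim [Module.Finite A N] {d n : ℕ} (h : DepthGE A A d)
    (hd : ¬ DepthGE A A (d + 1)) (hN : HasInjectiveDimensionLE (ModuleCat.of A N) n)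
    [Module.Finite A M] (hM : DepthGE A M d) (i : ℕ) (hi : 1 ≤ i) : ExtV A M N i :=
  DepthGE.extV (n := d) (fun _ _ _ _ j hj => extV_of_depth_lt h hd hN j hj) hM i (by omega)

end Depth

/-! ### Depth along surjections -/

section

open IsLocalRing

theorem DepthGE.of_algebra_surjective {A B N : Type u} [CommRing A] [IsLocalRing A] [AddCommGroup N] [Module A N] [CommRing B] [IsLocalRing B] [Algebra A B]
    [IsNoetherianRing B] (hB : Function.Surjective (algebraMap A B)) [Module B N]
    [IsScalarTower A B N] [Module.Finite B N] {n : ℕ} (h : DepthGE B N n) : DepthGE A N n := by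
  induction n generalizing N with
  | zero => exact fun i hi => absurd hi (by omega)
  | succ n ih =>
    obtain ⟨b, hb, hreg⟩ := h.exists_isSMulRegular
    obtain ⟨a, rfl⟩ := hB b
    have hs := SES.smul_of_isSMulRegular hreg
    have hs' : SES (a • LinearMap.id : N →ₗ[A] N) ((Submodule.mkQ _).restrictScalars A) :=
      ⟨fun x y hxy => hs.inj (by simpa using hxy), fun y => (hs.exact y).trans (by
        simp [Set.mem_range]), hs.surj⟩
    refine (ih (h.quot hs)).of_quot ?_ hs'
    exact fun h => hb (h.map (algebraMap A B))

end

/-! ### A semidualizing module from a surjection of finite G-dimension -/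

section Construction

open IsLocalRing

theorem top_isPrincipal_iff {A M : Type*} [CommRing A] [AddCommGroup M] [Module A M] :
    (⊤ : Submodule A M).IsPrincipal ↔ ∃ a : M, ∀ b, ∃ q : A, q • a = b := by
  constructor
  · rintro ⟨a, ha⟩
    exact ⟨a, fun b => Submodule.mem_span_singleton.mp (ha ▸ trivial)⟩
  · rintro ⟨a, ha⟩
    exact ⟨a, (eq_top_iff.mpr fun b _ => Submodule.mem_span_singleton.mpr (ha b)).symm⟩

theorem exists_linearMap_apply_one {S R N : Type u} [CommRing S] [CommRing R] [Algebra S R]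
    [AddCommGroup N] [Module S N] (hSR : Function.Surjective (algebraMap S R)) (s : N)
    (hs : ∀ t : S, algebraMap S R t = 0 → t • s = 0) : ∃ φ : R →ₗ[S] N, φ 1 = s := by
  have hle : LinearMap.ker (Algebra.linearMap S R) ≤
    LinearMap.ker (LinearMap.toSpanSingleton S N s) := hs
  refine ⟨(LinearMap.ker (Algebra.linearMap S R)).liftQ _ hle ∘ₗ
    ((Algebra.linearMap S R).quotKerEquivOfSurjective hSR).symm.toLinearMap, ?_⟩
  have : ((Algebra.linearMap S R).quotKerEquivOfSurjective hSR).symm 1 =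
      Submodule.Quotient.mk 1 := by
    rw [LinearEquiv.symm_apply_eq]
    exact (map_one (algebraMap S R)).symm
  rw [LinearMap.comp_apply, LinearEquiv.coe_coe, this]
  exact one_smul S s

variable {Q : Type u} [CommRing Q] (I : Ideal Q)

/-- The connecting map is linear and onto because `q` kills `M`, so it carries a generator to a
generator. -/
theorem SES.isPrincipal_ext {M N N' : Type u} [AddCommGroup M] [Module Q M] [AddCommGroup N]
    [Module Q N] [AddCommGroup N'] [Module Q N'] {q : Q} {π : N →ₗ[Q] N'}
    (hN : SES (q • LinearMap.id : N →ₗ[Q] N) π) (hM : ∀ m : M, q • m = 0) {g : ℕ}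
    (h : (⊤ : Submodule Q (Abelian.Ext (ModuleCat.of Q M) (ModuleCat.of Q N') g)).IsPrincipal) :
    (⊤ : Submodule Q
      (Abelian.Ext (ModuleCat.of Q M) (ModuleCat.of Q N) (g + 1))).IsPrincipal := by
  rw [top_isPrincipal_iff] at *
  obtain ⟨a, ha⟩ := h
  refine ⟨a.comp hN.shortExact.extClass rfl, fun b => ?_⟩
  obtain ⟨φ, rfl⟩ := hN.exists_comp_extClass hM b
  obtain ⟨q, rfl⟩ := ha φ
  exact ⟨q, (Abelian.Ext.smul_comp ..).symm⟩

/-- As `R = S/IS`, the maps from `Q/I` to `S` are those from `R` to `S`, and `Hom_S(R, S)` has the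
single generator `φ₀`. -/
theorem isPrincipal_ext_zero {S R : Type u} [CommRing S] [CommRing R] [Algebra S R] [Algebra Q S]
    (hQS : Function.Surjective (algebraMap Q S)) (hSR : Function.Surjective (algebraMap S R))
    (hI : ∀ s : S, algebraMap S R s = 0 ↔ ∃ q ∈ I, algebraMap Q S q = s)
    (e : CoextHom S R S ≃ₗ[R] R) :
    (⊤ : Submodule Q
      (Abelian.Ext (ModuleCat.of Q (Q ⧸ I)) (ModuleCat.of Q S) 0)).IsPrincipal := by
  set φ₀ := e.symm 1 with hφ₀
  have hφ : ∀ φ : CoextHom S R S, ∃ r : R, φ = r • φ₀ := fun φ =>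
    ⟨e φ, by rw [hφ₀, ← map_smul, smul_eq_mul, mul_one, e.symm_apply_apply]⟩
  have hφ₀' : ∀ t : S, φ₀.toHom (algebraMap S R t) = t * φ₀.toHom 1 := fun t => by
    rw [Algebra.algebraMap_eq_smul_one, map_smul, smul_eq_mul]
  have hle : I ≤ LinearMap.ker (LinearMap.toSpanSingleton Q S (φ₀.toHom 1)) := fun q hq => by
    rw [LinearMap.mem_ker, LinearMap.toSpanSingleton_apply, Algebra.smul_def, ← hφ₀',
      (hI _).mpr ⟨q, hq, rfl⟩, map_zero]
  rw [top_isPrincipal_iff]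
  refine ⟨Abelian.Ext.mk₀ (ModuleCat.ofHom (Submodule.liftQ I _ hle)), fun b => ?_⟩
  obtain ⟨η, rfl⟩ := (Abelian.Ext.mk₀_bijective _ _).2 b
  obtain ⟨φ, h1⟩ := exists_linearMap_apply_one hSR (η.hom (1 : Q ⧸ I)) fun t ht => by
    obtain ⟨q, hq, rfl⟩ := (hI t).mp ht
    rw [algebraMap_smul, ← map_smul, Algebra.smul_def, mul_one, Ideal.Quotient.algebraMap_eq,
      Ideal.Quotient.eq_zero_iff_mem.mpr hq, map_zero]
  obtain ⟨r, hr⟩ := hφ φ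
  obtain ⟨t, rfl⟩ := hSR r
  obtain ⟨q, rfl⟩ := hQS t
  refine ⟨q, ?_⟩
  rw [← Abelian.Ext.mk₀_smul]
  congr 1
  ext1
  refine LinearMap.ext fun y => ?_
  obtain ⟨p, rfl⟩ := Ideal.Quotient.mk_surjective y
  have h2 : η.hom (1 : Q ⧸ I) = q • φ₀.toHom 1 := by
    rw [← h1, Algebra.smul_def, ← hφ₀', ← mul_one (algebraMap S R _), ← CoextHom.smul_toHom, ← hr]
    rfl
  have h3 : Ideal.Quotient.mk I p = p • (1 : Q ⧸ I) := by
    rw [Algebra.smul_def, mul_one]; rfl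
  rw [h3, map_smul, map_smul, h2]
  change p • q • (1 : Q) • φ₀.toHom 1 = _
  rw [one_smul]

variable {R : Type u} [CommRing R]

/-- For `C = Hom_S(R, S)`, adjunction turns endomorphisms of `C` into the `S`-bidual of `R`, which
is `R` by reflexivity. Likewise `Ext_R(C, C)` corresponds to `Ext_S(C, S)`, the Ext of the dual, in
positive degrees. -/
theorem TR.isSemidualizing {S : Type u} [CommRing S] [IsNoetherianRing S] [Algebra S R]
    (h : TR S R) : IsSemidualizing (ModuleCat.of R (CoextHom S R S)) := by
  have hunl : ∀ r : R, ∀ φ : CoextHom S R S, (r • φ).toHom 1 = φ.toHom r := fun r φ => by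
    rw [CoextHom.smul_toHom, mul_one]
  have : Module.Finite S (CoextHom S R S) := h.dual.finite
  refine ⟨Module.Finite.of_restrictScalars_finite S R _, ⟨?_, ?_⟩, fun i hi => ?_⟩
  · rw [injective_iff_map_eq_zero]
    intro r hr
    refine h.eq_zero fun μ => ?_
    have h1 : r • (show CoextHom S R S from μ) = 0 := LinearMap.congr_fun hr _
    have h2 := hunl r μ
    rw [h1] at h2
    exact h2.symm
  · intro ψ
    obtain ⟨r, hr⟩ := h.exists_eval_eq
      (CoextHom.unlift (A := S) (B := R) (N := S) (M := CoextHom S R S) ψ)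
    refine ⟨r, CoextHom.unlift_injective (A := S) (B := R) (N := S)
      (M := CoextHom S R S) (LinearMap.ext fun φ => ?_)⟩
    exact (hunl r φ).trans (hr φ).symm
  · exact (extV_coextHom_iff (A := S) (B := R) (N := S) (M := CoextHom S R S) h.ext hi).mpr (h.ext_dual i hi)

theorem ringKrullDim_quotient_annihilator {S : Type u} [CommRing S] [Algebra S R]
    (hSR : Function.Surjective (algebraMap S R)) :
    ringKrullDim (S ⧸ Module.annihilator S R) ≤ ringKrullDim R := by
  have hle : ∀ a ∈ RingHom.ker (algebraMap S R), a ∈ Module.annihilator S R := fun a ha => by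
    rw [Module.mem_annihilator]
    intro r
    rw [Algebra.smul_def, (RingHom.mem_ker).mp ha, zero_mul]
  rw [← ringKrullDim_eq_of_ringEquiv (RingHom.quotientKerEquivOfSurjective hSR)]
  exact ringKrullDim_le_of_surjective (Ideal.Quotient.factor hle)
    (Ideal.Quotient.factor_surjective hle)

theorem exists_quotBy_algebra {S : Type u} [CommRing S] [Algebra S R] [Algebra Q S]
    (hI : ∀ s : S, algebraMap S R s = 0 ↔ ∃ q ∈ I, algebraMap Q S q = s) {x : S}
    (hx0 : algebraMap S R x = 0) : ∃ _ : Algebra (QuotBy x) R, IsScalarTower S (QuotBy x) R ∧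
      ∀ s : QuotBy x, algebraMap (QuotBy x) R s = 0 ↔ ∃ q ∈ I, algebraMap Q (QuotBy x) q = s := by
  have hker : ∀ a ∈ Ideal.span {x}, algebraMap S R a = 0 := fun a ha => by
    obtain ⟨b, rfl⟩ := Ideal.mem_span_singleton'.mp ha
    rw [map_mul, hx0, mul_zero]
  let := (Ideal.Quotient.lift (Ideal.span {x}) (algebraMap S R) hker).toAlgebra
  have : IsScalarTower S (QuotBy x) R := .of_algebraMap_eq fun a => rfl
  refine ⟨inferInstance, this, fun s => ?_⟩
  obtain ⟨s, rfl⟩ := Ideal.Quotient.mk_surjective s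
  rw [← Ideal.Quotient.algebraMap_eq, ← IsScalarTower.algebraMap_apply S (QuotBy x) R]
  constructor
  · intro h
    obtain ⟨q, hq, rfl⟩ := (hI s).mp h
    exact ⟨q, hq, rfl⟩
  · rintro ⟨q, hq, hqs⟩
    rw [IsScalarTower.algebraMap_apply S (QuotBy x) R, ← hqs,
      IsScalarTower.algebraMap_apply Q S (QuotBy x), ← IsScalarTower.algebraMap_apply S (QuotBy x) R]
    exact (hI _).mpr ⟨q, hq, rfl⟩

variable [IsLocalRing R] [IsNoetherianRing R]

/-- A nonzero map `R → S` forces `depth S ≤ dim R`, and `dim R` is the depth of `R`; so the depth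
criterion `TR.of_gdimLE` applies. -/
theorem TR.of_gdimLE_of_surjective {d : ℕ} (hdim : ringKrullDim R = d)
    (hdepth : DepthGE R R d) {r : ℕ} {S : Type u} [CommRing S] [IsLocalRing S]
    [IsNoetherianRing S] [Algebra S R] (hSR : Function.Surjective (algebraMap S R))
    (hr : ¬ DepthGE S S (r + 1)) {n : ℕ} (hG : GdimLE S n R) (h0 : ¬ ExtV S R S 0) :
    TR S R := by
  have hfin : Module.Finite S R := Module.Finite.of_surjective (Algebra.linearMap S R) hSR
  refine TR.of_gdimLE hG r hr fun s hs i hi => ?_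
  have hsd : s ≤ d := by
    by_contra! hlt
    refine h0 (extV_of_ringKrullDim_lt hs s 0 ?_ (by omega))
    refine (ringKrullDim_quotient_annihilator hSR).trans_lt ?_
    rw [hdim]
    exact_mod_cast hlt
  exact hdepth.of_algebra_surjective hSR i (by omega)

/-- Over the common residue field `k`, vanishing of `Ext_S(k, S)` and of `Ext_R(k, C)` are
equivalent in positive degrees. -/
theorem exists_injDimLE_of_coextHom {S : Type u} [CommRing S] [IsLocalRing S]
    [IsNoetherianRing S] [Algebra S R] (hSR : Function.Surjective (algebraMap S R)) (h : TR S R)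
    (hC : ∃ n : ℕ, HasInjectiveDimensionLE (ModuleCat.of R (CoextHom S R S)) n) :
    ∃ n : ℕ, HasInjectiveDimensionLE (ModuleCat.of S S) n := by
  have : Module.Finite R (CoextHom S R S) := h.isSemidualizing.finite
  rw [exists_injDimLE_iff] at *
  obtain ⟨r, hr⟩ := hC
  obtain ⟨e⟩ := nonempty_residueField_equiv hSR
  refine ⟨r + 1, fun i hi => ?_⟩
  rw [← extV_congr_left e, ← extV_coextHom_iff h.ext (by omega)]
  exact hr i (by omega)

/-- A surjection `S → R` of finite G-dimension onto a Cohen–Macaulay ring gives a semidualizing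
module over `R`. -/
theorem exists_semidualizing_of_gdimLE {d : ℕ} (hdim : ringKrullDim R = d)
    (hdepth : DepthGE R R d) (r : ℕ) (S : Type u) [CommRing S] [IsLocalRing S]
    [IsNoetherianRing S] [Algebra Q S] [Algebra S R]
    (hQS : Function.Surjective (algebraMap Q S)) (hSR : Function.Surjective (algebraMap S R))
    (hI : ∀ s : S, algebraMap S R s = 0 ↔ ∃ q ∈ I, algebraMap Q S q = s)
    (hr : ¬ DepthGE S S (r + 1)) {n : ℕ} (hG : GdimLE S n R) :
    ∃ C : ModuleCat.{u} R, IsSemidualizing C ∧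
      ((∃ n : ℕ, HasInjectiveDimensionLE C n) →
        ∃ n : ℕ, HasInjectiveDimensionLE (ModuleCat.of S S) n) ∧
      (Nonempty (C ≃ₗ[R] R) → ∃ g, (∀ i, i ≠ g → ExtV S R S i) ∧ (⊤ : Submodule Q
        (Abelian.Ext (ModuleCat.of Q (Q ⧸ I)) (ModuleCat.of Q S) g)).IsPrincipal) := by
  induction r using Nat.strong_induction_on generalizing S n with | _ r ih
  by_cases h0 : ExtV S R S 0
  swap
  · have h := TR.of_gdimLE_of_surjective hdim hdepth hSR hr hG h0
    refine ⟨_, h.isSemidualizing, exists_injDimLE_of_coextHom hSR h, fun ⟨e⟩ => ⟨0, fun i hi => ?_,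
      isPrincipal_ext_zero I hQS hSR hI e⟩⟩
    exact h.ext i (by omega)
  have hfin : Module.Finite S R := Module.Finite.of_surjective (Algebra.linearMap S R) hSR
  have h0' := h0
  rw [extV_zero_iff, IsSMulRegular.subsingleton_linearMap_iff] at h0'
  -- When `Hom(R, S) = 0`, some `S`-regular `x` annihilates `R`. Replacing `S` by `S/x` lowers the
  -- bound `r` on its depth, so the process stops.
  obtain ⟨x, hx, hxS⟩ := h0'
  have hx0 : algebraMap S R x = 0 := by
    rw [Algebra.algebraMap_eq_smul_one]
    exact Module.mem_annihilator.mp hx 1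
  have hxm : x ∈ maximalIdeal S := fun hu => by
    have := hu.map (algebraMap S R)
    rw [hx0] at this
    exact not_isUnit_zero this
  have hs := SES.quotBy hxS
  cases r with
  | zero => exact absurd (DepthGE.of_quot (n := 0) (fun i hi => absurd hi (by omega)) hxm hs) hr
  | succ r =>
    have := isLocalRing_quotBy hxm
    obtain ⟨_, _, hI'⟩ := exists_quotBy_algebra I hI hx0
    have hA := extV_residueField_quotBy_iff hxS hs
    have hfin' : Module.Finite (QuotBy x) R := Module.Finite.of_restrictScalars_finite S _ _
    obtain ⟨n', hG'⟩ := hG.exists_quotBy hxS R n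
    obtain ⟨C, hC, h1, h2⟩ := ih r r.lt_succ_self (QuotBy x)
      (Ideal.Quotient.mk_surjective.comp hQS) (fun y => by
        obtain ⟨s, rfl⟩ := hSR y
        exact ⟨_, (IsScalarTower.algebraMap_apply S (QuotBy x) R s).symm⟩) hI'
      (fun h => hr fun i hi => by
        cases i with
        | zero => exact extV_residueField_zero_of_isSMulRegular hxm hxS
        | succ i => exact (hA i).mp (h i (by omega))) hG'
    refine ⟨C, hC, fun h => ?_, fun h => ?_⟩
    · have h3 := h1 h
      rw [exists_injDimLE_iff] at h3 ⊢
      obtain ⟨r, hr⟩ := h3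
      refine ⟨r + 1, fun i hi => ?_⟩
      obtain ⟨i, rfl⟩ := Nat.exists_eq_add_of_le' (show 1 ≤ i by omega)
      exact (hA i).mp (hr i (by omega))
    · obtain ⟨g, hg, hp⟩ := h2 h
      -- Undoing one cut raises the critical degree by one. Cyclicity comes back along the
      -- connecting map, since `x` is the image of some `q` in `I`, which kills `Q/I`.
      refine ⟨g + 1, fun i hi => ?_, ?_⟩
      · cases i with
        | zero => exact h0
        | succ i => exact (hs.extV_iff_rees hs i).mp (hg i (by omega))
      · obtain ⟨q, hq, rfl⟩ := (hI x).mp hx0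
        have hs' : SES (q • LinearMap.id : S →ₗ[Q] S)
            ((Algebra.linearMap S (QuotBy (algebraMap Q S q))).restrictScalars Q) :=
          ⟨fun a b hab => hs.inj (by simpa using hab), fun y => (hs.exact y).trans (by
            simp [Set.mem_range]), hs.surj⟩
        refine hs'.isPrincipal_ext (fun m => ?_) hp
        obtain ⟨m, rfl⟩ := Ideal.Quotient.mk_surjective m
        rw [Algebra.smul_def, Ideal.Quotient.algebraMap_eq, Ideal.Quotient.eq_zero_iff_mem.mpr hq,
          zero_mul]

end Construction

/-! ### Exactness and resolutions in terms of linear maps -/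

section Complexes

variable {A : Type u} [CommRing A]

theorem exactAt_iff_function_exact {ι : Type*} {c : ComplexShape ι}
    (K : HomologicalComplex (ModuleCat.{u} A) c) (i j k : ι) (hi : c.prev j = i)
    (hk : c.next j = k) : K.ExactAt j ↔ Function.Exact (K.d i j).hom (K.d j k).hom := by
  rw [HomologicalComplex.exactAt_iff' K i j k hi hk,
    ShortComplex.ShortExact.moduleCat_exact_iff_function_exact]
  rfl

theorem exactAt_int_iff (K : ChainComplex (ModuleCat.{u} A) ℤ) (i : ℤ) :
    K.ExactAt (i + 1) ↔ Function.Exact (K.d (i + 1 + 1) (i + 1)).hom (K.d (i + 1) i).hom :=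
  exactAt_iff_function_exact K _ _ _ (by simp) (by simp)

theorem quasiIso_single_iff (P : ChainComplex (ModuleCat.{u} A) ℤ) (M : ModuleCat.{u} A)
    (hP : ∀ i : ℤ, i < 0 → Limits.IsZero (P.X i))
    (β : P ⟶ (HomologicalComplex.single (ModuleCat.{u} A) (ComplexShape.down ℤ) 0).obj M) :
    QuasiIso β ↔ (∀ n : ℕ, Function.Exact (P.d (n + 1 + 1) (n + 1)).hom (P.d (n + 1) n).hom) ∧
      Function.Exact (P.d 1 0).hom (β.f 0).hom ∧ Function.Surjective (β.f 0).hom := by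
  rw [quasiIso_iff]
  have h0 : QuasiIsoAt β 0 ↔
      Function.Exact (P.d 1 0).hom (β.f 0).hom ∧ Function.Surjective (β.f 0).hom := by
    rw [quasiIsoAt_iff' β 1 0 (-1) (by simp) (by simp), ShortComplex.quasiIso_iff_of_zeros',
      ShortComplex.ShortExact.moduleCat_exact_iff_function_exact, ModuleCat.epi_iff_surjective]
    · rfl
    · exact (hP (-1) (by omega)).eq_of_tgt _ _
    · exact HomologicalComplex.single_obj_d (ComplexShape.down ℤ) ..
    · exact HomologicalComplex.single_obj_d (ComplexShape.down ℤ) ..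
  have h1 : ∀ i, i ≠ 0 → (QuasiIsoAt β i ↔ P.ExactAt i) := fun i hi =>
    quasiIsoAt_iff_exactAt' β i (HomologicalComplex.exactAt_single_obj _ _ _ _ hi)
  constructor
  · intro h
    refine ⟨fun n => ?_, h0.mp (h 0)⟩
    rw [← exactAt_int_iff, ← h1 _ (by omega)]
    exact h _
  · rintro ⟨h2, h3⟩ i
    rcases lt_trichotomy i 0 with hi | rfl | hi
    · rw [h1 i hi.ne, HomologicalComplex.exactAt_iff_isZero_homology]
      exact (HomologicalComplex.exactAt_iff_isZero_homology ..).mp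
        (ShortComplex.exact_of_isZero_X₂ _ (hP i hi))
    · exact h0.mpr h3
    · rw [h1 i hi.ne']
      obtain ⟨n, rfl⟩ : ∃ n : ℕ, i = n + 1 := ⟨(i - 1).toNat, by omega⟩
      rw [exactAt_int_iff]
      exact h2 n

end Complexes

/-! ### Spliced resolutions and Tor -/

section Sequences

variable {A : Type u} [CommRing A]

section

variable {M₁ M₂ M₃ : Type*} [AddCommGroup M₁] [AddCommGroup M₂] [AddCommGroup M₃]
  [Module A M₁] [Module A M₂] [Module A M₃]

/-- The splicing criterion: exactness of a spliced complex at a term means injectivity of the next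
inclusion. Tensoring preserves the other hypotheses, so the same test computes Tor. -/
theorem exact_comp_iff_injective {M₀ M₄ : Type*} [AddCommGroup M₀] [AddCommGroup M₄] [Module A M₀]
    [Module A M₄] {f : M₁ →ₗ[A] M₂} {g : M₂ →ₗ[A] M₃} (h : Function.Exact f g) {p : M₀ →ₗ[A] M₁}
    (hp : Function.Surjective p) (hg : Function.Surjective g) {i : M₃ →ₗ[A] M₄} :
    Function.Exact (f ∘ₗ p) (i ∘ₗ g) ↔ Function.Injective i := by
  have hr : ∀ y, y ∈ Set.range (f ∘ₗ p) ↔ g y = 0 := fun y => by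
    rw [h y, LinearMap.coe_comp, hp.range_comp]
  constructor
  · intro H
    rw [injective_iff_map_eq_zero]
    intro z hz
    obtain ⟨y, rfl⟩ := hg z
    exact (hr y).mp ((H y).mp hz)
  · intro hi y
    rw [hr, LinearMap.comp_apply, map_eq_zero_iff i hi]

end

variable (M F : ℕ → ModuleCat.{u} A) (f : ∀ n, M (n + 1) ⟶ F n) (g : ∀ n, F n ⟶ M n)
  (h : ∀ n, SES (f n).hom (g n).hom)

/-- The complex obtained by splicing short exact sequences. -/
noncomputable def spliceComplex : ChainComplex (ModuleCat.{u} A) ℕ :=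
  ChainComplex.of F (fun n => g (n + 1) ≫ f n) fun n => by
    have : f (n + 1) ≫ g (n + 1) = 0 := by
      ext1
      exact (h (n + 1)).exact.linearMap_comp_eq_zero
    simp [reassoc_of% this]

theorem spliceComplex_d (n : ℕ) :
    (spliceComplex M F f g h).d (n + 1) n = g (n + 1) ≫ f n :=
  ChainComplex.of_d F (fun n => g (n + 1) ≫ f n) n

theorem spliceComplex_exact (n : ℕ) : Function.Exact
    ((spliceComplex M F f g h).d (n + 2) (n + 1)).hom ((spliceComplex M F f g h).d (n + 1) n).hom := by
  rw [spliceComplex_d, spliceComplex_d]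
  exact (exact_comp_iff_injective (h (n + 1)).exact (h (n + 2)).surj (h (n + 1)).surj).mpr (h n).inj

/-- The projective resolution obtained by splicing short exact sequences. -/
noncomputable def spliceResolution (hF : ∀ n, Projective (F n)) : ProjectiveResolution (M 0) where
  complex := spliceComplex M F f g h
  projective := hF
  π := (ChainComplex.toSingle₀Equiv _ _).symm ⟨g 0, by
    have : f 0 ≫ g 0 = 0 := by
      ext1
      exact (h 0).exact.linearMap_comp_eq_zero
    have h0 : (g 1 ≫ f 0) ≫ g 0 = 0 := by rw [Category.assoc, this, Limits.comp_zero]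
    rw [spliceComplex_d]
    exact h0⟩
  quasiIso := ⟨fun n => by
    cases n with
    | zero =>
      rw [ChainComplex.quasiIsoAt₀_iff, ShortComplex.quasiIso_iff_of_zeros',
        ShortComplex.ShortExact.moduleCat_exact_iff_function_exact, ModuleCat.epi_iff_surjective]
      · refine ⟨?_, (h 0).surj⟩
        change Function.Exact ((spliceComplex M F f g h).d 1 0).hom (g 0).hom
        rw [spliceComplex_d]
        exact (exact_comp_iff_injective (h 0).exact (h 1).surj (h 0).surj (i := LinearMap.id)).mpr
          Function.injective_id
      all_goals rfl
    | succ n =>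
      rw [quasiIsoAt_iff_exactAt' _ _ (ChainComplex.exactAt_succ_single_obj _ _),
        exactAt_iff_function_exact _ (n + 2) (n + 1) n (by simp) (by simp)]
      exact spliceComplex_exact M F f g h n⟩

-- Dimension shifting: `Tor_{n+1}(M₀, N) = Tor₁(M_n, N)`, the kernel of `f n ⊗ N`.
include g h in
theorem isZero_Tor'_iff (hF : ∀ n, Projective (F n)) (N : ModuleCat.{u} A) (n : ℕ) :
    Limits.IsZero (((Tor' (ModuleCat.{u} A) (n + 1)).obj (M 0)).obj N) ↔
      Function.Injective ((f n).hom.rTensor N) := by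
  have e := (spliceResolution M F f g h hF).isoLeftDerivedObj
    ((MonoidalCategory.tensoringRight (ModuleCat.{u} A)).obj N) (n + 1)
  have h1 : Limits.IsZero (((Tor' (ModuleCat.{u} A) (n + 1)).obj (M 0)).obj N) ↔
     ((((MonoidalCategory.tensoringRight (ModuleCat.{u} A)).obj N).mapHomologicalComplex _).obj
      (spliceComplex M F f g h)).ExactAt (n + 1) := by
    rw [HomologicalComplex.exactAt_iff_isZero_homology]
    exact e.isZero_iff
  rw [h1, exactAt_iff_function_exact _ (n + 2) (n + 1) n (by simp) (by simp)]
  have h2 : Function.Exact (((f (n + 1)).hom ∘ₗ (g (n + 2)).hom).rTensor N)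
      (((f n).hom ∘ₗ (g (n + 1)).hom).rTensor N) ↔ Function.Injective ((f n).hom.rTensor N) := by
    rw [LinearMap.rTensor_comp, LinearMap.rTensor_comp]
    exact exact_comp_iff_injective (rTensor_exact N (h (n + 1)).exact (h (n + 1)).surj)
      (LinearMap.rTensor_surjective N (h (n + 2)).surj)
      (LinearMap.rTensor_surjective N (h (n + 1)).surj)
  have h3 : Function.Exact (((spliceComplex M F f g h).d (n + 2) (n + 1)).hom.rTensor N)
      (((spliceComplex M F f g h).d (n + 1) n).hom.rTensor N) ↔
      Function.Injective ((f n).hom.rTensor N) := by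
    rw [spliceComplex_d, spliceComplex_d]
    exact h2
  exact h3

include g h in
theorem torIndependent_iff (hF : ∀ n, Projective (F n)) (N : ModuleCat.{u} A) :
    TorIndependent (M 0) N ↔ ∀ n, Function.Injective ((f n).hom.rTensor N) := by
  simp_rw [← isZero_Tor'_iff M F f g h hF N]
  refine ⟨fun H n => H _ (by omega), fun H n hn => ?_⟩
  obtain ⟨n, rfl⟩ := Nat.exists_eq_add_of_le' hn
  exact H n

end Sequences

/-! ### Independence of Tor vanishing from the cover -/

section Cover

variable {A : Type u} [CommRing A]
variable {M K F K' F' N : Type u} [AddCommGroup M] [AddCommGroup K] [AddCommGroup F]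
  [AddCommGroup K'] [AddCommGroup F'] [AddCommGroup N] [Module A M] [Module A K] [Module A F]
  [Module A K'] [Module A F'] [Module A N]

/-- Vanishing of the first Tor module can be tested on any projective cover. -/
theorem SES.rTensor_injective_of_cover {f : K →ₗ[A] F} {g : F →ₗ[A] M} (h : SES f g)
    {f' : K' →ₗ[A] F'} {g' : F' →ₗ[A] M} (h' : SES f' g') [Module.Projective A F]
    [Module.Projective A F'] (hf : Function.Injective (f.rTensor N)) :
    Function.Injective (f'.rTensor N) := by
  obtain ⟨s, hs⟩ := Module.projective_lifting_property g g' h.surj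
  obtain ⟨s', hs'⟩ := Module.projective_lifting_property g' g h'.surj
  have hs1 : ∀ y, g (s y) = g' y := LinearMap.congr_fun hs
  have hs1' : ∀ y, g' (s' y) = g y := LinearMap.congr_fun hs'
  have ha : ∀ k, s (f' k) ∈ LinearMap.range f := fun k =>
    (h.exact _).mp (by rw [hs1, h'.exact.apply_apply_eq_zero])
  let a : K' →ₗ[A] K := (LinearEquiv.ofInjective f h.inj).symm.toLinearMap ∘ₗ
    (s ∘ₗ f').codRestrict _ ha
  have hfa : f ∘ₗ a = s ∘ₗ f' := LinearMap.ext fun k =>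
    congrArg Subtype.val ((LinearEquiv.ofInjective f h.inj).apply_symm_apply ⟨s (f' k), ha k⟩)
  have hb : ∀ z : K × F', z.2 - s' (s z.2 - f z.1) ∈ LinearMap.range f' := fun z =>
    (h'.exact _).mp (by
      rw [map_sub, hs1', map_sub, hs1, h.exact.apply_apply_eq_zero, sub_zero, sub_self])
  let b : K × F' →ₗ[A] K' := (LinearEquiv.ofInjective f' h'.inj).symm.toLinearMap ∘ₗ
    (LinearMap.snd A K F' - s' ∘ₗ (s ∘ₗ LinearMap.snd A K F' - f ∘ₗ LinearMap.fst A K F')).codRestrict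
      _ hb
  -- As in Schanuel's lemma, `K'` is a retract of `K × F'` through `(a, f')`. Anything killed by `f'
  -- ⊗ N` is also killed by `a ⊗ N`, as `f ∘ a = s ∘ f'`, hence is zero.
  have hba : b ∘ₗ (a.prod f') = LinearMap.id := by
    refine LinearMap.ext fun k => h'.inj ?_
    have h1 : f' (b (a k, f' k)) = f' k - s' (s (f' k) - f (a k)) :=
      congrArg Subtype.val ((LinearEquiv.ofInjective f' h'.inj).apply_symm_apply ⟨_, hb (a k, f' k)⟩)
    have h2 : f (a k) = s (f' k) := LinearMap.congr_fun hfa k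
    rw [LinearMap.comp_apply]
    refine h1.trans ?_
    rw [h2, sub_self, map_zero, sub_zero]
    rfl
  have hprod : a.prod f' = LinearMap.inl A K F' ∘ₗ a + LinearMap.inr A K F' ∘ₗ f' := by
    ext <;> simp
  clear_value a b
  rw [injective_iff_map_eq_zero]
  intro t ht
  have hat : a.rTensor N t = 0 := by
    apply hf
    rw [map_zero, ← LinearMap.comp_apply, ← LinearMap.rTensor_comp, hfa, LinearMap.rTensor_comp,
      LinearMap.comp_apply, ht, map_zero]
  have : (b ∘ₗ (a.prod f')).rTensor N t = 0 := by
    rw [LinearMap.rTensor_comp, hprod, LinearMap.rTensor_add, LinearMap.comp_apply,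
      LinearMap.add_apply, LinearMap.rTensor_comp, LinearMap.rTensor_comp, LinearMap.comp_apply,
      LinearMap.comp_apply, hat, ht, map_zero, map_zero, add_zero, map_zero]
  rwa [hba, LinearMap.rTensor_id] at this

variable (A) in
/-- The standard syzygies of a module. -/
noncomputable def stdSyzygy (M : ModuleCat.{u} A) : ℕ → ModuleCat.{u} A
  | 0 => M
  | n + 1 => ModuleCat.of A
      (LinearMap.ker (Finsupp.linearCombination A (id : stdSyzygy M n → stdSyzygy M n)))

/-- The standard projection onto a standard syzygy. -/
noncomputable def stdSyzygyπ (M : ModuleCat.{u} A) (n : ℕ) :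
    ModuleCat.of A (stdSyzygy A M n →₀ A) ⟶ stdSyzygy A M n :=
  ModuleCat.ofHom (Finsupp.linearCombination A (id : stdSyzygy A M n → stdSyzygy A M n))

/-- The inclusion of a standard syzygy. -/
noncomputable def stdSyzygyι (M : ModuleCat.{u} A) (n : ℕ) :
    stdSyzygy A M (n + 1) ⟶ ModuleCat.of A (stdSyzygy A M n →₀ A) :=
  ModuleCat.ofHom (Submodule.subtype _)

theorem SES.stdSyzygy (M : ModuleCat.{u} A) (n : ℕ) :
    SES (stdSyzygyι M n).hom (stdSyzygyπ M n).hom :=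
  SES.of_surjective (Finsupp.linearCombination_surjective A Function.surjective_id)

theorem projective_finsupp (X : Type u) : Projective (ModuleCat.of A (X →₀ A)) :=
  (IsProjective.iff_projective (R := A) _).mp inferInstance

theorem torIndependent_iff_stdSyzygy (M N : ModuleCat.{u} A) :
    TorIndependent M N ↔ ∀ n, Function.Injective ((stdSyzygyι M n).hom.rTensor N) :=
  torIndependent_iff (SemidualizingPresentation.stdSyzygy A M) _ (stdSyzygyι M) (stdSyzygyπ M) (SES.stdSyzygy M)
    (fun _ => projective_finsupp _) N

theorem TorIndependent.rTensor_injective (hT : TorIndependent (ModuleCat.of A M) (ModuleCat.of A N))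
    {f : K →ₗ[A] F} {g : F →ₗ[A] M} (h : SES f g) [Module.Projective A F] :
    Function.Injective (f.rTensor N) :=
  (SES.stdSyzygy (ModuleCat.of A M) 0).rTensor_injective_of_cover (f' := f) (g' := g) h
    ((torIndependent_iff_stdSyzygy _ _).mp hT 0)

end Cover

/-! ### Tor-independence of syzygies, and intersections of ideals -/

section TorCover

variable {A : Type u} [CommRing A]
variable {M K F N : Type u} [AddCommGroup M] [AddCommGroup K] [AddCommGroup F]
  [AddCommGroup N] [Module A M] [Module A K] [Module A F] [Module A N]

/-- Prepend an object to a sequence. -/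
def consObj (M : ModuleCat.{u} A) (X : ℕ → ModuleCat.{u} A) : ℕ → ModuleCat.{u} A
  | 0 => M
  | n + 1 => X n

/-- Prepend an inclusion to a sequence of inclusions of syzygies. -/
def consι {M F : ModuleCat.{u} A} {X Y : ℕ → ModuleCat.{u} A} (f : X 0 ⟶ F)
    (ι : ∀ n, X (n + 1) ⟶ Y n) : ∀ n, consObj M X (n + 1) ⟶ consObj F Y n
  | 0 => f
  | n + 1 => ι n

/-- Prepend a projection to a sequence of projections onto syzygies. -/
def consπ {M F : ModuleCat.{u} A} {X Y : ℕ → ModuleCat.{u} A} (g : F ⟶ M)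
    (π : ∀ n, Y n ⟶ X n) : ∀ n, consObj F Y n ⟶ consObj M X n
  | 0 => g
  | n + 1 => π n

/-- Tor-independence of the syzygies. -/
theorem TorIndependent.syzygy (hT : TorIndependent (ModuleCat.of A M) (ModuleCat.of A N))
    {f : K →ₗ[A] F} {g : F →ₗ[A] M} (h : SES f g) [Module.Projective A F] :
    TorIndependent (ModuleCat.of A K) (ModuleCat.of A N) := by
  have h1 := (torIndependent_iff (consObj (ModuleCat.of A M) (stdSyzygy A (ModuleCat.of A K))) _
    (consι (X := stdSyzygy A (ModuleCat.of A K)) (ModuleCat.ofHom f) (stdSyzygyι (ModuleCat.of A K)))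
    (consπ (ModuleCat.ofHom g) (stdSyzygyπ (ModuleCat.of A K)))
    (fun n => by
      cases n with
      | zero => exact h
      | succ n => exact SES.stdSyzygy _ n)
    (fun n => by
      cases n with
      | zero => exact (IsProjective.iff_projective (R := A) F).mp inferInstance
      | succ n => exact projective_finsupp _) (ModuleCat.of A N)).mp hT
  exact (torIndependent_iff_stdSyzygy _ _).mpr fun n => h1 (n + 1)

theorem TorIndependent.congr {M' : Type u} [AddCommGroup M'] [Module A M'] {N : ModuleCat.{u} A}
    (hT : TorIndependent (ModuleCat.of A M) N)
    (e : M ≃ₗ[A] M') : TorIndependent (ModuleCat.of A M') N :=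
  fun i hi => (hT i hi).of_iso (((Tor' (ModuleCat.{u} A) i).mapIso e.toModuleIso).symm.app N)

/-- For `x` in `I ∩ J`, the tensor `x ⊗ 1` in `I ⊗ A/J` dies in `A ⊗ A/J`. By injectivity it is
already zero in `I ⊗ A/J ≅ I/JI`. -/
theorem TorIndependent.inf_eq_mul {I J : Ideal A}
    (h : TorIndependent (ModuleCat.of A (A ⧸ I)) (ModuleCat.of A (A ⧸ J))) : I ⊓ J = I * J := by
  refine le_antisymm (fun x hx => ?_) Ideal.mul_le_inf
  have hs : SES (Submodule.subtype I) (Submodule.mkQ I) :=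
    ⟨Subtype.val_injective, LinearMap.exact_subtype_mkQ I, Submodule.mkQ_surjective I⟩
  have hinj := h.rTensor_injective hs
  have hx' : x ⊗ₜ[A] (1 : A ⧸ J) = 0 := by
    rw [← mul_one x, ← smul_eq_mul, TensorProduct.smul_tmul, Algebra.smul_def, mul_one,
      Ideal.Quotient.algebraMap_eq, Ideal.Quotient.eq_zero_iff_mem.mpr hx.2, TensorProduct.tmul_zero]
  obtain ⟨x, rfl⟩ : ∃ y : I, (y : A) = x := ⟨⟨x, hx.1⟩, rfl⟩
  have h0 : x ⊗ₜ[A] (1 : A ⧸ J) = 0 := by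
    apply hinj
    rw [map_zero]
    exact hx'
  have h1 := congrArg (TensorProduct.tensorQuotEquivQuotSMul I J) h0
  have h2 : Submodule.Quotient.mk (p := J • (⊤ : Submodule A I)) x = 0 := by
    rw [← map_one (Ideal.Quotient.mk J), TensorProduct.tensorQuotEquivQuotSMul_tmul_mk, one_smul,
      map_zero] at h1
    exact h1
  rw [Submodule.Quotient.mk_eq_zero] at h2
  have h3 : (x : A) ∈ (J • (⊤ : Submodule A I)).map (Submodule.subtype I) := ⟨_, h2, rfl⟩
  rw [Submodule.map_smul'', Submodule.map_top, Submodule.range_subtype, smul_eq_mul] at h3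
  rwa [mul_comm] at h3

end TorCover

/-! ### Cokernels in a complex -/

section Coker

variable {Q : Type u} [CommRing Q] (K : ChainComplex (ModuleCat.{u} Q) ℤ)

/-- The cokernel of the differential into degree `i`. -/
abbrev Coker (i : ℤ) : Type u := K.X i ⧸ LinearMap.range (K.d (i + 1) i).hom

theorem range_le_ker (i : ℤ) :
    LinearMap.range (K.d (i + 1 + 1) (i + 1)).hom ≤ LinearMap.ker (K.d (i + 1) i).hom := by
  rintro _ ⟨y, rfl⟩
  exact LinearMap.congr_fun (congrArg ModuleCat.Hom.hom (K.d_comp_d (i + 1 + 1) (i + 1) i)) y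

/-- The map from the cokernel in degree `i + 1` induced by the differential. -/
def cokerMap (i : ℤ) : Coker K (i + 1) →ₗ[Q] K.X i :=
  Submodule.liftQ _ _ (range_le_ker K i)

variable {K}

theorem cokerMap_comp_mkQ (i : ℤ) :
    cokerMap K i ∘ₗ Submodule.mkQ _ = (K.d (i + 1) i).hom :=
  Submodule.liftQ_mkQ ..

theorem range_cokerMap (i : ℤ) : LinearMap.range (cokerMap K i) = LinearMap.range (K.d (i + 1) i).hom :=
  Submodule.range_liftQ ..

theorem SES.coker {i : ℤ}
    (h : Function.Exact (K.d (i + 1 + 1) (i + 1)).hom (K.d (i + 1) i).hom) :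
    SES (cokerMap K i) (Submodule.mkQ (LinearMap.range (K.d (i + 1) i).hom)) := by
  refine ⟨?_, ?_, Submodule.mkQ_surjective _⟩
  · rw [← LinearMap.ker_eq_bot]
    refine Submodule.ker_liftQ_eq_bot _ _ _ ?_
    rw [h.linearMap_ker_eq]
  · rw [LinearMap.exact_iff, Submodule.ker_mkQ, range_cokerMap]

variable {N : Type u} [AddCommGroup N] [Module Q N]

theorem rTensor_cokerMap_injective {i : ℤ}
    (h : Function.Exact ((K.d (i + 1 + 1) (i + 1)).hom.rTensor N) ((K.d (i + 1) i).hom.rTensor N)) :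
    Function.Injective ((cokerMap K i).rTensor N) := by
  rw [← cokerMap_comp_mkQ i, LinearMap.rTensor_comp] at h
  refine (exact_comp_iff_injective (p := LinearMap.id)
    (rTensor_exact N (LinearMap.exact_map_mkQ_range _) (Submodule.mkQ_surjective _))
    Function.surjective_id (LinearMap.rTensor_surjective N (Submodule.mkQ_surjective _))).mp ?_
  exact h

/-- Exactness of `Hom(K, N)` in the form of an extension property, ready to be read as `Ext¹`
vanishing. -/
theorem exists_extend_cokerMap {i : ℤ} (h : Function.Exact
      (LinearMap.lcomp Q N (K.d (i + 1) i).hom) (LinearMap.lcomp Q N (K.d (i + 1 + 1) (i + 1)).hom))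
    (φ : Coker K (i + 1) →ₗ[Q] N) : ∃ ψ : K.X i →ₗ[Q] N, ψ ∘ₗ cokerMap K i = φ := by
  obtain ⟨ψ, hψ⟩ := (h (φ ∘ₗ Submodule.mkQ _)).mp (by
    ext y
    change φ (Submodule.mkQ _ ((K.d (i + 1 + 1) (i + 1)).hom y)) = 0
    rw [Submodule.mkQ_apply, 
      (Submodule.Quotient.mk_eq_zero _).mpr (LinearMap.mem_range_self _ y), map_zero])
  refine ⟨ψ, ?_⟩
  refine Submodule.linearMap_qext _ ?_
  rw [← hψ, LinearMap.comp_assoc, cokerMap_comp_mkQ]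
  rfl

theorem tensorComplex_exactAt_iff (N : ModuleCat.{u} Q) (i : ℤ) :
    (tensorComplex K N).ExactAt (i + 1) ↔
      Function.Exact ((K.d (i + 1 + 1) (i + 1)).hom.rTensor N) ((K.d (i + 1) i).hom.rTensor N) :=
  exactAt_int_iff _ i

theorem homComplex_exactAt_iff (N : ModuleCat.{u} Q) (i : ℤ) :
    (homComplex K N).ExactAt (i + 1) ↔ Function.Exact (LinearMap.lcomp Q N (K.d (i + 1) i).hom)
      (LinearMap.lcomp Q N (K.d (i + 1 + 1) (i + 1)).hom) :=
  exactAt_iff_function_exact _ i (i + 1) (i + 1 + 1) (by simp) (by simp)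

end Coker

/-! ### Cokernels in a Tate resolution after base change -/

section Tate

variable {Q : Type u} [CommRing Q] {S : Type u} [CommRing S] [Algebra Q S] [IsNoetherianRing S]

theorem lTensor_injective_of_rTensor {M N P : Type u} [AddCommGroup M] [AddCommGroup N]
    [AddCommGroup P] [Module Q M] [Module Q N] [Module Q P] {f : M →ₗ[Q] N}
    (h : Function.Injective (f.rTensor P)) : Function.Injective (f.lTensor P) :=
  (LinearMap.lTensor_inj_iff_rTensor_inj P f).mpr h

/-- The cokernels in a complex of free modules that stays exact under `- ⊗ S` and `Hom(-, S)`
are totally reflexive after base change to `S`. -/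
theorem TR.baseChange_coker {T : ChainComplex (ModuleCat.{u} Q) ℤ}
    (hfin : ∀ i, Module.Finite Q (T.X i)) (hfree : ∀ i, Module.Free Q (T.X i)) (hT : T.Acyclic)
    (hTor : (tensorComplex T (ModuleCat.of Q S)).Acyclic)
    (hExt : (homComplex T (ModuleCat.of Q S)).Acyclic) (i : ℤ) :
    TR S (S ⊗[Q] Coker T i) := by
  have h2 : ∀ i, Function.Injective ((cokerMap T i).rTensor S) := fun i =>
    rTensor_cokerMap_injective
      ((tensorComplex_exactAt_iff (K := T) (ModuleCat.of Q S) i).mp (hTor (i + 1)))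
  have hs : ∀ i, SES ((cokerMap T i).baseChange S)
      ((Submodule.mkQ (LinearMap.range (T.d (i + 1) i).hom)).baseChange S) := fun i =>
    (SES.coker ((exactAt_int_iff T i).mp (hT (i + 1)))).lTensor
      (lTensor_injective_of_rTensor (h2 i))
  have h1 : ∀ i, ExtV S (S ⊗[Q] Coker T i) S 1 := fun i => by
    have := hfree i
    refine (hs i).extV_one_of_extend extV_of_projective fun φ => ?_
    obtain ⟨ψ, hψ⟩ := exists_extend_cokerMap 
      ((homComplex_exactAt_iff (K := T) (ModuleCat.of Q S) i).mp (hExt (i + 1)))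
      ((LinearMap.liftBaseChangeEquiv S).symm φ)
    refine ⟨LinearMap.liftBaseChange S ψ, ?_⟩
    apply (LinearMap.liftBaseChangeEquiv S).symm.injective
    rw [← hψ]
    ext k
    simp
  refine TR.of_class (fun M _ _ => ∃ i, Nonempty (M ≃ₗ[S] S ⊗[Q] Coker T i)) ?_ ?_ _
    ⟨i, ⟨LinearEquiv.refl _ _⟩⟩
  · rintro M _ _ ⟨i, ⟨e⟩⟩ n hn
    obtain ⟨n, rfl⟩ := Nat.exists_eq_add_of_le' hn
    refine ExtV.congr_left e.symm ?_
    clear e hn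
    induction n generalizing i with
    | zero => exact h1 i
    | succ n ih =>
      have := hfree i
      exact (hs i).extV_right (ih (i + 1)) extV_of_projective
  · rintro M _ _ ⟨i, ⟨e⟩⟩
    -- The cokernel in degree `j + 1` embeds in the free term of degree `j` with cokernel of the
    -- same kind; being doubly infinite, the complex never runs out.
    obtain ⟨i, rfl⟩ : ∃ j, i = j + 1 := ⟨i - 1, by omega⟩
    have := hfree i
    have := hfin i
    exact ⟨_, _, _, _, _, _, _, _, TR.of_projective, (hs i).congr_left e,
      i, ⟨LinearEquiv.refl _ _⟩⟩

/-- The isomorphism between the cokernels in two complexes that are isomorphic in two degrees. -/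
theorem nonempty_coker_equiv {T P : ChainComplex (ModuleCat.{u} Q) ℤ} (α : T ⟶ P) (i : ℤ)
    (h : IsIso (α.f i)) (h' : IsIso (α.f (i + 1))) : Nonempty (Coker T i ≃ₗ[Q] Coker P i) := by
  refine ⟨Submodule.Quotient.equiv _ _ (asIso (α.f i)).toLinearEquiv ?_⟩
  have hc : (α.f i).hom ∘ₗ (T.d (i + 1) i).hom = (P.d (i + 1) i).hom ∘ₗ (α.f (i + 1)).hom :=
    congrArg ModuleCat.Hom.hom (α.comm (i + 1) i).symm
  have hr : LinearMap.range (α.f (i + 1)).hom = ⊤ :=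
    LinearMap.range_eq_top.mpr (asIso (α.f (i + 1))).toLinearEquiv.surjective
  change Submodule.map (α.f i).hom _ = _
  rw [← LinearMap.range_comp, hc, LinearMap.range_comp, hr, Submodule.map_top]

variable {M : Type u} [AddCommGroup M] [Module Q M]

theorem TateResolution.nonempty_coker_equiv (F : TateResolution (ModuleCat.of Q M)) :
    Nonempty (Coker F.P 0 ≃ₗ[Q] M) := by
  obtain ⟨-, h1, h2⟩ := (quasiIso_single_iff F.P _ F.isZero_P F.β).mp F.quasiIso_β
  let e := (HomologicalComplex.singleObjXSelf (ComplexShape.down ℤ) 0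
    (ModuleCat.of Q M)).toLinearEquiv
  have h3 : LinearMap.range (F.P.d (0 + 1) 0).hom = LinearMap.ker (F.β.f 0).hom :=
    h1.linearMap_ker_eq.symm
  exact ⟨(Submodule.quotEquivOfEq _ _ h3).trans (((F.β.f 0).hom.quotKerEquivOfSurjective h2).trans e)⟩

theorem TateResolution.ses_coker (F : TateResolution (ModuleCat.of Q M)) (i : ℤ) (hi : 0 ≤ i) :
    SES (cokerMap F.P i) (Submodule.mkQ (LinearMap.range (F.P.d (i + 1) i).hom)) := by
  obtain ⟨n, rfl⟩ := Int.eq_ofNat_of_zero_le hi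
  exact SES.coker (((quasiIso_single_iff F.P _ F.isZero_P F.β).mp F.quasiIso_β).1 n)

end Tate

/-! ### From a presentation to a semidualizing module -/

section Backward

variable {Q : Type u} [CommRing Q] {S : Type u} [CommRing S] [Algebra Q S]
variable {M : Type u} [AddCommGroup M] [Module Q M]

theorem TateResolution.torIndependent_coker (F : TateResolution (ModuleCat.of Q M))
    (hT : TorIndependent (ModuleCat.of Q M) (ModuleCat.of Q S)) (i : ℤ) (hi : 0 ≤ i) :
    TorIndependent (ModuleCat.of Q (Coker F.P i)) (ModuleCat.of Q S) := by
  induction i, hi using Int.leInduction with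
  | base =>
    obtain ⟨e⟩ := F.nonempty_coker_equiv
    exact hT.congr e.symm
  | succ i hi ih =>
    have := F.free_P i
    exact ih.syzygy (F.ses_coker i hi)

/-- In high degrees `P` agrees with `T`, whose cokernels become totally reflexive over `S`.
Tor-independence keeps the finitely many remaining short exact sequences of `P` exact over `S`. -/
theorem GdimLE.of_tateVanishing [IsNoetherianRing S]
    (h : TateVanishing (ModuleCat.of Q M) (ModuleCat.of Q S))
    (hT : TorIndependent (ModuleCat.of Q M) (ModuleCat.of Q S)) :
    ∃ n, GdimLE S n (S ⊗[Q] M) := by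
  obtain ⟨F, hF⟩ := h
  obtain ⟨e⟩ := F.nonempty_coker_equiv
  obtain ⟨n₀, hn₀⟩ := F.isIso_α
  have hTor : (tensorComplex F.T (ModuleCat.of Q S)).Acyclic := fun i =>
    (HomologicalComplex.exactAt_iff_isZero_homology ..).mpr (hF i).1
  have hExt : (homComplex F.T (ModuleCat.of Q S)).Acyclic := fun i =>
    (HomologicalComplex.exactAt_iff_isZero_homology ..).mpr (hF i).2
  have hTR := TR.baseChange_coker F.totallyAcyclic.finite F.totallyAcyclic.free
    F.totallyAcyclic.acyclic hTor hExt
  have key : ∀ (k : ℕ) (i : ℤ), 0 ≤ i → n₀ ≤ i + k → GdimLE S k (S ⊗[Q] Coker F.P i) := by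
    intro k
    induction k with
    | zero =>
      intro i hi hk
      obtain ⟨e⟩ := SemidualizingPresentation.nonempty_coker_equiv F.α i (hn₀ i (by omega))
        (hn₀ (i + 1) (by omega))
      exact TR.congr (hTR i) (e.baseChange Q S _ _)
    | succ k ih =>
      intro i hi hk
      have := F.free_P i
      have := F.finite_P i
      have hs := F.ses_coker i hi
      have hinj := (F.torIndependent_coker hT i hi).rTensor_injective hs
      exact ⟨_, _, _, _, _, _, _, _, inferInstance, inferInstance,
        hs.lTensor (lTensor_injective_of_rTensor hinj), ih (i + 1) (by omega) (by push_cast at hk; omega)⟩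
  exact ⟨n₀.toNat, (key n₀.toNat 0 le_rfl (by omega)).congr (e.baseChange Q S _ _)⟩

theorem TorIndependent.extV_baseChange_iff
    (hT : TorIndependent (ModuleCat.of Q M) (ModuleCat.of Q S)) (i : ℕ) :
    ExtV S (S ⊗[Q] M) S i ↔ ExtV Q M S i := by
  cases i with
  | zero =>
    rw [extV_zero_iff, extV_zero_iff]
    exact (LinearMap.liftBaseChangeEquiv S).symm.toEquiv.subsingleton_congr
  | succ i =>
    let 𝒢 : ∀ (M : Type u) [AddCommGroup M] [Module Q M], Prop :=
      fun M _ _ => TorIndependent (ModuleCat.of Q M) (ModuleCat.of Q S)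
    refine SemidualizingPresentation.extV_baseChange_iff 𝒢 (fun M _ _ hM => ?_) hT i
    have hs := SES.of_surjective
      (Finsupp.linearCombination_surjective Q (Function.surjective_id (α := M)))
    have h1 := TorIndependent.syzygy (N := S) hM hs
    have h2 := TorIndependent.rTensor_injective (N := S) hM hs
    exact ⟨_, _, _, _, _, _, _, _, inferInstance, hs, h1,
      (LinearMap.lTensor_inj_iff_rTensor_inj _ _).mpr h2⟩

/-- The isomorphism `R ≅ Hom(C, C)` forces the square of the rank to be one. -/
theorem nonempty_linearEquiv_of_free {R : Type u} [CommRing R] [IsLocalRing R] {C : Type u}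
    [AddCommGroup C] [Module R C] (hC : IsSemidualizing (ModuleCat.of R C)) (hf : Module.Free R C) :
    Nonempty (C ≃ₗ[R] R) := by
  have : Module.Finite R C := hC.finite
  have e : R ≃ₗ[R] (C →ₗ[R] C) := LinearEquiv.ofBijective _ hC.homothety_bijective
  have h1 := e.finrank_eq
  rw [Module.finrank_self, Module.finrank_linearMap] at h1
  have h2 : Module.finrank R C = Module.finrank R R := by
    rw [Module.finrank_self]
    exact Nat.eq_one_of_mul_eq_one_right h1.symm
  exact ⟨LinearEquiv.ofFinrankEq C R h2⟩

theorem nonempty_quotient_tensor_equiv {I J : Ideal Q} {R : Type u} [CommRing R] [Algebra (Q ⧸ J) R]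
    (hSR : Function.Surjective (algebraMap (Q ⧸ J) R))
    (hI : ∀ s : Q ⧸ J, algebraMap (Q ⧸ J) R s = 0 ↔ ∃ q ∈ I, algebraMap Q (Q ⧸ J) q = s) :
    Nonempty (((Q ⧸ J) ⊗[Q] (Q ⧸ I)) ≃ₗ[Q ⧸ J] R) := by
  let := Algebra.compHom R (algebraMap Q (Q ⧸ J))
  have : IsScalarTower Q (Q ⧸ J) R := .of_algebraMap_eq fun _ => rfl
  have hle : I ≤ LinearMap.ker (Algebra.linearMap Q R) := fun q hq => (hI _).mpr ⟨q, hq, rfl⟩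
  let ψ := LinearMap.liftBaseChange (Q ⧸ J) (Submodule.liftQ I (Algebra.linearMap Q R) hle)
  have h1 : ∀ s : Q ⧸ J, ψ (s ⊗ₜ 1) = algebraMap (Q ⧸ J) R s := fun s => by
    have : Submodule.liftQ I (Algebra.linearMap Q R) hle (1 : Q ⧸ I) = 1 :=
      (Submodule.liftQ_apply ..).trans (map_one (algebraMap Q R))
    rw [LinearMap.liftBaseChange_tmul, this, Algebra.algebraMap_eq_smul_one]
  have h2 : ∀ t : (Q ⧸ J) ⊗[Q] (Q ⧸ I), ∃ s : Q ⧸ J, s ⊗ₜ 1 = t := fun t => by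
    induction t with
    | zero => exact ⟨0, TensorProduct.zero_tmul _ _⟩
    | tmul s y =>
      obtain ⟨q, rfl⟩ := Ideal.Quotient.mk_surjective y
      refine ⟨q • s, ?_⟩
      rw [TensorProduct.smul_tmul, Algebra.smul_def, mul_one]
      rfl
    | add x y hx hy =>
      obtain ⟨s, rfl⟩ := hx
      obtain ⟨s', rfl⟩ := hy
      exact ⟨s + s', TensorProduct.add_tmul _ _ _⟩
  refine ⟨LinearEquiv.ofBijective ψ ⟨?_, fun r => ?_⟩⟩
  · rw [injective_iff_map_eq_zero]
    intro t ht
    obtain ⟨s, rfl⟩ := h2 t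
    rw [h1] at ht
    obtain ⟨q, hq, rfl⟩ := (hI s).mp ht
    rw [Algebra.algebraMap_eq_smul_one, TensorProduct.smul_tmul, Algebra.smul_def, mul_one,
      Ideal.Quotient.algebraMap_eq, Ideal.Quotient.eq_zero_iff_mem.mpr hq, TensorProduct.tmul_zero]
  · obtain ⟨s, rfl⟩ := hSR r
    exact ⟨s ⊗ₜ 1, h1 s⟩

theorem exists_algebra_of_ringEquiv {I J : Ideal Q} {R : Type u} [CommRing R]
    (e : R ≃+* Q ⧸ (I ⊔ J)) : ∃ _ : Algebra (Q ⧸ J) R,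
      Function.Surjective (algebraMap (Q ⧸ J) R) ∧
      ∀ s : Q ⧸ J, algebraMap (Q ⧸ J) R s = 0 ↔ ∃ q ∈ I, algebraMap Q (Q ⧸ J) q = s := by
  refine ⟨(e.symm.toRingHom.comp (Ideal.Quotient.factor le_sup_right)).toAlgebra,
    e.symm.surjective.comp (Ideal.Quotient.factor_surjective _), fun s => ?_⟩
  obtain ⟨q, rfl⟩ := Ideal.Quotient.mk_surjective s
  change e.symm (Ideal.Quotient.factor le_sup_right (Ideal.Quotient.mk J q)) = 0 ↔ _
  rw [map_eq_zero_iff _ e.symm.injective, Ideal.Quotient.factor_mk, Ideal.Quotient.eq_zero_iff_mem]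
  constructor
  · intro hq
    obtain ⟨a, ha, b, hb, rfl⟩ := Submodule.mem_sup.mp hq
    refine ⟨a, ha, ?_⟩
    rw [map_add, Ideal.Quotient.eq_zero_iff_mem.mpr hb, add_zero]
    rfl
  · rintro ⟨a, ha, hq⟩
    have h1 : a - q ∈ J := Ideal.Quotient.eq.mp hq
    rw [← sub_sub_cancel a q]
    exact Submodule.sub_mem_sup ha h1

theorem exists_semidualizing_of_isIndependentPresentation {R : Type u} [CommRing R]
    (hR : IsCohenMacaulayLocal R) {I₁ I₂ : Ideal Q} (h : IsIndependentPresentation R Q I₁ I₂) :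
    ∃ C : ModuleCat.{u} R, IsSemidualizing C ∧ ¬ IsDualizing C ∧ ¬ Module.Free R C := by
  have := hR.toIsLocalRing
  have : IsNoetherianRing R := hR.toIsNoetherian
  have := h.cohenMacaulay₂.toIsLocalRing
  have : IsNoetherianRing (Q ⧸ I₂) := h.cohenMacaulay₂.toIsNoetherian
  obtain ⟨d, hd, hdep⟩ := isCohenMacaulayLocal_iff.mp hR
  obtain ⟨r, hr, -⟩ := isCohenMacaulayLocal_iff.mp h.cohenMacaulay₂
  obtain ⟨e⟩ := h.ringEquiv
  obtain ⟨_, hSR, hI⟩ := exists_algebra_of_ringEquiv e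
  obtain ⟨e'⟩ := nonempty_quotient_tensor_equiv hSR hI
  obtain ⟨n, hn⟩ := GdimLE.of_tateVanishing h.tate_eq_zero h.tor_eq_zero
  obtain ⟨C, hC, h1, h2⟩ := exists_semidualizing_of_gdimLE I₁ hd hdep r (Q ⧸ I₂)
    Ideal.Quotient.mk_surjective hSR hI (fun H => by
      have := H.le_ringKrullDim
      rw [hr] at this
      have : r + 1 ≤ r := by exact_mod_cast this
      omega) (hn.congr e')
  refine ⟨C, hC, fun hD => ?_, fun hF => ?_⟩
  · exact h.not_gorenstein₂ ⟨inferInstance, inferInstance, h1 hD.finite_injDim⟩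
  · obtain ⟨g, hg, hp⟩ := h2 (nonempty_linearEquiv_of_free hC hF)
    obtain ⟨c, hc⟩ := h.ext_not_cyclic
    apply hc
    -- In degree `g` the module is cyclic, and in every other degree it is zero, hence cyclic too.
    by_cases hcg : c = g
    · rwa [hcg]
    · have h3 : ExtV Q (Q ⧸ I₁) (Q ⧸ I₂) c :=
        (h.tor_eq_zero.extV_baseChange_iff c).mp ((hg c hcg).congr_left e'.symm)
      rw [top_isPrincipal_iff]
      exact ⟨0, fun b => ⟨0, (extV_iff.mp h3 _).trans (extV_iff.mp h3 _).symm⟩⟩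

end Backward

/-! ### Complete resolutions from doubly infinite sequences -/

section IntSequences

theorem exists_int_chain {α : Type*} {r : α → α → Prop} (h₁ : ∀ a, ∃ b, r a b)
    (h₂ : ∀ b, ∃ a, r a b) (a₀ : α) : ∃ s : ℤ → α, s 0 = a₀ ∧ ∀ i, r (s i) (s (i + 1)) := by
  choose p hp using h₁
  choose q hq using h₂
  refine ⟨fun
    | .ofNat n => p^[n] a₀
    | .negSucc n => q^[n + 1] a₀, rfl, ?_⟩
  rintro (n | n | n)
  · change r (p^[n] a₀) (p^[n + 1] a₀)
    rw [Function.iterate_succ_apply']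
    exact hp _
  · exact hq _
  · change r (q^[n + 1 + 1] a₀) (q^[n + 1] a₀)
    rw [Function.iterate_succ_apply' q (n + 1)]
    exact hq _

variable {A : Type u} [CommRing A] (M F : ℤ → ModuleCat.{u} A) (f : ∀ n, M (n + 1) ⟶ F n)
  (g : ∀ n, F n ⟶ M n) (h : ∀ n, SES (f n).hom (g n).hom)

include h in
theorem splice_comp (n : ℤ) : (g (n + 1 + 1) ≫ f (n + 1)) ≫ g (n + 1) ≫ f n = 0 := by
  have : f (n + 1) ≫ g (n + 1) = 0 := by
    ext1
    exact (h (n + 1)).exact.linearMap_comp_eq_zero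
  simp [reassoc_of% this]

/-- The complex obtained by splicing a doubly infinite sequence of short exact sequences. -/
noncomputable def intSplice : ChainComplex (ModuleCat.{u} A) ℤ :=
  ChainComplex.of F (fun n => g (n + 1) ≫ f n) (splice_comp M F f g h)

theorem intSplice_d (n : ℤ) : (intSplice M F f g h).d (n + 1) n = g (n + 1) ≫ f n :=
  ChainComplex.of_d F (fun n => g (n + 1) ≫ f n) n

theorem intSplice_acyclic : (intSplice M F f g h).Acyclic := by
  intro i
  obtain ⟨i, rfl⟩ : ∃ j, i = j + 1 := ⟨i - 1, by ring⟩
  rw [exactAt_int_iff, intSplice_d, intSplice_d]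
  exact (exact_comp_iff_injective (h (i + 1)).exact (h (i + 1 + 1)).surj (h (i + 1)).surj).mpr
    (h i).inj

theorem tensorComplex_intSplice_acyclic (N : ModuleCat.{u} A)
    (hN : ∀ n, Function.Injective ((f n).hom.rTensor N)) :
    (tensorComplex (intSplice M F f g h) N).Acyclic := by
  intro i
  obtain ⟨i, rfl⟩ : ∃ j, i = j + 1 := ⟨i - 1, by ring⟩
  rw [exactAt_int_iff]
  have h2 : Function.Exact (((f (i + 1)).hom ∘ₗ (g (i + 1 + 1)).hom).rTensor N)
      (((f i).hom ∘ₗ (g (i + 1)).hom).rTensor N) := by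
    rw [LinearMap.rTensor_comp, LinearMap.rTensor_comp]
    exact (exact_comp_iff_injective (rTensor_exact N (h (i + 1)).exact (h (i + 1)).surj)
      (LinearMap.rTensor_surjective N (h (i + 1 + 1)).surj)
      (LinearMap.rTensor_surjective N (h (i + 1)).surj)).mpr (hN i)
  have h3 : Function.Exact (((intSplice M F f g h).d (i + 1 + 1) (i + 1)).hom.rTensor N)
      (((intSplice M F f g h).d (i + 1) i).hom.rTensor N) := by
    rw [intSplice_d, intSplice_d]
    exact h2
  exact h3

theorem homComplex_intSplice_acyclic (N : ModuleCat.{u} A)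
    (hN : ∀ n (φ : M (n + 1) →ₗ[A] N), ∃ ψ : F n →ₗ[A] N, ψ ∘ₗ (f n).hom = φ) :
    (homComplex (intSplice M F f g h) N).Acyclic := by
  intro i
  obtain ⟨i, rfl⟩ : ∃ j, i = j + 1 := ⟨i - 1, by ring⟩
  rw [exactAt_iff_function_exact _ i (i + 1) (i + 1 + 1) (by simp) (by simp)]
  have h3 : Function.Exact (LinearMap.lcomp A N ((intSplice M F f g h).d (i + 1) i).hom)
      (LinearMap.lcomp A N ((intSplice M F f g h).d (i + 1 + 1) (i + 1)).hom) := by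
    rw [intSplice_d, intSplice_d]
    intro y
    change F (i + 1) →ₗ[A] N at y
    constructor
    · intro hy
      have h1 : y ∘ₗ (f (i + 1)).hom = 0 := by
        rw [← LinearMap.cancel_right (h (i + 1 + 1)).surj]
        exact hy
      obtain ⟨z, hz⟩ : ∃ z : M (i + 1) →ₗ[A] N, z ∘ₗ (g (i + 1)).hom = y := by
        refine ⟨(LinearMap.ker (g (i + 1)).hom).liftQ y ?_ ∘ₗ
          ((g (i + 1)).hom.quotKerEquivOfSurjective (h (i + 1)).surj).symm.toLinearMap, ?_⟩
        · rw [LinearMap.exact_iff.mp (h (i + 1)).exact]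
          rintro _ ⟨x, rfl⟩
          exact LinearMap.congr_fun h1 x
        · ext x
          have : ((g (i + 1)).hom.quotKerEquivOfSurjective (h (i + 1)).surj).symm
              ((g (i + 1)).hom x) = Submodule.Quotient.mk x := by
            rw [LinearEquiv.symm_apply_eq]
            rfl
          simp [this]
      obtain ⟨w, hw⟩ := hN i z
      refine ⟨w, ?_⟩
      change w ∘ₗ (f i).hom ∘ₗ (g (i + 1)).hom = y
      rw [← LinearMap.comp_assoc, hw, hz]
    · rintro ⟨w, rfl⟩
      change w ∘ₗ (((g (i + 1 + 1) ≫ f (i + 1)) ≫ g (i + 1) ≫ f i).hom) = 0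
      rw [splice_comp M F f g h]
      exact LinearMap.comp_zero w
  exact h3

/-- The terms of the brutal truncation of a complex in nonnegative degrees. -/
def truncObj : ℤ → ModuleCat.{u} A
  | .ofNat n => F n
  | .negSucc _ => ModuleCat.of A PUnit

/-- The differential of the brutal truncation of a spliced complex. -/
def truncD : ∀ n : ℤ, truncObj F (n + 1) ⟶ truncObj F n
  | .ofNat n => g (n + 1) ≫ f n
  | .negSucc _ => 0

/-- The projection onto the brutal truncation of a complex. -/
def truncProj : ∀ n : ℤ, F n ⟶ truncObj F n
  | .ofNat n => 𝟙 (F n)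
  | .negSucc _ => 0

theorem isZero_truncObj : ∀ n : ℤ, n < 0 → Limits.IsZero (truncObj F n)
  | .negSucc _, _ => ModuleCat.isZero_of_subsingleton (ModuleCat.of A PUnit)

/-- The brutal truncation of a spliced complex. -/
noncomputable def intSpliceTrunc : ChainComplex (ModuleCat.{u} A) ℤ :=
  ChainComplex.of (truncObj F) (truncD M F f g) fun
    | .ofNat n => splice_comp M F f g h n
    | .negSucc n => by simp [truncD]

theorem intSpliceTrunc_d (n : ℕ) :
    (intSpliceTrunc M F f g h).d ((n : ℤ) + 1) n = g (n + 1) ≫ f n :=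
  ChainComplex.of_d (truncObj F) (truncD M F f g) (n : ℤ)

/-- The map from a spliced complex to its truncation. -/
noncomputable def intSpliceToTrunc : intSplice M F f g h ⟶ intSpliceTrunc M F f g h :=
  ChainComplex.ofHom (truncProj F) fun
    | .ofNat n => by
      have h1 := intSpliceTrunc_d M F f g h n
      have h2 := intSplice_d M F f g h n
      have h3 : 𝟙 (F (n + 1)) ≫ g (n + 1) ≫ f n = (g (n + 1) ≫ f n) ≫ 𝟙 (F n) := by simp
      exact (congrArg (𝟙 (F (n + 1)) ≫ ·) h1).trans (h3.trans (congrArg (· ≫ 𝟙 (F n)) h2).symm)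
    | .negSucc n => (isZero_truncObj F (.negSucc n) (Int.negSucc_lt_zero n)).eq_of_tgt _ _

/-- The augmentation of the truncation of a spliced complex. -/
noncomputable def intSpliceAug : intSpliceTrunc M F f g h ⟶
    (HomologicalComplex.single (ModuleCat.{u} A) (ComplexShape.down ℤ) 0).obj (M 0) :=
  HomologicalComplex.mkHomToSingle (g 0) (by
    intro i hi
    obtain rfl : (0 : ℤ) + 1 = i := hi
    have h0 : f 0 ≫ g 0 = 0 := by
      ext1
      exact (h 0).exact.linearMap_comp_eq_zero
    have h1 : (g (0 + 1) ≫ f 0) ≫ g 0 = 0 := by rw [Category.assoc, h0, Limits.comp_zero]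
    have h2 := intSpliceTrunc_d M F f g h 0
    exact (congrArg (· ≫ g 0) h2).trans h1)

theorem quasiIso_intSpliceAug : QuasiIso (intSpliceAug M F f g h) := by
  rw [quasiIso_single_iff _ _ (isZero_truncObj F)]
  have hf : (intSpliceAug M F f g h).f 0 =
      g 0 ≫ (HomologicalComplex.singleObjXSelf (ComplexShape.down ℤ) 0 (M 0)).inv :=
    HomologicalComplex.mkHomToSingle_f ..
  have hb : Function.Bijective (HomologicalComplex.singleObjXSelf
      (ComplexShape.down ℤ) 0 (M 0)).inv.hom :=
    ConcreteCategory.bijective_of_isIso _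
  refine ⟨fun n => ?_, ?_, ?_⟩
  · have h1 := intSpliceTrunc_d M F f g h (n + 1)
    have h2 := intSpliceTrunc_d M F f g h n
    have h3 := (exact_comp_iff_injective (h ((n : ℤ) + 1)).exact (h ((n : ℤ) + 1 + 1)).surj
      (h ((n : ℤ) + 1)).surj).mpr (h n).inj
    rw [h2]
    intro y
    rw [show (intSpliceTrunc M F f g h).d ((n : ℤ) + 1 + 1) ((n : ℤ) + 1) = _ from h1]
    exact h3 y
  · have h2 := intSpliceTrunc_d M F f g h 0
    have h3 := (exact_comp_iff_injective (h 0).exact (h (0 + 1)).surj (h 0).surj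
      (i := (HomologicalComplex.singleObjXSelf (ComplexShape.down ℤ) 0 (M 0)).inv.hom)).mpr hb.1
    rw [hf]
    intro y
    rw [show (intSpliceTrunc M F f g h).d 1 0 = _ from h2]
    exact h3 y
  · rw [hf]
    exact hb.2.comp (h 0).surj

-- The Tate resolution has the spliced complex as `T` and its truncation to nonnegative degrees as
-- `P`. The hypotheses `hA`, `hN`, `hT` say that each short exact sequence stays exact under `Hom(-,
-- A)`, `Hom(-, N)` and `- ⊗ N`.
include g h in
theorem tateVanishing_of_intSequence (hF : ∀ n, Module.Finite A (F n))
    (hF' : ∀ n, Module.Free A (F n)) (N : ModuleCat.{u} A)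
    (hA : ∀ n (φ : M (n + 1) →ₗ[A] A), ∃ ψ : F n →ₗ[A] A, ψ ∘ₗ (f n).hom = φ)
    (hN : ∀ n (φ : M (n + 1) →ₗ[A] N), ∃ ψ : F n →ₗ[A] N, ψ ∘ₗ (f n).hom = φ)
    (hT : ∀ n, Function.Injective ((f n).hom.rTensor N)) : TateVanishing (M 0) N := by
  refine ⟨{
    T := intSplice M F f g h
    P := intSpliceTrunc M F f g h
    α := intSpliceToTrunc M F f g h
    β := intSpliceAug M F f g h
    totallyAcyclic := ⟨hF, hF', intSplice_acyclic M F f g h,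
      homComplex_intSplice_acyclic M F f g h (ModuleCat.of A A) hA⟩
    isIso_α := ⟨0, fun
      | .ofNat n, _ => inferInstanceAs (IsIso (𝟙 (F n)))⟩
    finite_P := fun
      | .ofNat n => hF n
      | .negSucc n => inferInstanceAs (Module.Finite A PUnit.{u + 1})
    free_P := fun
      | .ofNat n => hF' n
      | .negSucc n => inferInstanceAs (Module.Free A PUnit.{u + 1})
    isZero_P := isZero_truncObj F
    quasiIso_β := quasiIso_intSpliceAug M F f g h }, fun i => ⟨?_, ?_⟩⟩
  · exact (HomologicalComplex.exactAt_iff_isZero_homology ..).mp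
      (tensorComplex_intSplice_acyclic M F f g h N hT i)
  · exact (HomologicalComplex.exactAt_iff_isZero_homology ..).mp
      (homComplex_intSplice_acyclic M F f g h N hN i)

include h in
theorem torIndependent_of_intSequence (hF' : ∀ n, Module.Free A (F n)) (N : ModuleCat.{u} A)
    (hT : ∀ n, Function.Injective ((f n).hom.rTensor N)) : TorIndependent (M 0) N :=
  (torIndependent_iff (fun n => M n) (fun n => F n) (fun n => f n) (fun n => g n) (fun n => h n)
    (fun n => by
      have := hF' n
      exact (IsProjective.iff_projective _).mp (Module.Projective.of_free (R := A) (P := F n))) N).mpr fun n => hT n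

end IntSequences

/-! ### Base change of complete resolutions -/

section BaseChange

variable {S Q : Type u} [CommRing S] [CommRing Q] [Algebra S Q]

theorem TateVanishing.congr {A : Type u} [CommRing A] {M M' N : ModuleCat.{u} A}
    (h : TateVanishing M N) (e : M ≅ M') : TateVanishing M' N := by
  obtain ⟨F, hF⟩ := h
  have := F.quasiIso_β
  exact ⟨{
    T := F.T
    P := F.P
    α := F.α
    β := F.β ≫ (HomologicalComplex.single (ModuleCat.{u} A) (ComplexShape.down ℤ) 0).map e.hom
    totallyAcyclic := F.totallyAcyclic
    isIso_α := F.isIso_α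
    finite_P := F.finite_P
    free_P := F.free_P
    isZero_P := F.isZero_P
    quasiIso_β := inferInstance }, hF⟩

theorem exists_baseChange_extend {M F N : Type u} [AddCommGroup M] [AddCommGroup F]
    [AddCommGroup N] [Module S M] [Module S F] [Module S N] [Module Q N] [IsScalarTower S Q N]
    {f : M →ₗ[S] F} (h : ∀ φ : M →ₗ[S] N, ∃ ψ : F →ₗ[S] N, ψ ∘ₗ f = φ)
    (φ : Q ⊗[S] M →ₗ[Q] N) : ∃ ψ : Q ⊗[S] F →ₗ[Q] N, ψ ∘ₗ f.baseChange Q = φ := by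
  obtain ⟨ψ, hψ⟩ := h (φ.restrictScalars S ∘ₗ TensorProduct.mk S Q M 1)
  refine ⟨ψ.liftBaseChange Q, ?_⟩
  ext m
  simpa using LinearMap.congr_fun hψ m

/-- Cancelling the base change identifies the map with `f ⊗_S N`, where flatness over `S` applies.
-/
theorem rTensor_baseChange_injective {M F N : Type u} [AddCommGroup M] [AddCommGroup F]
    [AddCommGroup N] [Module S M] [Module S F] [Module S N] [Module Q N] [IsScalarTower S Q N]
    [Module.Flat S N] {f : M →ₗ[S] F} (hf : Function.Injective f) :
    Function.Injective ((f.baseChange Q).rTensor N) := by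
  rw [← LinearMap.lTensor_inj_iff_rTensor_inj]
  have h1 := Module.Flat.lTensor_preserves_injective_linearMap (M := N) f hf
  have h2 : ∀ t, TensorProduct.AlgebraTensorModule.cancelBaseChange S Q Q N F
      ((f.baseChange Q).lTensor N t) =
      f.lTensor N (TensorProduct.AlgebraTensorModule.cancelBaseChange S Q Q N M t) := by
    intro t
    induction t with
    | zero => simp
    | add x y hx hy => simp only [map_add, hx, hy]
    | tmul n t =>
      induction t with
      | zero => simp
      | add x y hx hy => simp only [TensorProduct.tmul_add, map_add, hx, hy]
      | tmul q m => simp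
  refine Function.Injective.of_comp
    (f := TensorProduct.AlgebraTensorModule.cancelBaseChange S Q Q N F) ?_
  have h3 : (TensorProduct.AlgebraTensorModule.cancelBaseChange S Q Q N F) ∘
      ((f.baseChange Q).lTensor N) = (f.lTensor N) ∘
        (TensorProduct.AlgebraTensorModule.cancelBaseChange S Q Q N M) := funext h2
  rw [h3]
  exact h1.comp (LinearEquiv.injective _)

/-- If `S → Q` is a ring homomorphism compatible with totally reflexive `S`-modules, then the Tate
homology and cohomology of the base change to `Q` of a totally reflexive `S`-module with
coefficients in an `S`-flat `Q`-module vanish. -/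
theorem tateVanishing_baseChange [IsNoetherianRing S] {N R₀ M : Type u} [AddCommGroup N]
    [Module S N] [Module Q N] [IsScalarTower S Q N] [Module.Flat S N]
    [AddCommGroup R₀] [Module S R₀] [AddCommGroup M] [Module Q M]
    (h₁ : ∀ (K F X : ModuleCat.{u} S) (f : K ⟶ F) (g : F ⟶ X), SES f.hom g.hom →
      Module.Finite S F → Module.Free S F → TR S X → Function.Injective (f.hom.lTensor Q))
    (hQ : ∀ X : ModuleCat.{u} S, TR S X → ExtV S X Q 1)
    (hN : ∀ X : ModuleCat.{u} S, TR S X → ExtV S X N 1)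
    (hR : TR S R₀) (e : M ≃ₗ[Q] Q ⊗[S] R₀) :
    TateVanishing (ModuleCat.of Q M) (ModuleCat.of Q N) ∧
      TorIndependent (ModuleCat.of Q M) (ModuleCat.of Q N) := by
  let r : {X : ModuleCat.{u} S // TR S X} → {X : ModuleCat.{u} S // TR S X} → Prop := fun X Y =>
    ∃ (F : ModuleCat.{u} S) (f : Y.1 ⟶ F) (g : F ⟶ X.1), Module.Finite S F ∧ Module.Free S F ∧
      SES f.hom g.hom
  -- Syzygies of `R₀` fill the positive indices and cosyzygies the negative ones; all of them are
  -- totally reflexive.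
  obtain ⟨s, hs0, hs⟩ := exists_int_chain (r := r) (by
    rintro ⟨X, hX⟩
    have := hX.finite
    obtain ⟨n, p, hp⟩ := Module.Finite.exists_fin' S X
    have h := SES.of_surjective hp
    exact ⟨⟨ModuleCat.of S (LinearMap.ker p), hX.syzygy h⟩, ModuleCat.of S (Fin n → S),
      ModuleCat.ofHom (LinearMap.ker p).subtype, ModuleCat.ofHom p,
      inferInstanceAs (Module.Finite S (Fin n → S)), inferInstanceAs (Module.Free S (Fin n → S)),
      h⟩) (by
    rintro ⟨X, hX⟩
    obtain ⟨F, L, _, _, _, _, f, g, h1, h2, h3, h4⟩ := hX.exists_cosyzygy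
    exact ⟨⟨ModuleCat.of S L, h4⟩, ModuleCat.of S F, ModuleCat.ofHom f, ModuleCat.ofHom g,
      h1, h2, h3⟩) ⟨ModuleCat.of S R₀, hR⟩
  choose F f g hF hF' h using hs
  let M' : ℤ → ModuleCat.{u} Q := fun i => ModuleCat.of Q (Q ⊗[S] (s i).1)
  let F' : ℤ → ModuleCat.{u} Q := fun i => ModuleCat.of Q (Q ⊗[S] F i)
  let f' : ∀ i, M' (i + 1) ⟶ F' i := fun i => ModuleCat.ofHom ((f i).hom.baseChange Q)
  let g' : ∀ i, F' i ⟶ M' i := fun i => ModuleCat.ofHom ((g i).hom.baseChange Q)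
  have h' : ∀ i, SES (f' i).hom (g' i).hom := fun i =>
    (h i).lTensor (h₁ _ _ _ _ _ (h i) (hF i) (hF' i) (s i).2)
  have hfin : ∀ i, Module.Finite Q (F' i) := fun i => by
    have := hF i
    exact inferInstanceAs (Module.Finite Q (Q ⊗[S] F i))
  have hfree : ∀ i, Module.Free Q (F' i) := fun i => by
    have := hF' i
    exact inferInstanceAs (Module.Free Q (Q ⊗[S] F i))
  have hT : ∀ i, Function.Injective ((f' i).hom.rTensor (ModuleCat.of Q N)) := fun i =>
    rTensor_baseChange_injective (N := N) (h i).inj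
  have he : ∀ X : {X : ModuleCat.{u} S // TR S X}, X = ⟨ModuleCat.of S R₀, hR⟩ →
      Nonempty (Q ⊗[S] X.1 ≃ₗ[Q] M) := by
    rintro _ rfl
    exact ⟨e.symm⟩
  obtain ⟨e'⟩ : Nonempty (M' 0 ≃ₗ[Q] M) := he _ hs0
  constructor
  · refine TateVanishing.congr (tateVanishing_of_intSequence M' F' f' g' h' hfin hfree
      (ModuleCat.of Q N) (fun i φ => ?_) (fun i φ => ?_) hT) e'.toModuleIso
    · exact exists_baseChange_extend (N := Q) (fun φ => (h i).exists_extend (hQ _ (s i).2) φ) φ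
    · exact exists_baseChange_extend (N := N) (fun φ => (h i).exists_extend (hN _ (s i).2) φ) φ
  · exact (torIndependent_of_intSequence M' F' f' g' h' hfree (ModuleCat.of Q N) hT).congr e'

end BaseChange

/-! ### Tensor evaluation and duality into modules of finite injective dimension -/

section HomEval

variable {A : Type u} [CommRing A]
variable {X Y K W : Type u} [AddCommGroup X] [AddCommGroup Y] [AddCommGroup K] [AddCommGroup W]
  [Module A X] [Module A Y] [Module A K] [Module A W]

variable (A X K W) in
/-- The map `X ⊗ Hom(K, W) → Hom(Hom(X, K), W)`, `x ⊗ φ ↦ (h ↦ φ (h x))`. -/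
def homEval : X ⊗[A] (K →ₗ[A] W) →ₗ[A] (X →ₗ[A] K) →ₗ[A] W :=
  TensorProduct.lift (LinearMap.mk₂ A (fun x φ => φ ∘ₗ LinearMap.applyₗ x)
    (fun x x' φ => by ext h; simp) (fun c x φ => by ext h; simp)
    (fun x φ φ' => by ext h; simp) (fun c x φ => by ext h; simp))

theorem homEval_tmul (x : X) (φ : K →ₗ[A] W) (h : X →ₗ[A] K) :
    homEval A X K W (x ⊗ₜ φ) h = φ (h x) := rfl

theorem homEval_naturality (f : X →ₗ[A] Y) (t : X ⊗[A] (K →ₗ[A] W)) :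
    homEval A Y K W (f.rTensor _ t) = homEval A X K W t ∘ₗ LinearMap.lcomp A K f := by
  induction t with
  | zero => simp
  | add x y hx hy => simp only [map_add, hx, hy, LinearMap.add_comp]
  | tmul x φ => rfl

theorem homEval_bijective_of_free [Module.Finite A X] [Module.Free A X] :
    Function.Bijective (homEval A X K W) := by
  let b := Module.Free.chooseBasis A X
  constructor
  · have key : ∀ t : X ⊗[A] (K →ₗ[A] W),
        ∑ i, b i ⊗ₜ[A] (homEval A X K W t ∘ₗ LinearMap.smulRightₗ (b.coord i)) = t := by
      intro t
      induction t with
      | zero => simp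
      | add x y hx hy =>
        simp only [map_add, LinearMap.add_comp, TensorProduct.tmul_add, Finset.sum_add_distrib,
          hx, hy]
      | tmul x φ =>
        have h1 : ∀ i, homEval A X K W (x ⊗ₜ φ) ∘ₗ LinearMap.smulRightₗ (b.coord i) =
            b.coord i x • φ := by
          intro i
          ext k
          simp [homEval_tmul]
        simp_rw [h1, TensorProduct.tmul_smul, TensorProduct.smul_tmul', ← TensorProduct.sum_tmul]
        congr 1
        exact b.sum_repr x
    rw [injective_iff_map_eq_zero]
    intro t ht
    rw [← key t, ht]
    simp
  · intro Φ
    refine ⟨∑ i, b i ⊗ₜ[A] (Φ ∘ₗ LinearMap.smulRightₗ (b.coord i)), ?_⟩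
    ext h
    rw [map_sum, LinearMap.sum_apply]
    simp_rw [homEval_tmul, LinearMap.comp_apply]
    rw [← map_sum]
    congr 1
    refine b.ext fun j => ?_
    simp [LinearMap.sum_apply, Finsupp.single_apply]

section Duality

variable {n : ℕ} (hW : ∀ (M : Type u) [AddCommGroup M] [Module A M] (i : ℕ), n < i → ExtV A M W i)
  (hK : ∀ i, 1 ≤ i → ExtV A K W i)

theorem ExtV.hom_of_free [Module.Finite A X] [Module.Free A X] {i : ℕ} (h : ExtV A K W i) :
    ExtV A (X →ₗ[A] K) W i :=
  ExtV.congr_left (((Module.Free.chooseBasis A X).reindex (Fintype.equivFin _)).constr A) (h.pow _)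

theorem extV_of_ses_left {f : K →ₗ[A] X} {g : X →ₗ[A] Y} (h : SES f g) [Module.Projective A X]
    (hY : ∀ i, 1 ≤ i → ExtV A Y W i) (i : ℕ) (hi : 1 ≤ i) : ExtV A K W i :=
  h.extV_left (extV_of_projective' hi) (hY _ (by omega))

-- Applying `Hom(-, K)` to a syzygy sequence bounds `Extⁱ` of the dual of `X` by `Extⁱ⁺¹` of the
-- dual of its syzygy. Iterating pushes the degree beyond the injective dimension `n`.
include hW hK in
theorem extV_hom [IsNoetherianRing A] [Module.Finite A X] (hX : ∀ i, 1 ≤ i → ExtV A X K i) (i : ℕ)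
    (hi : 1 ≤ i) : ExtV A (X →ₗ[A] K) W i := by
  suffices H : ∀ m : ℕ, ∀ (X : Type u) [AddCommGroup X] [Module A X] [Module.Finite A X],
      (∀ i, 1 ≤ i → ExtV A X K i) → ∀ i, 1 ≤ i → n < i + m → ExtV A (X →ₗ[A] K) W i from
    H (n + 1) X hX i hi (by omega)
  intro m
  induction m with
  | zero => exact fun X _ _ _ hX i hi hn => hW _ _ hn
  | succ m ih =>
    intro X _ _ _ hX i hi hn
    obtain ⟨r, p, hp⟩ := Module.Finite.exists_fin' A X
    have h := SES.of_surjective hp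
    have := h.finite_left
    exact (h.hom (hX 1 le_rfl)).extV_left (ExtV.hom_of_free (hK i hi))
      (ih _ (extV_of_ses_left h hX) (i + 1) (by omega) (by omega))

include hW hK in
theorem homEval_surjective [IsNoetherianRing A] [Module.Finite A X]
    (hX : ∀ i, 1 ≤ i → ExtV A X K i) : Function.Surjective (homEval A X K W) := by
  obtain ⟨r, p, hp⟩ := Module.Finite.exists_fin' A X
  have h := SES.of_surjective hp
  have := h.finite_left
  intro Φ
  obtain ⟨Ψ, hΨ⟩ := (h.hom (hX 1 le_rfl)).exists_extend
    (extV_hom hW hK (extV_of_ses_left h hX) 1 le_rfl) Φ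
  obtain ⟨t, rfl⟩ := homEval_bijective_of_free.2 Ψ
  exact ⟨p.rTensor _ t, (homEval_naturality p t).trans hΨ⟩

-- Both sides send a free presentation of `X` to a right exact sequence, so bijectivity follows from
-- the free case.
include hW hK in
theorem homEval_bijective [IsNoetherianRing A] [Module.Finite A X]
    (hX : ∀ i, 1 ≤ i → ExtV A X K i) : Function.Bijective (homEval A X K W) := by
  refine ⟨?_, homEval_surjective hW hK hX⟩
  obtain ⟨r, p, hp⟩ := Module.Finite.exists_fin' A X
  have h := SES.of_surjective hp
  have := h.finite_left
  have hd := h.hom (N := K) (hX 1 le_rfl)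
  have hdd := hd.hom (N := W) (extV_hom hW hK (extV_of_ses_left h hX) 1 le_rfl)
  rw [injective_iff_map_eq_zero]
  intro t ht
  obtain ⟨t, rfl⟩ := LinearMap.rTensor_surjective _ hp t
  rw [homEval_naturality] at ht
  obtain ⟨Ψ, hΨ⟩ := (hdd.exact _).mp ht
  obtain ⟨s, rfl⟩ := homEval_surjective hW hK (extV_of_ses_left h hX) Ψ
  have h1 : (LinearMap.ker p).subtype.rTensor _ s = t := by
    apply homEval_bijective_of_free.1
    rw [homEval_naturality]
    exact hΨ
  rw [← h1, ← LinearMap.rTensor_comp_apply, h.exact.linearMap_comp_eq_zero]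
  simp

-- This is `Tor₁(X, Hom(K, W)) = 0`: tensor evaluation turns the map into a double Hom, under which
-- the sequence stays exact.
include hW hK in
theorem rTensor_hom_injective [IsNoetherianRing A] {Z F : Type u} [AddCommGroup Z] [AddCommGroup F]
    [Module A Z] [Module A F] [Module.Finite A F] [Module.Free A F] {f : Z →ₗ[A] F}
    {g : F →ₗ[A] X} (h : SES f g) (hX : ∀ i, 1 ≤ i → ExtV A X K i) :
    Function.Injective (f.rTensor (K →ₗ[A] W)) := by
  have := h.finite_left
  have hZ := extV_of_ses_left h hX
  have hdd := (h.hom (N := K) (hX 1 le_rfl)).hom (N := W) (extV_hom hW hK hZ 1 le_rfl)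
  have h1 : homEval A F K W ∘ f.rTensor (K →ₗ[A] W) =
      LinearMap.lcomp A W (LinearMap.lcomp A K f) ∘ homEval A Z K W :=
    funext (homEval_naturality f)
  refine Function.Injective.of_comp (f := homEval A F K W) ?_
  rw [h1]
  exact hdd.inj.comp (homEval_bijective hW hK hZ).1

end Duality

section Biduality

variable [IsNoetherianRing A] {n : ℕ}
  (hW : ∀ (M : Type u) [AddCommGroup M] [Module A M] (i : ℕ), n < i → ExtV A M W i)
  (hWW : ∀ i, 1 ≤ i → ExtV A W W i) (hA : Function.Bijective (LinearMap.lsmul A W))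
  [Module.Finite A X] (hX : ∀ i, 1 ≤ i → ExtV A X W i)
include hW hWW hA hX

/-- The case `K = W` of tensor evaluation, since `Hom(W, W)` is the ring. -/
theorem bidual_bijective :
    Function.Bijective (fun x : X => (LinearMap.applyₗ x : (X →ₗ[A] W) →ₗ[A] W)) := by
  have h1 := homEval_bijective hW hWW hX
  let e : X ≃ₗ[A] X ⊗[A] (W →ₗ[A] W) := (TensorProduct.rid A X).symm ≪≫ₗ
    TensorProduct.congr (LinearEquiv.refl A X) (LinearEquiv.ofBijective _ hA)
  have h2 : (fun x : X => (LinearMap.applyₗ x : (X →ₗ[A] W) →ₗ[A] W)) = homEval A X W W ∘ e := by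
    ext x h
    simp [e, homEval_tmul]
  rw [h2]
  exact h1.comp e.bijective

theorem eq_zero_of_forall_hom {x : X} (hx : ∀ η : X →ₗ[A] W, η x = 0) : x = 0 :=
  (bidual_bijective hW hWW hA hX).1 (LinearMap.ext fun η => by simpa using hx η)

theorem exists_lcomp_eq {Z : Type u} [AddCommGroup Z] [Module A Z]
    (ψ : (X →ₗ[A] W) →ₗ[A] (Z →ₗ[A] W)) : ∃ φ : Z →ₗ[A] X, LinearMap.lcomp A W φ = ψ := by
  let e : X ≃ₗ[A] ((X →ₗ[A] W) →ₗ[A] W) := LinearEquiv.ofBijective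
    (LinearMap.applyₗ : X →ₗ[A] (X →ₗ[A] W) →ₗ[A] W) (bidual_bijective hW hWW hA hX)
  refine ⟨e.symm.toLinearMap ∘ₗ ψ.flip, ?_⟩
  ext η z
  have h1 : ∀ Φ : (X →ₗ[A] W) →ₗ[A] W, η (e.symm Φ) = Φ η := by
    intro Φ
    obtain ⟨x, rfl⟩ := e.surjective Φ
    rw [e.symm_apply_apply]
    rfl
  simp [h1]

/-- Duality into `W` reverses Ext. In degree one, biduality makes every map from the dual of `X` to
the dual of a syzygy of `Z` a transpose, so lifting it amounts to extending a map into `X`. -/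
theorem extV_hom_hom {i : ℕ} (hi : 1 ≤ i) {Z : Type u} [AddCommGroup Z] [Module A Z]
    [Module.Finite A Z] (hZ : ∀ i, 1 ≤ i → ExtV A Z W i) (h : ExtV A Z X i) :
    ExtV A (X →ₗ[A] W) (Z →ₗ[A] W) i := by
  induction i, hi using Nat.le_induction generalizing Z with
  | base =>
    obtain ⟨r, p, hp⟩ := Module.Finite.exists_fin' A Z
    have hs := SES.of_surjective hp
    refine (hs.hom (hZ 1 le_rfl)).extV_one_of_lift
      (ExtV.congr_right ((Pi.basisFun A (Fin r)).constr A)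
        ((extV_hom hW hWW hX 1 le_rfl).pow' _)) fun ψ => ?_
    obtain ⟨φ, rfl⟩ := exists_lcomp_eq hW hWW hA hX ψ
    obtain ⟨φ', rfl⟩ := hs.exists_extend h φ
    exact ⟨LinearMap.lcomp A W φ', rfl⟩
  | succ i hi ih =>
    obtain ⟨r, p, hp⟩ := Module.Finite.exists_fin' A Z
    have hs := SES.of_surjective hp
    have := hs.finite_left
    refine (hs.hom (hZ 1 le_rfl)).extV_left' (ih (extV_of_ses_left hs hZ)
      (hs.extV_left (extV_of_projective' hi) h)) (ExtV.congr_right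
        ((Pi.basisFun A (Fin r)).constr A) ((extV_hom hW hWW hX _ (by omega)).pow' _))

theorem isSemidualizing_hom [Module.Finite A W] (h : IsSemidualizing (ModuleCat.of A X)) :
    IsSemidualizing (ModuleCat.of A (X →ₗ[A] W)) where
  finite := inferInstanceAs (Module.Finite A (X →ₗ[A] W))
  homothety_bijective := by
    constructor
    · rw [injective_iff_map_eq_zero]
      intro a ha
      refine (injective_iff_map_eq_zero _).mp h.homothety_bijective.1 a (LinearMap.ext fun x => ?_)
      refine eq_zero_of_forall_hom hW hWW hA hX fun η => ?_
      exact (η.map_smul a x).trans (LinearMap.congr_fun (LinearMap.congr_fun ha η) x)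
    · intro ψ
      obtain ⟨φ, hφ⟩ := exists_lcomp_eq hW hWW hA hX (Z := X) ψ
      obtain ⟨a, rfl⟩ := h.homothety_bijective.2 φ
      refine ⟨a, ?_⟩
      rw [← hφ]
      ext η x
      exact (η.map_smul a x).symm
  ext_eq_zero := fun i hi => extV_hom_hom hW hWW hA hX hi hX (h.ext_eq_zero i hi)

end Biduality

end HomEval

/-! ### Semidualizing modules: duals, depth and generators -/

section Semidualizing

variable {A : Type u} [CommRing A]
variable {C D X : Type u} [AddCommGroup C] [AddCommGroup D] [AddCommGroup X]
  [Module A C] [Module A D] [Module A X]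

theorem SES.compRight {X₁ X₂ X₃ : Type u} [AddCommGroup X₁] [AddCommGroup X₂] [AddCommGroup X₃]
    [Module A X₁] [Module A X₂] [Module A X₃] {f : X₁ →ₗ[A] X₂} {g : X₂ →ₗ[A] X₃} (h : SES f g)
    (h₁ : ExtV A C X₁ 1) : SES (LinearMap.compRight A (M := C) f) (LinearMap.compRight A (M := C) g) := by
  refine ⟨fun φ ψ hφ => LinearMap.ext fun c => h.inj (LinearMap.congr_fun hφ c), fun φ => ⟨?_, ?_⟩,
    fun φ => h.exists_lift h₁ φ⟩
  · intro hφ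
    have h2 : ∀ c, φ c ∈ LinearMap.range f := fun c => (h.exact _).mp (LinearMap.congr_fun hφ c)
    refine ⟨(LinearEquiv.ofInjective f h.inj).symm.toLinearMap ∘ₗ φ.codRestrict _ h2, ?_⟩
    ext c
    have := LinearEquiv.apply_symm_apply (LinearEquiv.ofInjective f h.inj)
      (φ.codRestrict _ h2 c)
    exact congrArg Subtype.val this
  · rintro ⟨ψ, rfl⟩
    ext c
    exact h.exact.apply_apply_eq_zero _

/-- Tensor evaluation gives `C ⊗ Hom(C, W) ≅ Hom(Hom(C, C), W)`, and `Hom(C, C)` is the ring. -/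
theorem IsSemidualizing.nonempty_tensor_equiv {W : Type u} [AddCommGroup W] [Module A W]
    [IsNoetherianRing A] (hC : IsSemidualizing (ModuleCat.of A C)) {n : ℕ}
    (hW : ∀ (M : Type u) [AddCommGroup M] [Module A M] (i : ℕ), n < i → ExtV A M W i)
    (hCW : ∀ i, 1 ≤ i → ExtV A C W i) : Nonempty (C ⊗[A] (C →ₗ[A] W) ≃ₗ[A] W) := by
  have : Module.Finite A C := hC.finite
  exact ⟨LinearEquiv.ofBijective _ (homEval_bijective hW hCW hC.ext_eq_zero) ≪≫ₗ
    LinearEquiv.arrowCongr (LinearEquiv.ofBijective _ hC.homothety_bijective).symm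
      (LinearEquiv.refl A W) ≪≫ₗ LinearMap.ringLmapEquivSelf A A W⟩

theorem free_of_cyclic (hC : Function.Injective (LinearMap.lsmul A C)) {c : C}
    (hc : ∀ x, ∃ a : A, a • c = x) : Module.Free A C := by
  refine Module.Free.of_equiv (LinearEquiv.ofBijective (LinearMap.toSpanSingleton A C c) ⟨?_, hc⟩)
  rw [injective_iff_map_eq_zero]
  intro a ha
  refine (injective_iff_map_eq_zero _).mp hC a (LinearMap.ext fun x => ?_)
  obtain ⟨b, rfl⟩ := hc x
  change a • b • c = 0
  rw [smul_comm]
  exact (congrArg (b • ·) ha).trans (smul_zero b)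

variable [IsLocalRing A]

open IsLocalRing in
theorem finrank_residueField_tensor (M N : Type u) [AddCommGroup M] [AddCommGroup N] [Module A M]
    [Module A N] : Module.finrank (ResidueField A) (ResidueField A ⊗[A] (M ⊗[A] N)) =
      Module.finrank (ResidueField A) (ResidueField A ⊗[A] M) *
        Module.finrank (ResidueField A) (ResidueField A ⊗[A] N) := by
  rw [← Module.finrank_tensorProduct]
  exact (TensorProduct.AlgebraTensorModule.distribBaseChange A (ResidueField A) M N).finrank_eq

open IsLocalRing in
theorem exists_span_singleton_of_finrank_eq_one {M : Type u} [AddCommGroup M] [Module A M]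
    [Module.Finite A M] (h : Module.finrank (ResidueField A) (ResidueField A ⊗[A] M) = 1) :
    ∃ m : M, ∀ x, ∃ a : A, a • m = x := by
  let b := Module.finBasisOfFinrankEq (ResidueField A) (ResidueField A ⊗[A] M) h
  have hs : Function.Surjective (TensorProduct.mk A (ResidueField A) M 1) :=
    TensorProduct.mk_surjective A M (ResidueField A) residue_surjective
  choose f hf using fun i => hs (b i)
  have := span_eq_top_of_tmul_eq_basis f b hf
  refine ⟨f 0, fun x => Submodule.mem_span_singleton.mp ?_⟩
  have h1 : Set.range f = {f 0} := by
    ext y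
    simp [eq_comm]
  rw [← h1, this]
  trivial

variable [IsNoetherianRing A]

/-- An element regular on `Hom(C, X)` is regular on `X`, and since `Ext(C, X)` vanishes, dividing by
it commutes with `Hom(C, -)`. -/
theorem DepthGE.of_hom [Module.Finite A C] (hC : Function.Injective (LinearMap.lsmul A C))
    {n : ℕ} [Module.Finite A X] (hX : ∀ i, 1 ≤ i → ExtV A C X i) (h : DepthGE A (C →ₗ[A] X) n) :
    DepthGE A X n := by
  induction n generalizing X with
  | zero => exact fun i hi => absurd hi (by omega)
  | succ n ih =>
    obtain ⟨y, hy, hreg⟩ := h.exists_isSMulRegular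
    have hyX : IsSMulRegular X y := by
      let N := LinearMap.ker (y • LinearMap.id : X →ₗ[A] X)
      have hN : Subsingleton (C →ₗ[A] N) := by
        refine subsingleton_of_forall_eq 0 fun φ => ?_
        have h1 : y • (N.subtype ∘ₗ φ) = y • 0 := by
          ext c
          have h2 : (y • LinearMap.id : X →ₗ[A] X) (φ c) = 0 := (φ c).2
          exact h2.trans (smul_zero y).symm
        ext c
        exact LinearMap.congr_fun (hreg h1) c
      -- `Hom(C, N) = 0` gives an `N`-regular element annihilating `C`. As `C` is faithful, that
      -- element is `0`, so `N = 0`.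
      obtain ⟨r, hr, hrN⟩ := IsSMulRegular.subsingleton_linearMap_iff.mp hN
      have hr0 : r = 0 := (injective_iff_map_eq_zero _).mp hC r
        (LinearMap.ext fun c => Module.mem_annihilator.mp hr c)
      rw [isSMulRegular_iff_right_eq_zero_of_smul]
      intro x hx
      have hx' : x ∈ N := by simpa [N] using hx
      have := hrN (show r • (⟨x, hx'⟩ : N) = r • 0 by simp [hr0])
      simpa using congrArg Subtype.val this
    have hs := SES.smul_of_isSMulRegular hyX
    refine DepthGE.of_quot (ih (fun i hi => hs.extV_right' (hX i hi) (hX _ (by omega))) ?_) hy hs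
    have h2 := hs.compRight (hX 1 le_rfl)
    refine DepthGE.quot (x := y) h (π := LinearMap.compRight A (M := C) (Submodule.mkQ _)) ?_
    convert h2 using 1
    ext φ c
    rfl

theorem IsSemidualizing.depthGE (hC : IsSemidualizing (ModuleCat.of A C)) {n : ℕ}
    (h : DepthGE A A n) : DepthGE A C n := by
  have := hC.finite
  exact DepthGE.of_hom (A := A) (C := C) hC.homothety_bijective.1 hC.ext_eq_zero
    (h.congr (LinearEquiv.ofBijective _ hC.homothety_bijective))

variable {n d : ℕ} (hd : DepthGE A A d) (hd' : ¬ DepthGE A A (d + 1))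
  (hC : IsSemidualizing (ModuleCat.of A C))
  (hD : IsSemidualizing (ModuleCat.of A D)) (hDn : HasInjectiveDimensionLE (ModuleCat.of A D) n)
include hd hd' hD hDn hC

theorem IsSemidualizing.extV_dualizing (i : ℕ) (hi : 1 ≤ i) : ExtV A C D i := by
  have : Module.Finite A C := hC.finite
  have : Module.Finite A D := hD.finite
  exact hd.extV_of_injDim hd' hDn (hC.depthGE hd) i hi

theorem IsSemidualizing.hom_dualizing : IsSemidualizing (ModuleCat.of A (C →ₗ[A] D)) := by
  have : Module.Finite A C := hC.finite
  have : Module.Finite A D := hD.finite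
  exact isSemidualizing_hom (hasInjectiveDimensionLE_iff_extV.mp hDn) hD.ext_eq_zero
    hD.homothety_bijective (hC.extV_dualizing hd hd' hD hDn) hC

/-- If the dual of a semidualizing module with respect to a dualizing module has finite injective
dimension, then the semidualizing module is free. -/
theorem IsSemidualizing.free_of_hom_injDimLE {m : ℕ}
    (h : HasInjectiveDimensionLE (ModuleCat.of A (C →ₗ[A] D)) m) : Module.Free A C := by
  have : Module.Finite A C := hC.finite
  have : Module.Finite A D := hD.finite
  have hE := hC.hom_dualizing hd hd' hD hDn
  have hDW := hasInjectiveDimensionLE_iff_extV.mp hDn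
  -- Write `C† = Hom(C, D)` and `μ` for the minimal number of generators. From `C ⊗ C† ≅ D` and `D ⊗
  -- Hom(D, C†) ≅ C†` one gets `μ(D) = μ(D) μ(C) μ(Hom(D, C†))`, so `μ(C) = 1`.
  obtain ⟨e₁⟩ := hC.nonempty_tensor_equiv hDW (hC.extV_dualizing hd hd' hD hDn)
  obtain ⟨e₂⟩ := hD.nonempty_tensor_equiv (hasInjectiveDimensionLE_iff_extV.mp h)
    (hD.extV_dualizing hd hd' hE h)
  have h₁ := (e₁.baseChange A (IsLocalRing.ResidueField A)).finrank_eq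
  have h₂ := (e₂.baseChange A (IsLocalRing.ResidueField A)).finrank_eq
  rw [finrank_residueField_tensor] at h₁ h₂
  have hpos : Module.finrank (IsLocalRing.ResidueField A)
      (IsLocalRing.ResidueField A ⊗[A] D) ≠ 0 := by
    have h0 : Nontrivial D := by
      by_contra h0
      rw [not_nontrivial_iff_subsingleton] at h0
      exact one_ne_zero (hD.homothety_bijective.1
        (LinearMap.ext fun x : D => Subsingleton.elim _ _) :       (1 : A) = 0)
    have : Nontrivial (IsLocalRing.ResidueField A ⊗[A] D) := by
      rw [← not_subsingleton_iff_nontrivial, IsLocalRing.subsingleton_tensorProduct,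
        not_subsingleton_iff_nontrivial]
      exact h0
    exact Module.finrank_pos.ne'
  rw [← h₂, mul_left_comm] at h₁
  have h₃ : _ = 1 := Nat.eq_one_of_mul_eq_one_right (Nat.eq_of_mul_eq_mul_left
    (Nat.pos_of_ne_zero hpos) (h₁.trans (mul_one _).symm))
  obtain ⟨c, hc⟩ := exists_span_singleton_of_finrank_eq_one h₃
  exact free_of_cyclic hC.homothety_bijective.1 hc

end Semidualizing

/-! ### Trivial extensions -/

/-- The trivial extension of a ring by a module. -/
structure TrivExt (A W : Type u) where
  /-- The ring component. -/
  fst : A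
  /-- The module component. -/
  snd : W

namespace TrivExt

variable {A W : Type u}

@[ext]
theorem ext' {x y : TrivExt A W} (h₁ : x.fst = y.fst) (h₂ : x.snd = y.snd) : x = y := by
  cases x
  cases y
  simp_all

variable [CommRing A] [AddCommGroup W]

instance : Zero (TrivExt A W) := ⟨⟨0, 0⟩⟩
instance : One (TrivExt A W) := ⟨⟨1, 0⟩⟩
instance : Add (TrivExt A W) := ⟨fun x y => ⟨x.fst + y.fst, x.snd + y.snd⟩⟩
instance : Neg (TrivExt A W) := ⟨fun x => ⟨-x.fst, -x.snd⟩⟩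

@[simp] theorem fst_zero : (0 : TrivExt A W).fst = 0 := rfl
@[simp] theorem snd_zero : (0 : TrivExt A W).snd = 0 := rfl
@[simp] theorem fst_one : (1 : TrivExt A W).fst = 1 := rfl
@[simp] theorem snd_one : (1 : TrivExt A W).snd = 0 := rfl
@[simp] theorem fst_add (x y : TrivExt A W) : (x + y).fst = x.fst + y.fst := rfl
@[simp] theorem snd_add (x y : TrivExt A W) : (x + y).snd = x.snd + y.snd := rfl

variable [Module A W]

instance : Mul (TrivExt A W) := ⟨fun x y => ⟨x.fst * y.fst, x.fst • y.snd + y.fst • x.snd⟩⟩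

@[simp] theorem fst_mul (x y : TrivExt A W) : (x * y).fst = x.fst * y.fst := rfl
@[simp] theorem snd_mul (x y : TrivExt A W) :
    (x * y).snd = x.fst • y.snd + y.fst • x.snd := rfl

instance : CommRing (TrivExt A W) where
  add_assoc x y z := ext' (add_assoc _ _ _) (add_assoc _ _ _)
  zero_add x := ext' (zero_add _) (zero_add _)
  add_zero x := ext' (add_zero _) (add_zero _)
  add_comm x y := ext' (add_comm _ _) (add_comm _ _)
  neg_add_cancel x := ext' (neg_add_cancel _) (neg_add_cancel _)
  nsmul := nsmulRec
  zsmul := zsmulRec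
  mul_assoc x y z := ext' (mul_assoc _ _ _) (by
    simp only [fst_mul, snd_mul, smul_add, mul_smul]
    rw [smul_comm z.fst x.fst, smul_comm z.fst y.fst]
    abel)
  one_mul x := ext' (one_mul _) (by simp)
  mul_one x := ext' (mul_one _) (by simp)
  zero_mul x := ext' (zero_mul _) (by simp)
  mul_zero x := ext' (mul_zero _) (by simp)
  left_distrib x y z := ext' (mul_add _ _ _) (by simp [add_smul, smul_add]; abel)
  right_distrib x y z := ext' (add_mul _ _ _) (by simp [add_smul, smul_add]; abel)
  mul_comm x y := ext' (mul_comm _ _) (by simp [add_comm])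

instance : Algebra A (TrivExt A W) where
  smul a x := ⟨a * x.fst, a • x.snd⟩
  algebraMap :=
    { toFun := fun a => ⟨a, 0⟩
      map_one' := rfl
      map_zero' := rfl
      map_mul' := fun a b => ext' rfl (by simp)
      map_add' := fun a b => ext' rfl (by simp) }
  commutes' a x := mul_comm _ _
  smul_def' a x := ext' rfl (show a • x.snd = a • x.snd + x.fst • (0 : W) by simp)

@[simp] theorem fst_smul (a : A) (x : TrivExt A W) : (a • x).fst = a * x.fst := rfl
@[simp] theorem snd_smul (a : A) (x : TrivExt A W) : (a • x).snd = a • x.snd := rfl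
@[simp] theorem fst_algebraMap (a : A) : (algebraMap A (TrivExt A W) a).fst = a := rfl
@[simp] theorem snd_algebraMap (a : A) : (algebraMap A (TrivExt A W) a).snd = 0 := rfl

variable (A W)

/-- The projection of a trivial extension onto the ring. -/
def fstHom : TrivExt A W →+* A where
  toFun := fst
  map_one' := rfl
  map_mul' _ _ := rfl
  map_zero' := rfl
  map_add' _ _ := rfl

/-- A trivial extension is a product as a module over the ring. -/
def prodEquiv : (A × W) ≃ₗ[A] TrivExt A W where
  toFun x := ⟨x.1, x.2⟩
  invFun x := (x.fst, x.snd)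
  map_add' _ _ := rfl
  map_smul' _ _ := rfl

/-- The inclusion of the module in the trivial extension. -/
def inr : W →ₗ[A] TrivExt A W := prodEquiv A W ∘ₗ LinearMap.inr A A W

/-- The projection of the trivial extension onto the module. -/
def sndHom : TrivExt A W →ₗ[A] W := LinearMap.snd A A W ∘ₗ (prodEquiv A W).symm.toLinearMap

variable {A W}

@[simp] theorem fst_inr (w : W) : (inr A W w).fst = 0 := rfl
@[simp] theorem snd_inr (w : W) : (inr A W w).snd = w := rfl

theorem mul_inr (x : TrivExt A W) (w : W) : x * inr A W w = inr A W (x.fst • w) :=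
  ext' (by simp) (by simp)

theorem fstHom_surjective : Function.Surjective (fstHom A W) := fun a => ⟨algebraMap A _ a, rfl⟩

instance : Algebra (TrivExt A W) A := (fstHom A W).toAlgebra

theorem smul_def (x : TrivExt A W) (a : A) : x • a = x.fst * a := rfl


instance : IsScalarTower A (TrivExt A W) A := ⟨fun a x b => by simp [smul_def, mul_assoc]⟩

instance [Module.Finite A W] : Module.Finite A (TrivExt A W) :=
  Module.Finite.equiv (prodEquiv A W)

theorem isNoetherianRing [IsNoetherianRing A] [Module.Finite A W] :
    IsNoetherianRing (TrivExt A W) :=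
  IsNoetherianRing.of_finite A _

instance : IsLocalHom (fstHom A W) where
  map_nonunit x hx := by
    obtain ⟨b, hb⟩ := hx.exists_right_inv
    refine IsUnit.of_mul_eq_one ⟨b, -((b * b) • x.snd)⟩ (ext' hb ?_)
    have hb' : x.fst * b = 1 := hb
    simp only [snd_mul, snd_one, smul_neg, smul_smul, ← mul_assoc, hb', one_mul]
    exact neg_add_cancel _

instance : IsLocalHom (algebraMap A (TrivExt A W)) where
  map_nonunit _ ha := ha.map (fstHom A W)

theorem isLocalRing [IsLocalRing A] : IsLocalRing (TrivExt A W) :=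
  RingHom.domain_isLocalRing (fstHom A W)

/-- Every prime contains the square-zero ideal `0 ⋉ W`, so it is determined by its contraction to
`A`. -/
theorem ringKrullDim_eq : ringKrullDim (TrivExt A W) = ringKrullDim A := by
  refine le_antisymm ?_ (ringKrullDim_le_of_surjective _ fstHom_surjective)
  refine Order.krullDim_le_of_strictMono (PrimeSpectrum.comap (algebraMap A (TrivExt A W))) ?_
  have hmem : ∀ (p : PrimeSpectrum (TrivExt A W)) (x : TrivExt A W), x ∈ p.asIdeal ↔
      algebraMap A (TrivExt A W) x.fst ∈ p.asIdeal := by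
    intro p x
    have h1 : inr A W x.snd ∈ p.asIdeal := by
      have : inr A W x.snd * inr A W x.snd ∈ p.asIdeal := by
        rw [mul_inr]
        simp
      exact (p.2.mem_or_mem this).elim id id
    have h2 : x = algebraMap A (TrivExt A W) x.fst + inr A W x.snd := ext' (by simp) (by simp)
    conv_lhs => rw [h2]
    exact Ideal.add_mem_iff_left _ h1
  intro p q hpq
  refine lt_of_le_of_ne (fun a ha => hpq.le ha) fun h => hpq.ne ?_
  ext x
  rw [hmem p, hmem q]
  exact Ideal.ext_iff.mp (congrArg PrimeSpectrum.asIdeal h) x.fst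

section Local

variable [IsLocalRing A] [IsNoetherianRing A] [Module.Finite A W]

theorem isCohenMacaulayLocal {d : ℕ} (hd : ringKrullDim A = d) (hA : DepthGE A A d)
    (hW : DepthGE A W d) : IsCohenMacaulayLocal (TrivExt A W) := by
  have := isLocalRing (A := A) (W := W)
  have := isNoetherianRing (A := A) (W := W)
  rw [isCohenMacaulayLocal_iff]
  exact ⟨d, ringKrullDim_eq.trans hd, DepthGE.algebra (A := A) ((hA.prod hW).congr (prodEquiv A W))⟩

end Local

/-- The pairing `(x, y) ↦ snd (x * y)` is perfect: `Hom_A(A ⋉ W, W)` is `W ⊕ Hom(W, W)`, and `Hom(W,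
W) = A`. -/
theorem isCoext_sndHom (hW : Function.Bijective (LinearMap.lsmul A W)) :
    IsCoext (TrivExt A W) (sndHom A W) := by
  have key : ∀ x y : TrivExt A W,
      (CoextHom.lift (B := TrivExt A W) (sndHom A W) x).toHom y = y.fst • x.snd + x.fst • y.snd :=
    fun x y => CoextHom.lift_apply ..
  constructor
  · rw [injective_iff_map_eq_zero]
    intro x hx
    have h1 : ∀ y : TrivExt A W, y.fst • x.snd + x.fst • y.snd = 0 := fun y => by
      rw [← key, hx]
      rfl
    refine ext' ((injective_iff_map_eq_zero _).mp hW.1 _ (LinearMap.ext fun w => ?_)) ?_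
    · simpa using h1 (inr A W w)
    · simpa using h1 1
  · intro φ
    obtain ⟨a, ha⟩ := hW.2 (φ.toHom ∘ₗ inr A W)
    refine ⟨⟨a, φ.toHom 1⟩, ?_⟩
    change (_ : TrivExt A W →ₗ[A] W) = _
    refine LinearMap.ext fun y => (key _ y).trans ?_
    have h1 : a • y.snd = φ.toHom (inr A W y.snd) := LinearMap.congr_fun ha y.snd
    have h2 : y = y.fst • 1 + inr A W y.snd := ext' (by simp) (by simp)
    rw [h1]
    change y.fst • φ.toHom 1 + _ = φ.toHom y
    conv_rhs => rw [h2, map_add, map_smul]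

theorem extV_left {N : Type u} [AddCommGroup N] [Module A N] {i : ℕ} (hi : 1 ≤ i)
    (h : ExtV A W N i) : ExtV A (TrivExt A W) N i :=
  ((extV_of_projective' hi).prod h).congr_left (prodEquiv A W)

theorem extV_right {M : Type u} [AddCommGroup M] [Module A M] {i : ℕ}
    (h₁ : ExtV A M A i) (h₂ : ExtV A M W i) : ExtV A M (TrivExt A W) i :=
  (h₁.prod' h₂).congr_right (prodEquiv A W)

/-- A trivial extension of a local ring by a dualizing module is Gorenstein. -/
theorem isGorensteinLocal [IsLocalRing A] [IsNoetherianRing A]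
    (hW : IsDualizing (ModuleCat.of A W)) : IsGorensteinLocal (TrivExt A W) := by
  have : Module.Finite A W := hW.finite
  obtain ⟨n, hn⟩ := hW.finite_injDim
  exact { isLocalRing with
    toIsNoetherian := isNoetherianRing
    finite_injDim := ⟨n, (isCoext_sndHom hW.homothety_bijective).hasInjectiveDimensionLE
      (fun i hi => extV_left hi (hW.ext_eq_zero i hi)) hn⟩ }

section Semidualizing

variable (hW : Function.Injective (LinearMap.lsmul A W))

include hW in
theorem fst_eq_zero {x : TrivExt A W} (h : ∀ w, inr A W w * x = 0) : x.fst = 0 :=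
  (injective_iff_map_eq_zero _).mp hW _ (LinearMap.ext fun w => by
    simpa using congrArg snd (h w))

variable (A W) in
/-- The linear map `a ↦ (0, aw)`. -/
def inrSMul (w : W) : A →ₗ[TrivExt A W] TrivExt A W where
  toFun a := inr A W (a • w)
  map_add' a b := by simp [add_smul]
  map_smul' x a := by
    rw [smul_def, mul_smul, RingHom.id_apply, smul_eq_mul, mul_inr]

theorem linearMap_apply (φ : A →ₗ[TrivExt A W] TrivExt A W) (a : A) : φ a = a • φ 1 := by
  rw [← algebraMap_smul (TrivExt A W) a (φ 1), ← map_smul, smul_def]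
  simp

instance : IsScalarTower A (TrivExt A W) (CoextHom (TrivExt A W) A (TrivExt A W)) where
  smul_assoc a x φ := by
    refine LinearMap.ext fun (b : A) => ?_
    change (a • x) * φ.toHom b = x * φ.toHom (a * b)
    rw [linearMap_apply φ.toHom (a * b), linearMap_apply φ.toHom b, mul_smul, smul_mul_assoc,
      mul_smul_comm, mul_smul_comm, mul_smul_comm]

-- The value of `φ` at `1` is killed by `0 ⋉ W`, hence lies in `0 ⋉ W` because `W` is faithful.
include hW in
theorem linearMap_eq_inrSMul (φ : A →ₗ[TrivExt A W] TrivExt A W) : inrSMul A W (φ 1).snd = φ := by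
  have h1 : (φ 1).fst = 0 := fst_eq_zero hW fun w => by
    rw [← smul_eq_mul, ← map_smul, smul_def, fst_inr, zero_mul, map_zero]
  refine LinearMap.ext fun a => Eq.trans ?_ (linearMap_apply φ a).symm
  refine ext' ?_ rfl
  change 0 = a * (φ 1).fst
  rw [h1, mul_zero]

include hW in
theorem coextHom_equiv : Nonempty (CoextHom (TrivExt A W) A (TrivExt A W) ≃ₗ[A] W) := by
  let f : CoextHom (TrivExt A W) A (TrivExt A W) →ₗ[A] W :=
    { toFun := fun φ => (φ.toHom 1).snd
      map_add' := fun φ ψ => rfl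
      map_smul' := fun a φ => by
        rw [CoextHom.smul_toHom, mul_one, linearMap_apply]
        rfl }
  refine ⟨LinearEquiv.ofBijective f ⟨fun φ ψ h => ?_, fun w => ⟨inrSMul A W w, ?_⟩⟩⟩
  · have h1 := linearMap_eq_inrSMul hW φ.toHom
    have h2 := linearMap_eq_inrSMul hW ψ.toHom
    exact h1.symm.trans ((congrArg (inrSMul A W) h).trans h2)
  · exact one_smul A w

/-- The base of a trivial extension by a semidualizing module is totally reflexive. -/
theorem tr_base (hW : IsSemidualizing (ModuleCat.of A W)) : TR (TrivExt A W) A := by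
  have hco := isCoext_sndHom (A := A) (W := W) hW.homothety_bijective
  have hB : ∀ i, 1 ≤ i → ExtV A (TrivExt A W) W i := fun i hi => extV_left hi (hW.ext_eq_zero i hi)
  have hinj := hW.homothety_bijective.1
  refine ⟨?_, isReflexive_of_forall ?_ ?_, ?_, ?_⟩
  · exact Module.Finite.of_surjective (Algebra.linearMap (TrivExt A W) A) fstHom_surjective
  · intro a ha
    refine (injective_iff_map_eq_zero _).mp hinj a (LinearMap.ext fun w => ?_)
    exact congrArg snd (ha (inrSMul A W w))
  · intro Φ
    have hadd : ∀ w v, inrSMul A W (w + v) = inrSMul A W w + inrSMul A W v := fun w v => by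
      refine LinearMap.ext fun a => ?_
      change inr A W (a • (w + v)) = inr A W (a • w) + inr A W (a • v)
      rw [smul_add, map_add]
    have hsmul : ∀ (a : A) w, inrSMul A W (a • w) = algebraMap A (TrivExt A W) a • inrSMul A W w :=
      fun a w => by
        refine LinearMap.ext fun b => ?_
        change inr A W (b • a • w) = algebraMap A (TrivExt A W) a * inr A W (b • w)
        rw [mul_inr, smul_comm, fst_algebraMap]
    -- Under `Hom(A, A ⋉ W) ≅ W`, the functional `Φ` becomes an endomorphism of `W`, hence
    -- multiplication by a scalar.
    let ψ : W →ₗ[A] W :=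
      { toFun := fun w => (Φ (inrSMul A W w)).snd
        map_add' := fun w v => by rw [hadd, map_add, snd_add]
        map_smul' := fun a w => by
          rw [hsmul, map_smul]
          simp }
    obtain ⟨a, ha⟩ := hW.homothety_bijective.2 ψ
    refine ⟨a, fun μ => ?_⟩
    rw [← linearMap_eq_inrSMul hinj μ]
    refine ext' ?_ (LinearMap.congr_fun ha (μ 1).snd).symm
    refine fst_eq_zero hinj fun w => ?_
    have h0 : inr A W w • inrSMul A W (μ 1).snd = 0 := by
      refine LinearMap.ext fun b => ?_
      change inr A W w * inr A W _ = 0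
      rw [mul_inr, fst_inr, zero_smul, map_zero]
    rw [← smul_eq_mul, ← map_smul, h0, map_zero]
  · exact fun i hi => (hco.extV_iff hB hi).mpr (extV_of_projective' hi)
  · intro i hi
    obtain ⟨e⟩ := coextHom_equiv hinj
    exact (hco.extV_iff (M := CoextHom (TrivExt A W) A (TrivExt A W)) hB hi).mpr
      (ExtV.congr_left (N := W) e.symm (hW.ext_eq_zero i hi))

/-- `W` is the coextension `Hom(A, A ⋉ W)`, so it inherits finite injective dimension from the ring
`A ⋉ W`. -/
theorem exists_injDimLE (hW : IsSemidualizing (ModuleCat.of A W))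
    (h : IsGorensteinLocal (TrivExt A W)) :
    ∃ n : ℕ, HasInjectiveDimensionLE (ModuleCat.of A W) n := by
  obtain ⟨n, hn⟩ := h.finite_injDim
  obtain ⟨e⟩ := coextHom_equiv hW.homothety_bijective.1
  have h1 : HasInjectiveDimensionLE
      (ModuleCat.of A (CoextHom (TrivExt A W) A (TrivExt A W))) n :=
    CoextHom.isCoext_ev.hasInjectiveDimensionLE (tr_base hW).ext hn
  rw [hasInjectiveDimensionLE_iff_extV] at h1
  exact ⟨n, hasInjectiveDimensionLE_iff_extV.mpr fun M _ _ i hi => (h1 M i hi).congr_right e⟩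

end Semidualizing

end TrivExt

/-! ### Dualizing modules over finite algebras and trivial extensions -/

section CoextDualizing

/-- Coextension of a dualizing module along a finite algebra. -/
theorem IsDualizing.coextHom {A B D : Type u} [CommRing A] [CommRing B] [Algebra A B]
    [IsNoetherianRing A] [Module.Finite A B] [AddCommGroup D] [Module A D]
    (hD : IsDualizing (ModuleCat.of A D)) (hB : ∀ i, 1 ≤ i → ExtV A B D i) :
    IsDualizing (ModuleCat.of B (CoextHom A B D)) := by
  obtain ⟨n, hn⟩ := hD.finite_injDim
  have : Module.Finite A D := hD.finite
  have hW := hasInjectiveDimensionLE_iff_extV.mp hn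
  refine ⟨⟨?_, ?_, fun i hi => ?_⟩, n, ?_⟩
  · have h1 : Module.Finite A (CoextHom A B D) := inferInstanceAs (Module.Finite A (B →ₗ[A] D))
    exact Module.Finite.of_restrictScalars_finite A B (CoextHom A B D)
  · have h1 := bidual_bijective hW hD.ext_eq_zero hD.homothety_bijective hB
    have key : ∀ b : B, CoextHom.unlift (LinearMap.lsmul B (CoextHom A B D) b) =
        (LinearMap.applyₗ b : (B →ₗ[A] D) →ₗ[A] D) := fun b => LinearMap.ext fun φ => by
      change (b • φ).toHom 1 = φ.toHom b
      rw [CoextHom.smul_toHom, mul_one]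
    constructor
    · intro b b' h
      refine h1.1 ?_
      change (LinearMap.applyₗ b : (B →ₗ[A] D) →ₗ[A] D) = LinearMap.applyₗ b'
      rw [← key, ← key]
      exact congrArg (CoextHom.unlift (M := CoextHom A B D)) h
    · intro ψ
      let ψ' : CoextHom A B D →ₗ[A] D := CoextHom.unlift (M := CoextHom A B D) (N := D) ψ
      obtain ⟨b, hb⟩ := h1.2 ψ'
      exact ⟨b, CoextHom.unlift_injective ((key b).trans hb)⟩
  · exact (CoextHom.isCoext_ev (A := A) (B := B) (N := D)).extV_iff (M := CoextHom A B D) hB hi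
      |>.mpr (extV_hom (X := B) (K := D) (W := D) hW hD.ext_eq_zero hB i hi)
  · exact (CoextHom.isCoext_ev (A := A) (B := B) (N := D)).hasInjectiveDimensionLE hB hn

/-- Iterated cosyzygies push the degree beyond the injective dimension. -/
theorem TR.extV_of_injDim {S : Type u} [CommRing S] [IsNoetherianRing S] {W : Type u}
    [AddCommGroup W] [Module S W] {n : ℕ}
    (hW : ∀ (M : Type u) [AddCommGroup M] [Module S M] (i : ℕ), n < i → ExtV S M W i)
    {X : Type u} [AddCommGroup X] [Module S X] (hX : TR S X) (i : ℕ) (hi : 1 ≤ i) :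
    ExtV S X W i := by
  suffices H : ∀ m : ℕ, ∀ (X : Type u) [AddCommGroup X] [Module S X], TR S X →
      ∀ i, 1 ≤ i → n < i + m → ExtV S X W i from H (n + 1) X hX i hi (by omega)
  intro m
  induction m with
  | zero => exact fun X _ _ _ i _ h => hW X i h
  | succ m ih =>
    intro X _ _ hX i hi h
    obtain ⟨F, L, _, _, _, _, f, g, _, _, hs, hL⟩ := hX.exists_cosyzygy
    exact hs.extV_left (extV_of_projective' hi) (ih L hL (i + 1) (by omega) (by omega))

theorem TrivExt.lTensor_injective {S W : Type u} [CommRing S] [AddCommGroup W] [Module S W]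
    {X Y : Type u} [AddCommGroup X] [Module S X] [AddCommGroup Y] [Module S Y] {f : X →ₗ[S] Y}
    (hf : Function.Injective f) (hW : Function.Injective (f.rTensor W)) :
    Function.Injective (f.lTensor (TrivExt S W)) := by
  rw [LinearMap.lTensor_inj_iff_rTensor_inj]
  have h1 : Function.Injective (f.rTensor S) :=
    Module.Flat.rTensor_preserves_injective_linearMap f hf
  let e := fun (Z : Type u) [AddCommGroup Z] [Module S Z] =>
    (TensorProduct.congr (LinearEquiv.refl S Z) (TrivExt.prodEquiv S W).symm) ≪≫ₗ
      TensorProduct.prodRight S S Z S W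
  have h2 : ∀ t, e Y (f.rTensor (TrivExt S W) t) = Prod.map (f.rTensor S) (f.rTensor W) (e X t) := by
    intro t
    induction t with
    | zero => simp [Prod.map, Prod.zero_eq_mk]
    | add x y hx hy =>
      simp only [map_add, hx, hy, Prod.map, Prod.fst_add, Prod.snd_add, Prod.mk_add_mk]
    | tmul x y => simp [e]
  have h3 : e Y ∘ f.rTensor (TrivExt S W) = Prod.map (f.rTensor S) (f.rTensor W) ∘ e X := funext h2
  refine Function.Injective.of_comp (f := e Y) ?_
  rw [h3]
  exact (h1.prodMap hW).comp (e X).injective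

end CoextDualizing

/-! ### Invariance under ring isomorphisms -/

section RingEquiv

attribute [local instance] RingHomInvPair.of_ringEquiv

variable {A B : Type u} [CommRing A] [CommRing B]

theorem IsGorensteinLocal.of_ringEquiv (e : A ≃+* B) (h : IsGorensteinLocal A) :
    IsGorensteinLocal B := by
  have := h.toIsLocalRing
  have := h.toIsNoetherian
  obtain ⟨n, hn⟩ := h.finite_injDim
  have hB : IsNoetherianRing B := isNoetherianRing_of_ringEquiv A e
  exact { e.isLocalRing with
    toIsNoetherian := hB
    finite_injDim := ⟨n, (ModuleCat.hasInjectiveDimensionLE_iff_of_semiLinearEquiv e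
      (M := ModuleCat.of A A) (N := ModuleCat.of B B)
      { e with map_smul' := fun a x => map_mul e a x } n).mp hn⟩ }

theorem IsCohenMacaulayLocal.of_ringEquiv (e : A ≃+* B) (h : IsCohenMacaulayLocal A) :
    IsCohenMacaulayLocal B := by
  have := h.toIsLocalRing
  have : IsNoetherianRing A := h.toIsNoetherian
  have : IsNoetherianRing B := isNoetherianRing_of_ringEquiv A e
  have : IsLocalRing B := e.isLocalRing
  obtain ⟨d, hd, hA⟩ := isCohenMacaulayLocal_iff.mp h
  let _ : Algebra A B := e.toRingHom.toAlgebra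
  have : IsLocalHom (algebraMap A B) := inferInstanceAs (IsLocalHom (e : A →+* B))
  let e' : A ≃ₗ[A] B := LinearEquiv.ofBijective (Algebra.linearMap A B) e.bijective
  have : Module.Finite A B := Module.Finite.equiv e'
  exact isCohenMacaulayLocal_iff.mpr ⟨d, (ringKrullDim_eq_of_ringEquiv e).symm.trans hd,
    (hA.congr e').algebra⟩

end RingEquiv

/-! ### The Gorenstein ring and its two ideals -/

section DoubleExt

variable (R C D : Type u) [CommRing R] [AddCommGroup C] [Module R C] [AddCommGroup D] [Module R D]

/-- The trivial extension of `R ⋉ C` by the coextension of `D`. -/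
abbrev DoubleExt : Type u := TrivExt (TrivExt R C) (CoextHom R (TrivExt R C) D)

/-- The projection of the double extension onto `R ⋉ Hom(C, D)`. -/
def resHom : DoubleExt R C D →+* TrivExt R (C →ₗ[R] D) where
  toFun q := ⟨q.fst.fst, q.snd.toHom ∘ₗ TrivExt.inr R C⟩
  map_one' := rfl
  map_zero' := rfl
  map_add' _ _ := rfl
  map_mul' p q := TrivExt.ext' rfl <| LinearMap.ext fun c => by
    have h : ∀ (s : TrivExt R C) (φ : CoextHom R (TrivExt R C) D),
        (s • φ).toHom (TrivExt.inr R C c) = s.fst • φ.toHom (TrivExt.inr R C c) := fun s φ => by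
      rw [CoextHom.smul_toHom, TrivExt.mul_inr, map_smul, map_smul]
    change (p.fst • q.snd).toHom (TrivExt.inr R C c) + (q.fst • p.snd).toHom (TrivExt.inr R C c) = _
    rw [h, h]
    rfl

variable {R C D}

theorem resHom_surjective : Function.Surjective (resHom R C D) := fun x =>
  ⟨⟨algebraMap R _ x.fst, (x.snd ∘ₗ TrivExt.sndHom R C : TrivExt R C →ₗ[R] D)⟩, rfl⟩

theorem mem_ker_resHom {q : DoubleExt R C D} : q ∈ RingHom.ker (resHom R C D) ↔
    q.fst.fst = 0 ∧ ∀ c, q.snd.toHom (TrivExt.inr R C c) = 0 := by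
  rw [RingHom.mem_ker]
  constructor
  · intro h
    exact ⟨congrArg TrivExt.fst h, fun c => LinearMap.congr_fun (congrArg TrivExt.snd h) c⟩
  · rintro ⟨h1, h2⟩
    exact TrivExt.ext' h1 (LinearMap.ext h2)

theorem mem_ker_fstHom {q : DoubleExt R C D} :
    q ∈ RingHom.ker (TrivExt.fstHom (TrivExt R C) (CoextHom R (TrivExt R C) D)) ↔ q.fst = 0 :=
  RingHom.mem_ker

variable (R C D) in
/-- The projection of the double extension onto `R`. -/
def baseHom : DoubleExt R C D →+* R := (TrivExt.fstHom R C).comp (TrivExt.fstHom _ _)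

theorem ker_baseHom : RingHom.ker (baseHom R C D) = RingHom.ker (resHom R C D) ⊔
    RingHom.ker (TrivExt.fstHom (TrivExt R C) (CoextHom R (TrivExt R C) D)) := by
  apply le_antisymm
  · intro q hq
    rw [RingHom.mem_ker] at hq
    have h1 : q = ⟨q.fst, 0⟩ + ⟨0, q.snd⟩ := TrivExt.ext' (by simp) (by simp)
    rw [h1]
    exact Submodule.add_mem_sup (mem_ker_resHom.mpr ⟨hq, fun c => rfl⟩) (mem_ker_fstHom.mpr rfl)
  · refine sup_le (fun q hq => ?_) fun q hq => ?_
    · exact (mem_ker_resHom.mp hq).1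
    · exact congrArg TrivExt.fst (mem_ker_fstHom.mp hq)

theorem nonempty_ringEquiv_base : Nonempty (R ≃+* DoubleExt R C D ⧸ (RingHom.ker (resHom R C D) ⊔
    RingHom.ker (TrivExt.fstHom (TrivExt R C) (CoextHom R (TrivExt R C) D)))) := by
  have h : Function.Surjective (baseHom R C D) :=
    TrivExt.fstHom_surjective.comp TrivExt.fstHom_surjective
  exact ⟨(RingHom.quotientKerEquivOfSurjective h).symm.trans (Ideal.quotEquivOfEq ker_baseHom)⟩

/-- A map `Q/I₁ → Q/I₂ = R ⋉ C` is an element killed by `I₁`, that is, an element of `0 ⋉ C`; so a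
generator of this Hom module generates `C`. -/
theorem isPrincipal_of_isPrincipal_ext
    (hC : Function.Injective (LinearMap.lsmul R C))
    (h : (⊤ : Submodule (DoubleExt R C D) (Abelian.Ext
      (ModuleCat.of (DoubleExt R C D) (DoubleExt R C D ⧸ RingHom.ker (resHom R C D)))
      (ModuleCat.of (DoubleExt R C D) (DoubleExt R C D ⧸
        RingHom.ker (TrivExt.fstHom (TrivExt R C) (CoextHom R (TrivExt R C) D)))) 0)).IsPrincipal) :
    ∃ c : C, ∀ x, ∃ a : R, a • c = x := by
  set I₁ := RingHom.ker (resHom R C D) with hI₁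
  set I₂ := RingHom.ker (TrivExt.fstHom (TrivExt R C) (CoextHom R (TrivExt R C) D)) with hI₂
  rw [top_isPrincipal_iff] at h
  obtain ⟨a, ha⟩ := h
  obtain ⟨η, rfl⟩ := (Abelian.Ext.mk₀_bijective _ _).2 a
  obtain ⟨m, hm⟩ := Ideal.Quotient.mk_surjective (I := I₂) (η.hom (1 : DoubleExt R C D ⧸ I₁))
  have hm0 : m.fst.fst = 0 := by
    refine TrivExt.fst_eq_zero hC fun c => ?_
    let q : DoubleExt R C D := ⟨TrivExt.inr R C c, 0⟩
    have hq : q ∈ I₁ := mem_ker_resHom.mpr ⟨rfl, fun c => rfl⟩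
    have h1 : Ideal.Quotient.mk I₂ (q * m) = 0 := by
      have h2 : q • (1 : DoubleExt R C D ⧸ I₁) = 0 := by
        rw [Algebra.smul_def, mul_one]
        exact Ideal.Quotient.eq_zero_iff_mem.mpr hq
      have h3 : q • η.hom (1 : DoubleExt R C D ⧸ I₁) = 0 := by
        rw [← map_smul, h2, map_zero]
      rw [← hm] at h3
      exact h3
    exact mem_ker_fstHom.mp (Ideal.Quotient.eq_zero_iff_mem.mp h1)
  refine ⟨m.fst.snd, fun c => ?_⟩
  let q : DoubleExt R C D := ⟨TrivExt.inr R C c, 0⟩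
  have hle : I₁ ≤ LinearMap.ker (LinearMap.toSpanSingleton (DoubleExt R C D)
      (DoubleExt R C D ⧸ I₂) (Ideal.Quotient.mk I₂ q)) := fun p hp => by
    rw [LinearMap.mem_ker, LinearMap.toSpanSingleton_apply]
    refine Ideal.Quotient.eq_zero_iff_mem.mpr (mem_ker_fstHom.mpr ?_)
    change p.fst * TrivExt.inr R C c = 0
    rw [TrivExt.mul_inr, (mem_ker_resHom.mp hp).1, zero_smul, map_zero]
  obtain ⟨p, hp⟩ := ha (Abelian.Ext.mk₀ (ModuleCat.ofHom (Submodule.liftQ I₁ _ hle)))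
  rw [← Abelian.Ext.mk₀_smul] at hp
  have h1 := (Abelian.Ext.mk₀_bijective _ _).1 hp
  have h2 := LinearMap.congr_fun (congrArg ModuleCat.Hom.hom h1) (1 : DoubleExt R C D ⧸ I₁)
  have h3 : p • η.hom (1 : DoubleExt R C D ⧸ I₁) =
      (1 : DoubleExt R C D) • (Ideal.Quotient.mk I₂ q) := h2
  rw [← hm, one_smul] at h3
  have h4 : Ideal.Quotient.mk I₂ (p * m) = Ideal.Quotient.mk I₂ q := h3
  rw [Ideal.Quotient.mk_eq_mk_iff_sub_mem] at h4
  have h5 : p.fst * m.fst - TrivExt.inr R C c = 0 := mem_ker_fstHom.mp h4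
  refine ⟨p.fst.fst, ?_⟩
  have h6 := congrArg TrivExt.snd (sub_eq_zero.mp h5)
  simpa [hm0] using h6

variable [IsNoetherianRing R] (hC : IsSemidualizing (ModuleCat.of R C))
  (hD : IsDualizing (ModuleCat.of R D)) (hCD : ∀ i, 1 ≤ i → ExtV R C D i)

include hC hD hCD

theorem coextHom_trivExt_isDualizing :
    IsDualizing (ModuleCat.of (TrivExt R C) (CoextHom R (TrivExt R C) D)) := by
  have : Module.Finite R C := hC.finite
  exact hD.coextHom fun i hi => TrivExt.extV_left hi (hCD i hi)

/-- Tensor evaluation embeds `R ⊗ W` in `Hom(Hom(R, S), W)`, where `S = R ⋉ C` and `W = Hom_R(S,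
D)`. The maps `R → S` are given by elements of `C`, so a `w` vanishing on `C` evaluates to zero. -/
theorem tmul_one_eq_zero {w : CoextHom R (TrivExt R C) D}
    (hw : ∀ c, w.toHom (TrivExt.inr R C c) = 0) : w ⊗ₜ[TrivExt R C] (1 : R) = 0 := by
  have : Module.Finite R C := hC.finite
  have := TrivExt.isNoetherianRing (A := R) (W := C)
  obtain ⟨n, hn⟩ := (coextHom_trivExt_isDualizing hC hD hCD).finite_injDim
  have hR := TrivExt.tr_base hC
  have := hR.finite
  have h1 := homEval_bijective (A := TrivExt R C) (X := R) (K := TrivExt R C)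
    (hasInjectiveDimensionLE_iff_extV.mp hn) (fun i hi => extV_of_projective' hi) hR.ext
  have h2 : (1 : R) ⊗ₜ[TrivExt R C] LinearMap.toSpanSingleton (TrivExt R C) _ w = 0 := by
    apply h1.1
    rw [map_zero]
    refine LinearMap.ext fun φ => ?_
    rw [homEval_tmul, ← TrivExt.linearMap_eq_inrSMul hC.homothety_bijective.1 φ]
    change TrivExt.inr R C ((1 : R) • (φ 1).snd) • w = 0
    refine LinearMap.ext fun x => ?_
    change (TrivExt.inr R C ((1 : R) • (φ 1).snd) • w).toHom x = 0
    rw [CoextHom.smul_toHom, mul_comm, TrivExt.mul_inr, hw]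
  have h3 := congrArg (TensorProduct.comm (TrivExt R C) _ _ ∘
    (LinearMap.ringLmapEquivSelf (TrivExt R C) (TrivExt R C)
      (CoextHom R (TrivExt R C) D)).toLinearMap.lTensor R) h2
  simpa using h3

theorem nonempty_quotient_equiv_tensor : Nonempty
    ((DoubleExt R C D ⧸ RingHom.ker (resHom R C D)) ≃ₗ[DoubleExt R C D]
      (DoubleExt R C D ⊗[TrivExt R C] R)) := by
  let f : DoubleExt R C D →ₗ[DoubleExt R C D] DoubleExt R C D ⊗[TrivExt R C] R :=
    LinearMap.toSpanSingleton _ _ (1 ⊗ₜ 1)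
  have hf : ∀ q, f q = q ⊗ₜ 1 := fun q => by
    change q • ((1 : DoubleExt R C D) ⊗ₜ[TrivExt R C] (1 : R)) = _
    rw [TensorProduct.smul_tmul', smul_eq_mul, mul_one]
  have hsurj : Function.Surjective f := by
    intro t
    induction t with
    | zero => exact ⟨0, map_zero f⟩
    | add x y hx hy =>
      obtain ⟨a, rfl⟩ := hx
      obtain ⟨b, rfl⟩ := hy
      exact ⟨a + b, map_add f a b⟩
    | tmul q r =>
      refine ⟨algebraMap R (TrivExt R C) r • q, ?_⟩
      rw [hf, TensorProduct.smul_tmul, TrivExt.smul_def, TrivExt.fst_algebraMap, mul_one]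
  have hker : LinearMap.ker f = RingHom.ker (resHom R C D) := by
    ext q
    rw [LinearMap.mem_ker, hf]
    constructor
    · intro h
      -- This map recovers `resHom q` from `q ⊗ 1`, so the kernel of `f` lies in that of `resHom`.
      let g : DoubleExt R C D ⊗[TrivExt R C] R →+ TrivExt R (C →ₗ[R] D) :=
        TensorProduct.liftAddHom
          ((AddMonoidHom.mul.comp (resHom R C D).toAddMonoidHom).compr₂ (.id _) |>.flip.comp
            (algebraMap R (TrivExt R (C →ₗ[R] D))).toAddMonoidHom |>.flip) (fun s q r => by
            change resHom R C D (s • q) * algebraMap R _ r =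
              resHom R C D q * algebraMap R _ (s.fst * r)
            have h1 : resHom R C D (s • q) = algebraMap R _ s.fst * resHom R C D q := by
              rw [Algebra.smul_def, map_mul]
              rfl
            rw [h1, map_mul]
            ring)
      have h1 := congrArg g h
      rw [map_zero] at h1
      change resHom R C D q * algebraMap R _ 1 = 0 at h1
      rw [RingHom.mem_ker]
      simpa using h1
    · intro h
      obtain ⟨h1, h2⟩ := mem_ker_resHom.mp h
      have h3 : q = q.fst • (1 : DoubleExt R C D) + TrivExt.inr _ _ q.snd :=
        TrivExt.ext' (by simp) (by simp)
      rw [h3, TensorProduct.add_tmul, TensorProduct.smul_tmul, TrivExt.smul_def, h1, zero_mul,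
        TensorProduct.tmul_zero, zero_add]
      have h4 := congrArg ((TrivExt.inr (TrivExt R C) (CoextHom R (TrivExt R C) D)).rTensor R)
        (tmul_one_eq_zero hC hD hCD h2)
      simpa using h4
  exact ⟨(Submodule.quotEquivOfEq _ _ hker).symm ≪≫ₗ f.quotKerEquivOfSurjective hsurj⟩

theorem tateVanishing_doubleExt :
    TateVanishing (ModuleCat.of (DoubleExt R C D) (DoubleExt R C D ⧸ RingHom.ker (resHom R C D)))
      (ModuleCat.of (DoubleExt R C D) (DoubleExt R C D ⧸
        RingHom.ker (TrivExt.fstHom (TrivExt R C) (CoextHom R (TrivExt R C) D)))) ∧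
    TorIndependent (ModuleCat.of (DoubleExt R C D) (DoubleExt R C D ⧸ RingHom.ker (resHom R C D)))
      (ModuleCat.of (DoubleExt R C D) (DoubleExt R C D ⧸
        RingHom.ker (TrivExt.fstHom (TrivExt R C) (CoextHom R (TrivExt R C) D)))) := by
  have : Module.Finite R C := hC.finite
  have := TrivExt.isNoetherianRing (A := R) (W := C)
  obtain ⟨n, hn⟩ := (coextHom_trivExt_isDualizing hC hD hCD).finite_injDim
  have hW := hasInjectiveDimensionLE_iff_extV.mp hn
  obtain ⟨e⟩ := nonempty_quotient_equiv_tensor hC hD hCD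
  let I₂ := RingHom.ker (TrivExt.fstHom (TrivExt R C) (CoextHom R (TrivExt R C) D))
  let e₂ : TrivExt R C ≃ₗ[TrivExt R C] DoubleExt R C D ⧸ I₂ :=
    LinearEquiv.ofBijective (Algebra.linearMap (TrivExt R C) (DoubleExt R C D ⧸ I₂)) (by
      constructor
      · rw [injective_iff_map_eq_zero]
        intro s hs
        exact mem_ker_fstHom.mp (Ideal.Quotient.eq_zero_iff_mem.mp hs)
      · intro x
        obtain ⟨q, rfl⟩ := Ideal.Quotient.mk_surjective x
        refine ⟨q.fst, (Ideal.Quotient.mk_eq_mk_iff_sub_mem _ _).mpr (mem_ker_fstHom.mpr ?_)⟩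
        exact sub_self q.fst)
  have : Module.Flat (TrivExt R C) (DoubleExt R C D ⧸ I₂) := Module.Flat.of_linearEquiv e₂.symm
  refine tateVanishing_baseChange (S := TrivExt R C) (Q := DoubleExt R C D)
    (N := DoubleExt R C D ⧸ I₂) ?_ ?_ ?_ (TrivExt.tr_base hC) e
  · intro K F X f g hs _ _ hX
    refine TrivExt.lTensor_injective hs.inj ?_
    -- Taking `K = S`, so that `Hom(S, W) = W`, gives Tor-independence of `W` and the totally
    -- reflexive `X`.
    have h1 := rTensor_hom_injective (K := TrivExt R C) hW (fun i hi => extV_of_projective' hi) hs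
      hX.ext
    let e₃ := (LinearMap.ringLmapEquivSelf (TrivExt R C) (TrivExt R C)
      (CoextHom R (TrivExt R C) D)).symm
    refine Function.Injective.of_comp (f := e₃.toLinearMap.lTensor F) ?_
    rw [← LinearMap.coe_comp, LinearMap.lTensor_comp_rTensor, ← LinearMap.rTensor_comp_lTensor,
      LinearMap.coe_comp]
    exact h1.comp (LinearEquiv.lTensor K e₃).injective
  · exact fun X hX => TrivExt.extV_right (hX.ext 1 le_rfl) (hX.extV_of_injDim hW 1 le_rfl)
  · exact fun X hX => (hX.ext 1 le_rfl).congr_right e₂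

end DoubleExt

/-- A Cohen–Macaulay local ring with a dualizing module and a semidualizing module that is neither
dualizing nor free is presented by a Gorenstein ring and a pair of independent ideals. -/
theorem exists_isIndependentPresentation {R : Type u} [CommRing R] (hR : IsCohenMacaulayLocal R)
    {C D : Type u} [AddCommGroup C] [Module R C] [AddCommGroup D] [Module R D]
    (hD : IsDualizing (ModuleCat.of R D)) (hC : IsSemidualizing (ModuleCat.of R C))
    (hCD : ¬ IsDualizing (ModuleCat.of R C)) (hf : ¬ Module.Free R C) :
    IsIndependentPresentation R (DoubleExt R C D) (RingHom.ker (resHom R C D))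
      (RingHom.ker (TrivExt.fstHom (TrivExt R C) (CoextHom R (TrivExt R C) D))) := by
  have := hR.toIsLocalRing
  have : IsNoetherianRing R := hR.toIsNoetherian
  have : Module.Finite R C := hC.finite
  have : Module.Finite R D := hD.finite
  have := TrivExt.isNoetherianRing (A := R) (W := C)
  have := TrivExt.isLocalRing (A := R) (W := C)
  obtain ⟨d, hdim, hd⟩ := isCohenMacaulayLocal_iff.mp hR
  have hd' : ¬ DepthGE R R (d + 1) := fun h => by
    have h1 := h.le_ringKrullDim
    rw [hdim] at h1
    exact absurd (Nat.cast_le.mp (by exact_mod_cast h1)) (Nat.not_succ_le_self d)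
  obtain ⟨n, hn⟩ := hD.finite_injDim
  have hext := hC.extV_dualizing hd hd' hD.toIsSemidualizing hn
  have hC' := hC.hom_dualizing hd hd' hD.toIsSemidualizing hn
  obtain ⟨hT, hT'⟩ := tateVanishing_doubleExt hC hD hext
  let e₁ := RingHom.quotientKerEquivOfSurjective (resHom_surjective (R := R) (C := C) (D := D))
  let e₂ := RingHom.quotientKerEquivOfSurjective
    (TrivExt.fstHom_surjective (A := TrivExt R C) (W := CoextHom R (TrivExt R C) D))
  exact {
    gorenstein := TrivExt.isGorensteinLocal (coextHom_trivExt_isDualizing hC hD hext)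
    ringEquiv := nonempty_ringEquiv_base
    cohenMacaulay₁ := (TrivExt.isCohenMacaulayLocal hdim hd (hC'.depthGE hd)).of_ringEquiv e₁.symm
    cohenMacaulay₂ := (TrivExt.isCohenMacaulayLocal hdim hd (hC.depthGE hd)).of_ringEquiv e₂.symm
    not_gorenstein₁ := fun h => by
      obtain ⟨m, hm⟩ := TrivExt.exists_injDimLE hC' (h.of_ringEquiv e₁)
      exact hf (hC.free_of_hom_injDimLE hd hd' hD.toIsSemidualizing hn hm)
    not_gorenstein₂ := fun h => hCD ⟨hC, TrivExt.exists_injDimLE hC (h.of_ringEquiv e₂)⟩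
    tate_eq_zero := hT
    ext_not_cyclic := ⟨0, fun h => by
      obtain ⟨c, hc⟩ := isPrincipal_of_isPrincipal_ext hC.homothety_bijective.1 h
      exact hf (free_of_cyclic hC.homothety_bijective.1 hc)⟩
    tor_eq_zero := hT' }

end SemidualizingPresentation

theorem theorem1p1 (R : Type u) [CommRing R] (hR : IsCohenMacaulayLocal R)
    (hD : ∃ D : ModuleCat.{u} R, IsDualizing D) :
    ((∃ C : ModuleCat.{u} R, IsSemidualizing C ∧ ¬ IsDualizing C ∧ ¬ Module.Free R C) ↔
      ∃ (Q : Type u) (_ : CommRing Q) (I₁ I₂ : Ideal Q), IsIndependentPresentation R Q I₁ I₂) ∧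
    ∀ (Q : Type u) [CommRing Q] (I₁ I₂ : Ideal Q),
      IsIndependentPresentation R Q I₁ I₂ → I₁ ⊓ I₂ = I₁ * I₂ := by
  refine ⟨⟨?_, ?_⟩, fun Q _ I₁ I₂ h => h.tor_eq_zero.inf_eq_mul⟩
  · rintro ⟨C, hC, hCD, hf⟩
    obtain ⟨D, hD⟩ := hD
    exact ⟨_, _, _, _, exists_isIndependentPresentation (C := C) (D := D) hR hD hC hCD hf⟩
  · rintro ⟨Q, _, I₁, I₂, h⟩
    exact exists_semidualizing_of_isIndependentPresentation hR h
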